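/- Let $M$ be a smooth supermanifold (with Hausdorff, second countable underlying space) with local coordinates $x^a$, where $\tilde a\in\mathbb Z/2$ denotes the parity of $x^a$. Let $\Pi TM$ and $\Pi T^*M$ be the tangent and cotangent bundles with reversed parity in the fibers, with fiber coordinates $dx^a$ and $x^*_a$ of parity $\tilde a+1$ and transformation laws $$dx^a=\sum_{a'}dx^{a'}\,\frac{\partial x^a}{\partial x^{a'}},\qquad x^*_a=\sum_{a'}\frac{\partial x^{a'}}{\partial x^a}\,x^*_{a'} .$$ All derivatives are left derivatives. We say that a smooth map defined on $\Pi T^*M$ (or $\Pi TM$) is a diffeomorphism near the zero section if it restricts to a diffeomorphism from some open neighbourhood of the zero section onto an open sub-supermanifold of the target. (1) Let $P\in C^\infty(\Pi T^*M)$ be an even function. The formulas $\varphi_P^*(x^a)=x^a$, $\varphi_P^*(dx^a)=(-1)^{\tilde a+1}\,\partial P/\partial x^*_a$ give a well-defined smooth map $\varphi_P\colon \Pi T^*M\to\Pi TM$ over $M$. If the matrix $\left(\frac{\partial^2P}{\partial x^*_a\partial x^*_b}\right)$ is invertible at $x^*=0$ (at all points of $M$), then $\varphi_P$ is a diffeomorphism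 near the zero section. (2) Let $\omega\in C^\infty(\Pi TM)$ be an even function, that is, an even (pseudo)differential form. The formulas $\psi_\omega^*(x^a)=x^a$, $\psi_\omega^*(x^*_a)=\partial\omega/\partial dx^a$ give a well-defined smooth map $\psi_\omega\colon\Pi TM\to\Pi T^*M$ over $M$. It is a diffeomorphism near the zero section if and only if the matrix $\left(\frac{\partial^2\omega}{\partial dx^a\partial dx^b}\right)$ is invertible at $dx=0$ (at all points of $M$). -/

import Mathlib

universe u v w

noncomputable section

namespace Super

/-! ## Grassmann algebras -/

/-- The Grassmann algebra over `ℝ` on generators `ξ_o`, `o ∈ O`. -/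
abbrev Gr (O : Type*) : Type _ := ExteriorAlgebra ℝ (O → ℝ)

instance instFiniteGr {O : Type*} [Finite O] : Module.Finite ℝ (Gr O) := by
  classical
  let : LinearOrder O := linearOrderOfSTO WellOrderingRel
  cases nonempty_fintype O
  exact Module.Finite.of_basis (Pi.basisFun ℝ O).ExteriorAlgebra

/-- The finite-dimensional vector space `Gr O` with the norm read off from a basis.
All norms on it are equivalent, so smoothness and derivatives do not depend on the choice. -/
instance instNormedGr {O : Type*} [Finite O] : NormedAddCommGroup (Gr O) :=
  NormedAddCommGroup.induced _ _ (Module.finBasis ℝ (Gr O)).equivFun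
    (Module.finBasis ℝ (Gr O)).equivFun.injective

instance instNormedSpaceGr {O : Type*} [Finite O] : NormedSpace ℝ (Gr O) :=
  NormedSpace.induced ℝ _ _ (Module.finBasis ℝ (Gr O)).equivFun

/-- The body (the degree zero part) of an element of the Grassmann algebra. -/
def body {O : Type*} : Gr O →ₐ[ℝ] ℝ := ExteriorAlgebra.algebraMapInv

/-- The homogeneous elements of parity `e`. -/
def parityPart {O : Type*} (e : ZMod 2) : Submodule ℝ (Gr O) :=
  CliffordAlgebra.evenOdd (0 : QuadraticForm ℝ (O → ℝ)) e

/-! ## Superdomains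

Coordinates `x^a` are indexed by a finite type `A`, and `par a` is the parity of `x^a`. -/

/-- Index set of the even coordinates. -/
abbrev EvIx {A : Type*} (par : A → ZMod 2) : Type _ := {a : A // par a = 0}

/-- Index set of the odd coordinates. -/
abbrev OdIx {A : Type*} (par : A → ZMod 2) : Type _ := {a : A // par a = 1}

/-- The space of values of the even coordinates. -/
abbrev Ev {A : Type*} (par : A → ZMod 2) : Type _ := EvIx par → ℝ

/-- Superfunctions `∑ f_I(x) ξ^I`, as Grassmann algebra valued functions of the even coordinates.
Smoothness on an open set is required separately, where it is needed. -/
abbrev SFun {A : Type*} (par : A → ZMod 2) : Type _ := Ev par → Gr (OdIx par)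

/-- Coordinate expressions of maps of superdomains: for every target coordinate `y^b`, the
superfunction `F^* y^b`. -/
abbrev SMap {A B : Type*} (par : A → ZMod 2) (_par' : B → ZMod 2) : Type _ := B → SFun par

theorem par_eq_one {p : ZMod 2} (h : p ≠ 0) : p = 1 := by
  revert p; decide

/-- The coordinate `x^a` as a superfunction. -/
def coord {A : Type*} [DecidableEq A] (par : A → ZMod 2) (a : A) : SFun par := fun x =>
  if h : par a = 0 then algebraMap ℝ _ (x ⟨a, h⟩)
  else ExteriorAlgebra.ι ℝ (Pi.single ⟨a, par_eq_one h⟩ 1)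

/-- The (left) partial derivative `∂f/∂x^a`: an ordinary partial derivative for an even coordinate,
the contraction with the dual generator for an odd one. -/
def pd {A : Type*} [Fintype A] [DecidableEq A] {par : A → ZMod 2} (a : A) (f : SFun par) :
    SFun par := fun x =>
  if h : par a = 0 then fderiv ℝ f x (Pi.single ⟨a, h⟩ 1)
  else CliffordAlgebra.contractLeft (Q := (0 : QuadraticForm ℝ (OdIx par → ℝ)))
    (LinearMap.proj ⟨a, par_eq_one h⟩) (f x)

/-- Smoothness on `U`, with every `F^* y^b` of the parity of the coordinate `y^b`. -/
structure SmoothOn {A B : Type*} [Fintype A] {par : A → ZMod 2} {par' : B → ZMod 2}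
    (F : SMap par par') (U : Set (Ev par)) : Prop where
  smooth : ∀ b, ContDiffOn ℝ (⊤ : ℕ∞) (F b) U
  parity : ∀ b, ∀ x ∈ U, F b x ∈ parityPart (par' b)

section Pullback

variable {A : Type v} {B : Type w} {par : A → ZMod 2} {par' : B → ZMod 2}

/-- The underlying map `U → ℝ^p` of a map of superdomains. -/
def bodyMap (F : SMap par par') (x : Ev par) : Ev par' := fun b => body (F b x)

/-- The nilpotent parts of the components `F^* y^b`, `y^b` even. -/
def soul (F : SMap par par') (x : Ev par) (b : EvIx par') : Gr (OdIx par) :=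
  F b x - algebraMap ℝ _ (bodyMap F x b)

/-- The linear map that sends the generator `η^b` to `F^* η^b`, at the point `x`. -/
def oddVec [Fintype B] (F : SMap par par') (x : Ev par) :
    (OdIx par' → ℝ) →ₗ[ℝ] Gr (OdIx par) :=
  Fintype.linearCombination ℝ fun b : OdIx par' => F b x

open Classical in
/-- The algebra homomorphism that substitutes `F^* η^b` for the odd coordinates `η^b`, at the
point `x`. It exists if the `F^* η^b` are odd (and is replaced by `0` if it does not exist). -/
def oddSubst [Fintype B] (F : SMap par par') (x : Ev par) :
    Gr (OdIx par') →ₗ[ℝ] Gr (OdIx par) :=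
  if h : ∀ m, oddVec F x m * oddVec F x m = 0 then
    (ExteriorAlgebra.lift ℝ ⟨oddVec F x, h⟩).toLinearMap
  else 0

/-- The operator `∑_b n^b ∂/∂y^b`, for constant `n^b`. -/
def taylorStep [Fintype B] [DecidableEq B] {O : Type*} [Finite O] (n : EvIx par' → Gr O)
    (H : Ev par' → Gr O) : Ev par' → Gr O :=
  fun y => ∑ b, n b * fderiv ℝ H y (Pi.single b 1)

/-- The pullback `F^* G` of a superfunction `G` by a map of superdomains: the coordinates `y^b` in
`G` are replaced by `F^* y^b`, which for the even ones means the Taylor expansion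
`G(y + n) = ∑_k (∑_b n^b ∂_b)^k G(y) / k!` with `y` the body of `F` and `n` the nilpotent part.
The omitted terms of order greater than the number of odd coordinates vanish. -/
def pull [Fintype A] [Fintype B] [DecidableEq B] (F : SMap par par') (G : SFun par') :
    SFun par := fun x =>
  ∑ k ∈ Finset.range (Fintype.card A + 1), ((k.factorial : ℝ))⁻¹ •
    ((taylorStep (soul F x))^[k] fun y => oddSubst F x (G y)) (bodyMap F x)

end Pullback

/-! ## Supermanifolds -/

/-- Gluing data for a supermanifold with coordinates of parities `par`: open sets `dom i` of the
even coordinate space (the coordinate superdomains), the parts `overlap i j ⊆ dom i` that are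
glued to parts of `dom j`, and the coordinate changes `trans i j`, that is, the coordinates of
the chart `j` as superfunctions of those of the chart `i`, on `overlap i j`. -/
structure SuperAtlas {A : Type v} (par : A → ZMod 2) where
  ι : Type u
  dom : ι → Set (Ev par)
  overlap : ι → ι → Set (Ev par)
  trans : ι → ι → SMap par par

namespace SuperAtlas

variable {A : Type v} {par : A → ZMod 2}

/-- The underlying topological space: the chart domains glued along the bodies of the coordinate
changes, with the quotient topology. -/
def Body (M : SuperAtlas.{u} par) : Type (max u v) :=
  Quot fun p q : (Σ i, M.dom i) =>
    p.2.1 ∈ M.overlap p.1 q.1 ∧ bodyMap (M.trans p.1 q.1) p.2.1 = q.2.1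

instance (M : SuperAtlas.{u} par) : TopologicalSpace M.Body :=
  inferInstanceAs (TopologicalSpace (Quot _))

/-- The gluing data define a smooth supermanifold. -/
structure IsSupermanifold [Fintype A] [DecidableEq A] (M : SuperAtlas.{u} par) : Prop where
  isOpen_dom : ∀ i, IsOpen (M.dom i)
  isOpen_overlap : ∀ i j, IsOpen (M.overlap i j)
  overlap_subset : ∀ i j, M.overlap i j ⊆ M.dom i
  smooth : ∀ i j, SmoothOn (M.trans i j) (M.overlap i j)
  mapsTo : ∀ i j, Set.MapsTo (bodyMap (M.trans i j)) (M.overlap i j) (M.overlap j i)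
  overlap_self : ∀ i, M.overlap i i = M.dom i
  trans_self : ∀ i a, ∀ x ∈ M.dom i, M.trans i i a x = coord par a x
  cocycle : ∀ i j k, ∀ x ∈ M.overlap i j, bodyMap (M.trans i j) x ∈ M.overlap j k →
    x ∈ M.overlap i k ∧ ∀ a, pull (M.trans i j) (M.trans j k a) x = M.trans i k a x
  t2 : T2Space M.Body
  secondCountable : SecondCountableTopology M.Body

/-- `f i` are the coordinate expressions of an even global function. -/
structure IsEvenFunction [Fintype A] [DecidableEq A] (M : SuperAtlas.{u} par)
    (f : M.ι → SFun par) : Prop where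
  smooth : ∀ i, ContDiffOn ℝ (⊤ : ℕ∞) (f i) (M.dom i)
  even : ∀ i, ∀ x ∈ M.dom i, f i x ∈ parityPart 0
  compat : ∀ i j, ∀ x ∈ M.overlap i j, pull (M.trans i j) (f j) x = f i x

/-- An open subset of the underlying space, through its traces in the charts. -/
structure OpenSub (M : SuperAtlas.{u} par) where
  carrier : M.ι → Set (Ev par)
  isOpen : ∀ i, IsOpen (carrier i)
  subset : ∀ i, carrier i ⊆ M.dom i
  compat : ∀ i j, ∀ x ∈ M.overlap i j,
    x ∈ carrier i ↔ bodyMap (M.trans i j) x ∈ carrier j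

/-- The restriction of a supermanifold to an open subset. -/
def restrict (M : SuperAtlas.{u} par) (W : M.OpenSub) : SuperAtlas.{u} par where
  ι := M.ι
  dom := W.carrier
  overlap i j := M.overlap i j ∩ W.carrier i
  trans := M.trans

end SuperAtlas

/-! ## Maps of supermanifolds -/

/-- Local expressions of a map of supermanifolds: a family of maps of superdomains, the `c`-th one
being defined on an open part `dom c` of the chart `src c` of `M`, with values in the chart `tgt c`
of `N`. -/
structure SuperMap {A : Type v} {B : Type w} {par : A → ZMod 2} {par' : B → ZMod 2}
    (M : SuperAtlas.{u} par) (N : SuperAtlas.{u} par') where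
  κ : Type u
  src : κ → M.ι
  tgt : κ → N.ι
  dom : κ → Set (Ev par)
  map : κ → SMap par par'

namespace SuperMap

variable {A : Type v} {B : Type w} {par : A → ZMod 2} {par' : B → ZMod 2}
  {M : SuperAtlas.{u} par} {N : SuperAtlas.{u} par'}

/-- Two families of local expressions agree, up to coordinate changes, wherever both of them are
defined. -/
def Agree [Fintype A] [Fintype B] [DecidableEq A] [DecidableEq B] (φ φ' : SuperMap M N) : Prop :=
  ∀ c c', ∀ x ∈ φ.dom c, x ∈ M.overlap (φ.src c) (φ'.src c') →
    bodyMap (M.trans (φ.src c) (φ'.src c')) x ∈ φ'.dom c' →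
    bodyMap (φ.map c) x ∈ N.overlap (φ.tgt c) (φ'.tgt c') ∧
    ∀ b, pull (φ.map c) (N.trans (φ.tgt c) (φ'.tgt c') b) x =
      pull (M.trans (φ.src c) (φ'.src c')) (φ'.map c' b) x

/-- The family `φ` defines a smooth map of supermanifolds `M → N`: the local expressions are
smooth and parity preserving, their domains cover `M`, and they agree with each other. -/
structure IsMorphism [Fintype A] [Fintype B] [DecidableEq A] [DecidableEq B]
    (φ : SuperMap M N) : Prop where
  isOpen_dom : ∀ c, IsOpen (φ.dom c)
  dom_subset : ∀ c, φ.dom c ⊆ M.dom (φ.src c)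
  cover : ∀ i, ∀ x ∈ M.dom i, ∃ c, x ∈ M.overlap i (φ.src c) ∧
    bodyMap (M.trans i (φ.src c)) x ∈ φ.dom c
  smooth : ∀ c, SmoothOn (φ.map c) (φ.dom c)
  mapsTo : ∀ c, Set.MapsTo (bodyMap (φ.map c)) (φ.dom c) (N.dom (φ.tgt c))
  agree : φ.Agree φ

/-- The identity map. -/
protected def id [DecidableEq A] (M : SuperAtlas.{u} par) : SuperMap M M where
  κ := M.ι
  src := fun i => i
  tgt := fun i => i
  dom := M.dom
  map := fun _ => coord par

/-- The composition `ψ ∘ φ`. -/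
def comp {C : Type*} {par'' : C → ZMod 2} {L : SuperAtlas.{u} par''}
    [Fintype A] [Fintype B] [DecidableEq B] (ψ : SuperMap N L) (φ : SuperMap M N) :
    SuperMap M L where
  κ := φ.κ × ψ.κ
  src c := φ.src c.1
  tgt c := ψ.tgt c.2
  dom c := {x | x ∈ φ.dom c.1 ∧ bodyMap (φ.map c.1) x ∈ N.overlap (φ.tgt c.1) (ψ.src c.2) ∧
    bodyMap (N.trans (φ.tgt c.1) (ψ.src c.2)) (bodyMap (φ.map c.1) x) ∈ ψ.dom c.2}
  map c a := pull (φ.map c.1) (pull (N.trans (φ.tgt c.1) (ψ.src c.2)) (ψ.map c.2 a))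

/-- `φ` is a diffeomorphism: a smooth map with a smooth two-sided inverse. -/
def IsDiffeo [Fintype A] [Fintype B] [DecidableEq A] [DecidableEq B] (φ : SuperMap M N) : Prop :=
  φ.IsMorphism ∧ ∃ ψ : SuperMap N M, ψ.IsMorphism ∧
    (ψ.comp φ).Agree (SuperMap.id M) ∧ (φ.comp ψ).Agree (SuperMap.id N)

/-- The restriction of `φ` to an open subset `W` of `M`, as a map to an open subset `W'` of `N`.
(It is a morphism only if `φ` maps `W` to `W'`.) -/
def restrict (φ : SuperMap M N) (W : M.OpenSub) (W' : N.OpenSub) :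
    SuperMap (M.restrict W) (N.restrict W') where
  κ := φ.κ
  src := φ.src
  tgt := φ.tgt
  dom c := φ.dom c ∩ W.carrier (φ.src c)
  map := φ.map

end SuperMap

/-! ## The parity reversed tangent and cotangent bundles

On both, the coordinates are `x^a` (with index `Sum.inl a`) and fibre coordinates `dx^a`,
respectively `x^*_a` (with index `Sum.inr a`), of parity opposite to that of `x^a`. -/

section Bundles

variable {A : Type v} (par : A → ZMod 2)

/-- Parities of the coordinates on `ΠTM` and on `ΠT^*M`. -/
def dbl : A ⊕ A → ZMod 2 := Sum.elim par fun a => par a + 1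

/-- The even base coordinates of a point of the underlying space of `ΠTM` or `ΠT^*M`. -/
def basePt (z : Ev (dbl par)) : Ev par := fun a => z ⟨Sum.inl a.1, a.2⟩

/-- The bundle projection, in coordinates. -/
def proj [DecidableEq A] : SMap (dbl par) par := fun a => coord (dbl par) (Sum.inl a)

/-- The zero section, in coordinates. -/
def zeroSec [DecidableEq A] : SMap par (dbl par) := Sum.elim (coord par) fun _ => 0

variable {par} [Fintype A] [DecidableEq A]

/-- `ΠTM`, with `dx^{a'} = ∑_a dx^a ∂x^{a'}/∂x^a`. -/
def piT (M : SuperAtlas.{u} par) : SuperAtlas.{u} (dbl par) where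
  ι := M.ι
  dom i := {z | basePt par z ∈ M.dom i}
  overlap i j := {z | basePt par z ∈ M.overlap i j}
  trans i j := Sum.elim (fun a' => pull (proj par) (M.trans i j a')) fun a' =>
    ∑ a, coord (dbl par) (Sum.inr a) * pull (proj par) (pd a (M.trans i j a'))

/-- `ΠT^*M`, with `x^*_{a'} = ∑_a ∂x^a/∂x^{a'} x^*_a`. -/
def piTstar (M : SuperAtlas.{u} par) : SuperAtlas.{u} (dbl par) where
  ι := M.ι
  dom i := {z | basePt par z ∈ M.dom i}
  overlap i j := {z | basePt par z ∈ M.overlap i j}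
  trans i j := Sum.elim (fun a' => pull (proj par) (M.trans i j a')) fun a' =>
    ∑ a, pull (proj par) (pull (M.trans i j) (pd a' (M.trans j i a))) *
      coord (dbl par) (Sum.inr a)

/-- The map `φ_P : ΠT^*M → ΠTM` over `M`, `φ_P^* dx^a = (-1)^{ã+1} ∂P/∂x^*_a`. -/
def phi (M : SuperAtlas.{u} par) (P : M.ι → SFun (dbl par)) :
    SuperMap (piTstar M) (piT M) where
  κ := M.ι
  src := fun i => i
  tgt := fun i => i
  dom := (piTstar M).dom
  map i := Sum.elim (fun a => coord (dbl par) (Sum.inl a)) fun a =>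
    (-1 : ℝ) ^ (par a + 1).val • pd (Sum.inr a) (P i)

/-- The map `ψ_ω : ΠTM → ΠT^*M` over `M`, `ψ_ω^* x^*_a = ∂ω/∂dx^a`. -/
def psi (M : SuperAtlas.{u} par) (ω : M.ι → SFun (dbl par)) :
    SuperMap (piT M) (piTstar M) where
  κ := M.ι
  src := fun i => i
  tgt := fun i => i
  dom := (piT M).dom
  map i := Sum.elim (fun a => coord (dbl par) (Sum.inl a)) fun a => pd (Sum.inr a) (ω i)

/-- The matrix of second partial derivatives in the fibre coordinates, restricted to the zero
section. -/
def fiberHessian (f : SFun (dbl par)) (x : Ev par) : Matrix A A (Gr (OdIx par)) :=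
  fun a b => pull (zeroSec par) (pd (Sum.inr a) (pd (Sum.inr b) f)) x

/-- `W` contains the zero section of a bundle with the coordinates of `ΠTM` or `ΠT^*M`. -/
def ContainsZeroSection {N : SuperAtlas.{u} (dbl par)} (W : N.OpenSub) : Prop :=
  ∀ i, ∀ z ∈ N.dom i, (∀ b : EvIx (dbl par), b.1.isRight → z b = 0) → z ∈ W.carrier i

/-- `φ` restricts to a diffeomorphism from an open neighbourhood of the zero section onto an open
subset of the target. -/
def IsDiffeoNearZeroSection {N N' : SuperAtlas.{u} (dbl par)} (φ : SuperMap N N') : Prop :=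
  ∃ (W : N.OpenSub) (W' : N'.OpenSub), ContainsZeroSection W ∧ (φ.restrict W W').IsDiffeo

end Bundles

end Super

end

/-! In a chart both maps are the identity on the base coordinates and, up to constant signs, a
gradient in the fibre coordinates. They respect coordinate changes because differentiating the
compatibility of `P` or `ω` along the fibre produces a Jacobi matrix, which cancels against its
inverse (`sum_invJac_mul`). For `P`, the factor (-1)^(ã+1) is what makes the signs from reordering
factors independent of the summation index.

Invertibility near a point of the zero section is read off from the body `bJ` of the Jacobi matrix.
It is block triangular with one identity block; the other diagonal block is the body of the fibre
Hessian up to nonzero column factors (`isUnit_bJ_iff`). A matrix over a Grassmann algebra is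
invertible iff its body is (`isUnit_matrix_iff`). Necessity of the Hessian condition is then the
chain rule along the zero section (`IsFibreMap.isUnit_bJ_of_isDiffeo`).

Sufficiency rests on an inverse function theorem for superdomains (`exists_inverse`). The underlying
smooth map is inverted classically and the linear part in the odd coordinates by matrix inversion;
the remaining deviation from the identity has higher degree in the odd coordinates and is removed by
a finite geometric series. The inverses in the charts agree because inverses are unique
(`IsFibreMap.isDiffeo_restrict`). A single neighbourhood of the whole zero section comes from
paracompactness of the underlying space (`IsFibreMap.exists_neighbourhood`): points with equal
images lie over the same base point, so injectivity only has to be controlled over one base point at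
a time.

The calculus of pullbacks behind all this has one source. Functoriality and the chain rule each
compare two operations that obey the same Leibniz rule and agree on coordinates; Hadamard's lemma
and nilpotency force them to coincide (`eq_zero_of_leibniz`). -/

noncomputable section

namespace Super

/-! ### Grassmann algebras: signs, parity, filtration, contractions -/

section Algebra

variable {O : Type*}

/-- The `e`-th power of the grade involution of the Grassmann algebra. -/
def sg (e : ZMod 2) : Gr O →ₐ[ℝ] Gr O :=
  if e = 0 then AlgHom.id ℝ _ else CliffordAlgebra.involute

@[simp] theorem sg_zero : sg (O := O) 0 = AlgHom.id ℝ _ := if_pos rfl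

theorem sg_one : sg (O := O) 1 = CliffordAlgebra.involute := if_neg (by decide)

theorem zmod_two_cases (e : ZMod 2) : e = 0 ∨ e = 1 := by revert e; decide

theorem sg_sg (e f : ZMod 2) (x : Gr O) : sg e (sg f x) = sg (e + f) x := by
  obtain rfl | rfl := zmod_two_cases e <;> obtain rfl | rfl := zmod_two_cases f
  · simp
  · simp
  · simp
  · rw [show (1 : ZMod 2) + 1 = 0 from rfl, sg_one, sg_zero]
    exact CliffordAlgebra.involute_involute x

theorem sg_ι (e : ZMod 2) (v : O → ℝ) :
    sg e (ExteriorAlgebra.ι ℝ v) = (-1 : ℝ) ^ e.val • ExteriorAlgebra.ι ℝ v := by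
  obtain rfl | rfl := zmod_two_cases e
  · simp
  · rw [sg_one]
    erw [CliffordAlgebra.involute_ι]
    simp [ZMod.val_one]

theorem sg_of_mem {e f : ZMod 2} {x : Gr O} (hx : x ∈ parityPart f) :
    sg e x = (-1 : ℝ) ^ (e * f).val • x := by
  obtain rfl | rfl := zmod_two_cases e
  · simp
  · rw [sg_one]
    obtain rfl | rfl := zmod_two_cases f
    · simpa using CliffordAlgebra.involute_eq_of_mem_even hx
    · simpa [ZMod.val_one] using CliffordAlgebra.involute_eq_of_mem_odd hx

theorem ι_mul_eq (v : O → ℝ) (x : Gr O) :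
    ExteriorAlgebra.ι ℝ v * x = sg 1 x * ExteriorAlgebra.ι ℝ v := by
  induction x using ExteriorAlgebra.induction with
  | algebraMap r => rw [AlgHom.commutes, Algebra.commutes]
  | ι w =>
    rw [sg_ι]
    have := ExteriorAlgebra.ι_add_mul_swap (R := ℝ) v w
    simp only [ZMod.val_one, pow_one, neg_smul, one_smul, neg_mul]
    exact eq_neg_of_add_eq_zero_left this
  | mul a b ha hb => rw [← mul_assoc, ha, mul_assoc, hb, map_mul, mul_assoc]
  | add a b ha hb => rw [mul_add, ha, hb, map_add, add_mul]

/-- Homogeneous elements of the Grassmann algebra supercommute with all elements. -/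
theorem mul_eq_sg_mul {e : ZMod 2} {u : Gr O} (hu : u ∈ parityPart e) (x : Gr O) :
    u * x = sg e x * u := by
  obtain rfl | rfl := zmod_two_cases e
  · rw [sg_zero]
    refine CliffordAlgebra.even_induction (0 : QuadraticForm ℝ (O → ℝ))
      (motive := fun u _ => u * x = x * u) ?_ ?_ ?_ u hu
    · intro r; exact Algebra.commutes r x
    · intro a b _ _ ha hb; rw [add_mul, ha, hb, mul_add]
    · intro m₁ m₂ a _ ha
      have h1 := ι_mul_eq m₁ (sg 1 x)
      have h2 := ι_mul_eq m₂ x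
      have h3 : ExteriorAlgebra.ι ℝ m₁ * ExteriorAlgebra.ι ℝ m₂ * x =
          x * (ExteriorAlgebra.ι ℝ m₁ * ExteriorAlgebra.ι ℝ m₂) := by
        rw [mul_assoc, h2, ← mul_assoc, h1, sg_sg, mul_assoc]; rfl
      change ExteriorAlgebra.ι ℝ m₁ * ExteriorAlgebra.ι ℝ m₂ * a * x =
        x * (ExteriorAlgebra.ι ℝ m₁ * ExteriorAlgebra.ι ℝ m₂ * a)
      rw [mul_assoc, ha, ← mul_assoc, h3, mul_assoc]
  · refine CliffordAlgebra.odd_induction (0 : QuadraticForm ℝ (O → ℝ))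
      (P := fun u _ => u * x = sg 1 x * u) ?_ ?_ ?_ u hu
    · intro v; exact ι_mul_eq v x
    · intro a b _ _ ha hb; rw [add_mul, ha, hb, mul_add]
    · intro m₁ m₂ a _ ha
      have h1 := ι_mul_eq m₁ (x)
      have h2 := ι_mul_eq m₂ (sg 1 x)
      have h3 : ExteriorAlgebra.ι ℝ m₁ * ExteriorAlgebra.ι ℝ m₂ * sg 1 x =
          sg 1 x * (ExteriorAlgebra.ι ℝ m₁ * ExteriorAlgebra.ι ℝ m₂) := by
        rw [mul_assoc, h2, ← mul_assoc, sg_sg, show (1 : ZMod 2) + 1 = 0 from rfl, sg_zero,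
          AlgHom.id_apply, h1, mul_assoc]
      change ExteriorAlgebra.ι ℝ m₁ * ExteriorAlgebra.ι ℝ m₂ * a * x =
        sg 1 x * (ExteriorAlgebra.ι ℝ m₁ * ExteriorAlgebra.ι ℝ m₂ * a)
      rw [mul_assoc, ha, ← mul_assoc, h3, mul_assoc]

theorem mul_comm_of_even {u : Gr O} (hu : u ∈ parityPart 0) (x : Gr O) : u * x = x * u := by
  simpa using mul_eq_sg_mul hu x

theorem eq_zero_of_eq_neg {x : Gr O} (h : x = -x) : x = 0 := by
  have h2 : (2 : ℝ) • x = 0 := by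
    rw [two_smul]
    nth_rewrite 1 [h]
    exact neg_add_cancel x
  exact (smul_eq_zero.mp h2).resolve_left two_ne_zero

theorem mul_self_of_odd {u : Gr O} (hu : u ∈ parityPart 1) : u * u = 0 := by
  have h := mul_eq_sg_mul hu u
  rw [sg_of_mem hu] at h
  simp only [mul_one, ZMod.val_one, pow_one, neg_smul, one_smul, neg_mul] at h
  exact eq_zero_of_eq_neg h

theorem mul_mem_parityPart {e f : ZMod 2} {x y : Gr O} (hx : x ∈ parityPart e)
    (hy : y ∈ parityPart f) : x * y ∈ parityPart (e + f) :=
  CliffordAlgebra.evenOdd_mul_le (0 : QuadraticForm ℝ (O → ℝ)) e f (Submodule.mul_mem_mul hx hy)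

theorem mul_mem_parityPart' {e f g : ZMod 2} {x y : Gr O} (hx : x ∈ parityPart e)
    (hy : y ∈ parityPart f) (h : e + f = g) : x * y ∈ parityPart g :=
  h ▸ mul_mem_parityPart hx hy

theorem algebraMap_mem_parityPart (r : ℝ) : algebraMap ℝ (Gr O) r ∈ parityPart (O := O) 0 :=
  CliffordAlgebra.one_le_evenOdd_zero (0 : QuadraticForm ℝ (O → ℝ))
    (Submodule.algebraMap_mem r)

theorem ι_mem_parityPart (v : O → ℝ) : ExteriorAlgebra.ι ℝ v ∈ parityPart (O := O) 1 :=
  CliffordAlgebra.ι_mem_evenOdd_one (0 : QuadraticForm ℝ (O → ℝ)) v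

theorem exists_add_of_parity (x : Gr O) :
    ∃ y ∈ parityPart (O := O) 0, ∃ z ∈ parityPart (O := O) 1, x = y + z := by
  induction x using ExteriorAlgebra.induction with
  | algebraMap r => exact ⟨_, algebraMap_mem_parityPart r, 0, zero_mem _, by simp⟩
  | ι v => exact ⟨0, zero_mem _, _, ι_mem_parityPart v, by simp⟩
  | mul a b ha hb =>
    obtain ⟨y, hy, z, hz, rfl⟩ := ha
    obtain ⟨y', hy', z', hz', rfl⟩ := hb
    refine ⟨y * y' + z * z', add_mem ?_ ?_, y * z' + z * y', add_mem ?_ ?_,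
      by simp only [mul_add, add_mul]; abel⟩
    · exact mul_mem_parityPart' hy hy' (zero_add 0)
    · exact mul_mem_parityPart' hz hz' rfl
    · exact mul_mem_parityPart' hy hz' (zero_add 1)
    · exact mul_mem_parityPart' hz hy' (add_zero 1)
  | add a b ha hb =>
    obtain ⟨y, hy, z, hz, rfl⟩ := ha
    obtain ⟨y', hy', z', hz', rfl⟩ := hb
    exact ⟨y + y', add_mem hy hy', z + z', add_mem hz hz', by abel⟩

/-- The two parity parts are the eigenspaces of the grade involution. Parity thus becomes an
equation, which can be carried through any map that commutes or anticommutes with the involution. -/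
theorem mem_parityPart_iff {e : ZMod 2} {x : Gr O} :
    x ∈ parityPart e ↔ sg 1 x = (-1 : ℝ) ^ e.val • x := by
  refine ⟨fun h => by simpa using sg_of_mem (e := 1) h, fun h => ?_⟩
  obtain ⟨y, hy, z, hz, rfl⟩ := exists_add_of_parity x
  rw [map_add, sg_of_mem hy, sg_of_mem hz] at h
  obtain rfl | rfl := zmod_two_cases e
  · have : z = 0 := by
      simp only [mul_zero, ZMod.val_zero, pow_zero, one_smul, mul_one, ZMod.val_one, pow_one,
        neg_smul] at h
      exact eq_zero_of_eq_neg (add_left_cancel h).symm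
    simpa [this] using hy
  · have : y = 0 := by
      simp only [mul_zero, ZMod.val_zero, pow_zero, one_smul, mul_one, ZMod.val_one, pow_one,
        neg_smul, neg_add] at h
      exact eq_zero_of_eq_neg (add_right_cancel h)
    simpa [this] using hz

@[simp] theorem body_algebraMap (r : ℝ) : body (algebraMap ℝ (Gr O) r) = r := by
  simp

@[simp] theorem body_ι (v : O → ℝ) : body (ExteriorAlgebra.ι ℝ v) = 0 := by
  simp [body, ExteriorAlgebra.algebraMapInv]

theorem body_of_odd {x : Gr O} (hx : x ∈ parityPart 1) : body x = 0 := by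
  have h := mul_self_of_odd hx
  have h2 := congrArg body h
  rw [map_mul, map_zero] at h2
  exact mul_self_eq_zero.mp h2

/-! ### The filtration by the number of generators -/

/-- The span of the products with at least `m` generators. -/
def Fil (O : Type*) (m : ℕ) : Submodule ℝ (Gr O) :=
  LinearMap.range (ExteriorAlgebra.ι ℝ (M := O → ℝ)) ^ m * ⊤

@[simp] theorem Fil_zero : Fil O 0 = ⊤ := by simp [Fil]

theorem Fil_succ (m : ℕ) :
    Fil O (m + 1) = LinearMap.range (ExteriorAlgebra.ι ℝ (M := O → ℝ)) * Fil O m := by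
  rw [Fil, Fil, pow_succ', mul_assoc]

theorem Fil_induction {m : ℕ} {C : Gr O → Prop}
    (hadd : ∀ x y, C x → C y → C (x + y))
    (hmul : ∀ v, ∀ x ∈ Fil O m, C (ExteriorAlgebra.ι ℝ v * x)) {x : Gr O}
    (hx : x ∈ Fil O (m + 1)) : C x := by
  rw [Fil_succ] at hx
  refine Submodule.mul_induction_on hx ?_ hadd
  rintro _ ⟨v, rfl⟩ x hx
  exact hmul v x hx

theorem ι_mul_mem_Fil (v : O → ℝ) {m : ℕ} {x : Gr O} (hx : x ∈ Fil O m) :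
    ExteriorAlgebra.ι ℝ v * x ∈ Fil O (m + 1) := by
  rw [Fil_succ]
  exact Submodule.mul_mem_mul ⟨v, rfl⟩ hx

theorem mul_mem_Fil_right {m : ℕ} {x : Gr O} (hx : x ∈ Fil O m) (y : Gr O) :
    x * y ∈ Fil O m := by
  have : x * y ∈ Fil O m * ⊤ := Submodule.mul_mem_mul hx Submodule.mem_top
  rw [Fil, mul_assoc] at this
  refine Submodule.mul_le.mpr (fun a ha b hb => Submodule.mul_mem_mul ha Submodule.mem_top) this

theorem sg_mem_Fil {m : ℕ} {x : Gr O} (hx : x ∈ Fil O m) (e : ZMod 2) : sg e x ∈ Fil O m := by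
  induction m generalizing x with
  | zero => simp
  | succ m ih =>
    refine Fil_induction (C := fun x => sg e x ∈ Fil O (m + 1)) ?_ ?_ hx
    · intro x y hx hy; rw [map_add]; exact add_mem hx hy
    · intro v x hx
      rw [map_mul, sg_ι, smul_mul_assoc]
      exact Submodule.smul_mem _ _ (ι_mul_mem_Fil v (ih hx))

/-- The definition makes `Fil` a right ideal. For the left side, a factor is moved past the leading
generator at the cost of the grade involution, hence the induction over all `y`. -/
theorem mul_mem_Fil_left {m : ℕ} {x : Gr O} (hx : x ∈ Fil O m) (y : Gr O) :
    y * x ∈ Fil O m := by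
  induction m generalizing x y with
  | zero => simp
  | succ m ih =>
    refine Fil_induction (C := fun x => ∀ y, y * x ∈ Fil O (m + 1)) ?_ ?_ hx y
    · intro x z hx hz y; rw [mul_add]; exact add_mem (hx y) (hz y)
    · intro v x hx y
      have : y * ExteriorAlgebra.ι ℝ v = ExteriorAlgebra.ι ℝ v * sg 1 y := by
        rw [ι_mul_eq, sg_sg]; rfl
      rw [← mul_assoc, this, mul_assoc]
      exact ι_mul_mem_Fil v (ih hx _)

theorem mul_mem_Fil {m n : ℕ} {x y : Gr O} (hx : x ∈ Fil O m) (hy : y ∈ Fil O n) :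
    x * y ∈ Fil O (m + n) := by
  induction m generalizing x with
  | zero => simpa using mul_mem_Fil_left hy x
  | succ m ih =>
    refine Fil_induction (C := fun x => x * y ∈ Fil O (m + 1 + n)) ?_ ?_ hx
    · intro x z hx hz; rw [add_mul]; exact add_mem hx hz
    · intro v x hx
      rw [mul_assoc, add_right_comm]
      exact ι_mul_mem_Fil v (ih hx)

theorem Fil_le_succ (m : ℕ) : Fil O (m + 1) ≤ Fil O m := fun x hx => by
  refine Fil_induction (C := fun x => x ∈ Fil O m) (fun _ _ => add_mem) ?_ hx
  intro v x hx
  exact mul_mem_Fil_left hx _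

theorem Fil_antitone : Antitone (Fil O) := antitone_nat_of_succ_le Fil_le_succ

theorem mem_Fil_one {x : Gr O} : x ∈ Fil O 1 ↔ body x = 0 := by
  constructor
  · intro hx
    refine Fil_induction (m := 0) (C := fun x => body x = 0) ?_ ?_ hx
    · intro x y hx hy; rw [map_add, hx, hy, add_zero]
    · intro v x _; rw [map_mul, body_ι, zero_mul]
  · intro hx
    have key : ∀ x : Gr O, x - algebraMap ℝ _ (body x) ∈ Fil O 1 := by
      intro x
      induction x using ExteriorAlgebra.induction with
      | algebraMap r => rw [body_algebraMap, sub_self]; exact zero_mem _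
      | ι v =>
        rw [body_ι, map_zero, sub_zero, ← mul_one (ExteriorAlgebra.ι ℝ v)]
        exact ι_mul_mem_Fil v (m := 0) (by simp)
      | mul a b ha hb =>
        have : a * b - algebraMap ℝ (Gr O) (body (a * b)) =
            (a - algebraMap ℝ (Gr O) (body a)) * b +
              algebraMap ℝ (Gr O) (body a) * (b - algebraMap ℝ (Gr O) (body b)) := by
          rw [map_mul, map_mul, sub_mul, mul_sub]; abel
        rw [this]
        exact add_mem (mul_mem_Fil_right ha _) (mul_mem_Fil_left hb _)
      | add a b ha hb =>
        have : a + b - algebraMap ℝ (Gr O) (body (a + b)) =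
            (a - algebraMap ℝ (Gr O) (body a)) + (b - algebraMap ℝ (Gr O) (body b)) := by
          rw [map_add, map_add]; abel
        rw [this]
        exact add_mem ha hb
    simpa [hx] using key x

theorem sub_body_mem_Fil (x : Gr O) : x - algebraMap ℝ _ (body x) ∈ Fil O 1 := by
  rw [mem_Fil_one, map_sub, body_algebraMap, sub_self]

/-- The exterior power of degree `m` has dimension a binomial coefficient that vanishes. This is the
source of all nilpotency arguments. -/
theorem Fil_eq_bot [Fintype O] {m : ℕ} (hm : Fintype.card O < m) : Fil O m = ⊥ := by
  have h : LinearMap.range (ExteriorAlgebra.ι ℝ (M := O → ℝ)) ^ m = ⊥ := by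
    have : Module.finrank ℝ (⋀[ℝ]^m (O → ℝ)) = 0 := by
      rw [exteriorPower.finrank_eq, Module.finrank_fintype_fun_eq_card]
      exact Nat.choose_eq_zero_of_lt hm
    exact Submodule.finrank_eq_zero.mp this
  rw [Fil, h, Submodule.bot_mul]

/-! ### Contractions -/

/-- The left derivative with respect to a generator. -/
def ctr (o : O) : Gr O →ₗ[ℝ] Gr O :=
  CliffordAlgebra.contractLeft (Q := (0 : QuadraticForm ℝ (O → ℝ))) (LinearMap.proj o)

theorem ctr_ι_mul (o : O) (v : O → ℝ) (x : Gr O) :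
    ctr o (ExteriorAlgebra.ι ℝ v * x) = v o • x - ExteriorAlgebra.ι ℝ v * ctr o x :=
  CliffordAlgebra.contractLeft_ι_mul _ _ _

@[simp] theorem ctr_algebraMap (o : O) (r : ℝ) : ctr o (algebraMap ℝ (Gr O) r) = 0 :=
  CliffordAlgebra.contractLeft_algebraMap _ _ _

theorem ctr_ι (o : O) (v : O → ℝ) : ctr o (ExteriorAlgebra.ι ℝ v) = algebraMap ℝ _ (v o) :=
  CliffordAlgebra.contractLeft_ι _ _ _

theorem ctr_mul (o : O) (x y : Gr O) : ctr o (x * y) = ctr o x * y + sg 1 x * ctr o y := by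
  induction x using ExteriorAlgebra.induction generalizing y with
  | algebraMap r =>
    rw [ctr_algebraMap, zero_mul, zero_add, AlgHom.commutes, ← Algebra.smul_def,
      ← Algebra.smul_def, map_smul]
  | ι v =>
    rw [ctr_ι_mul, ctr_ι, sg_ι, ← Algebra.smul_def]
    simp [ZMod.val_one, sub_eq_add_neg]
  | mul a b ha hb => rw [mul_assoc, ha, ha, hb, map_mul]; simp only [mul_add, add_mul, mul_assoc]; abel
  | add a b ha hb => rw [add_mul, map_add, ha, hb, map_add, map_add]; simp only [add_mul]; abel

theorem ctr_sg (o : O) (x : Gr O) : ctr o (sg 1 x) = - sg 1 (ctr o x) := by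
  induction x using ExteriorAlgebra.induction with
  | algebraMap r => rw [AlgHom.commutes, ctr_algebraMap, map_zero, neg_zero]
  | ι v => rw [sg_ι, map_smul, ctr_ι, AlgHom.commutes]; simp [ZMod.val_one]
  | mul a b ha hb => rw [map_mul, ctr_mul, ctr_mul, ha, hb, map_add, map_mul, map_mul, neg_mul, mul_neg]; abel
  | add a b ha hb => rw [map_add, map_add, ha, hb, map_add, map_add]; abel

theorem ctr_mem {o : O} {e : ZMod 2} {x : Gr O} (hx : x ∈ parityPart e) :
    ctr o x ∈ parityPart (e + 1) := by
  rw [mem_parityPart_iff] at hx ⊢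
  have h := ctr_sg o x
  rw [hx, map_smul] at h
  have h2 : sg 1 (ctr o x) = -((-1 : ℝ) ^ e.val • ctr o x) := by rw [h, neg_neg]
  rw [h2]
  obtain rfl | rfl := zmod_two_cases e
  · simp [ZMod.val_one]
  · rw [show (1 : ZMod 2) + 1 = 0 from rfl]
    simp [ZMod.val_one]

/-- Modulo products of two generators, `ι v * x` only depends on the body of `x`, and contraction
reads off the coefficients of the linear part. -/
theorem sub_linear_mem_Fil [Fintype O] [DecidableEq O] {x : Gr O} (hx : x ∈ Fil O 1) :
    x - ∑ o, body (ctr o x) • ExteriorAlgebra.ι ℝ (Pi.single o 1) ∈ Fil O 2 := by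
  let C : Gr O → Prop := fun x =>
    x - ∑ o, body (ctr o x) • ExteriorAlgebra.ι ℝ (Pi.single o (1 : ℝ)) ∈ Fil O 2
  suffices h : C x from h
  refine Fil_induction (m := 0) (C := C) ?_ ?_ hx
  · intro x y hx hy
    change _ ∈ Fil O 2
    convert add_mem hx hy using 1
    simp only [map_add, add_smul, Finset.sum_add_distrib]
    abel
  · intro v x _
    have h : ∑ o, body (ctr o (ExteriorAlgebra.ι ℝ v * x)) •
        ExteriorAlgebra.ι ℝ (Pi.single o (1 : ℝ)) =
        ExteriorAlgebra.ι ℝ v * algebraMap ℝ _ (body x) := by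
      rw [← Algebra.commutes, ← Algebra.smul_def]
      conv_rhs => rw [← Finset.univ_sum_single v, map_sum, Finset.smul_sum]
      refine Finset.sum_congr rfl fun o _ => ?_
      rw [ctr_ι_mul, map_sub, map_mul, body_ι, zero_mul, sub_zero, map_smul,
        show (Pi.single o (v o) : O → ℝ) = v o • Pi.single o 1 by
          rw [← Pi.single_smul, smul_eq_mul, mul_one], map_smul, smul_smul, smul_eq_mul, mul_comm]
    change _ ∈ Fil O 2
    rw [h, ← mul_sub]
    exact ι_mul_mem_Fil v (sub_body_mem_Fil x)

end Algebra

end Super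

end

noncomputable section

namespace Super

open Filter Topology
open scoped ContDiff

/-! ### Smooth germs, also with values in Grassmann algebras -/

section Smooth

variable {E F F' : Type*} [NormedAddCommGroup E] [NormedSpace ℝ E] [NormedAddCommGroup F]
  [NormedSpace ℝ F] [NormedAddCommGroup F'] [NormedSpace ℝ F']

/-- Smoothness in a neighbourhood of a point. -/
def Sm (f : E → F) (y : E) : Prop := ∀ᶠ z in 𝓝 y, ContDiffAt ℝ ∞ f z

theorem Sm.contDiffAt {f : E → F} {y : E} (h : Sm f y) : ContDiffAt ℝ ∞ f y := h.self_of_nhds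

theorem Sm.eventually {f : E → F} {y : E} (h : Sm f y) : ∀ᶠ z in 𝓝 y, Sm f z :=
  eventually_eventually_nhds.mpr h

theorem Sm.differentiableAt {f : E → F} {y : E} (h : Sm f y) : DifferentiableAt ℝ f y :=
  h.contDiffAt.differentiableAt (by simp)

theorem Sm.continuousAt {f : E → F} {y : E} (h : Sm f y) : ContinuousAt f y :=
  h.differentiableAt.continuousAt

theorem Sm.congr {f g : E → F} {y : E} (h : Sm f y) (hfg : f =ᶠ[𝓝 y] g) : Sm g y := by
  filter_upwards [h, hfg.eventuallyEq_nhds] with z hz hz'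
  exact hz.congr_of_eventuallyEq hz'.symm

theorem sm_of_contDiffOn {f : E → F} {U : Set E} (h : ContDiffOn ℝ ∞ f U) (hU : IsOpen U)
    {y : E} (hy : y ∈ U) : Sm f y := by
  filter_upwards [hU.mem_nhds hy] with z hz
  exact h.contDiffAt (hU.mem_nhds hz)

theorem contDiffOn_of_sm {f : E → F} {U : Set E} (h : ∀ y ∈ U, Sm f y) : ContDiffOn ℝ ∞ f U :=
  fun y hy => (h y hy).contDiffAt.contDiffWithinAt

theorem sm_of_contDiff {f : E → F} (h : ContDiff ℝ ∞ f) (y : E) : Sm f y :=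
  Eventually.of_forall fun _ => h.contDiffAt

theorem sm_const (c : F) (y : E) : Sm (fun _ : E => c) y := sm_of_contDiff contDiff_const y

theorem Sm.add {f g : E → F} {y : E} (hf : Sm f y) (hg : Sm g y) : Sm (fun z => f z + g z) y := by
  filter_upwards [hf, hg] with z h h' using h.add h'

theorem Sm.sub {f g : E → F} {y : E} (hf : Sm f y) (hg : Sm g y) : Sm (fun z => f z - g z) y := by
  filter_upwards [hf, hg] with z h h' using h.sub h'

theorem Sm.const_smul {f : E → F} {y : E} (c : ℝ) (hf : Sm f y) : Sm (fun z => c • f z) y := by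
  filter_upwards [hf] with z h using h.const_smul c

theorem Sm.smul {c : E → ℝ} {f : E → F} {y : E} (hc : Sm c y) (hf : Sm f y) :
    Sm (fun z => c z • f z) y := by
  filter_upwards [hc, hf] with z h h' using h.smul h'

theorem sm_sum {κ : Type*} {s : Finset κ} {f : κ → E → F} {y : E} (h : ∀ i ∈ s, Sm (f i) y) :
    Sm (fun z => ∑ i ∈ s, f i z) y := by
  have : ∀ᶠ z in 𝓝 y, ∀ i ∈ s, ContDiffAt ℝ ∞ (f i) z := (Filter.eventually_all_finset s).mpr h
  filter_upwards [this] with z hz using ContDiffAt.sum hz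

theorem Sm.comp {g : F → F'} {f : E → F} {y : E} (hg : Sm g (f y)) (hf : Sm f y) :
    Sm (fun z => g (f z)) y := by
  filter_upwards [hf, hf.continuousAt.eventually hg] with z h h'
  exact h'.comp z h

theorem Sm.linearMap [FiniteDimensional ℝ F] {f : E → F} {y : E} (L : F →ₗ[ℝ] F')
    (hf : Sm f y) : Sm (fun z => L (f z)) y := by
  filter_upwards [hf] with z h
  exact (LinearMap.toContinuousLinearMap L).contDiff.contDiffAt.comp z h

theorem Sm.fderiv_apply {f : E → F} {y : E} (hf : Sm f y) (e : E) :
    Sm (fun z => fderiv ℝ f z e) y := by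
  filter_upwards [hf] with z h
  exact (h.fderiv_right (m := ∞) (by simp)).clm_apply contDiffAt_const

theorem sm_pi {κ : Type*} [Fintype κ] {f : E → κ → F} {y : E} (h : ∀ k, Sm (fun z => f z k) y) :
    Sm f y := by
  filter_upwards [Filter.eventually_all.mpr h] with z hz
  exact contDiffAt_pi.mpr hz

theorem fderiv_linearMap [FiniteDimensional ℝ F] {f : E → F} {y : E} (L : F →ₗ[ℝ] F')
    (hf : DifferentiableAt ℝ f y) (e : E) :
    fderiv ℝ (fun z => L (f z)) y e = L (fderiv ℝ f y e) := by
  have := (LinearMap.toContinuousLinearMap L).hasFDerivAt.comp y hf.hasFDerivAt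
  exact DFunLike.congr_fun this.fderiv e

/-- Derivatives of a function with values in a subspace belong to the subspace. -/
theorem fderiv_mem_submodule [FiniteDimensional ℝ F] {f : E → F} {y : E} (K : Submodule ℝ F)
    (h : ∀ᶠ z in 𝓝 y, f z ∈ K) (e : E) : fderiv ℝ f y e ∈ K := by
  by_cases hf : DifferentiableAt ℝ f y
  · obtain ⟨K', hK'⟩ := K.exists_isCompl
    -- A projection with kernel `K` turns membership in `K` into the vanishing of a function, which
    -- is inherited by the derivative.
    let L := K'.projectionOnto K hK'.symm
    have hL : ∀ x, L x = 0 ↔ x ∈ K := fun x => by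
      rw [← LinearMap.mem_ker, Submodule.ker_projectionOnto]
    rw [← hL, ← fderiv_linearMap L hf]
    have h0 : (fun z => L (f z)) =ᶠ[𝓝 y] fun _ => 0 := by
      filter_upwards [h] with z hz using (hL _).mpr hz
    rw [h0.fderiv_eq]
    simp
  -- Without differentiability `fderiv` has the default value 0, which lies in every subspace.
  · rw [fderiv_zero_of_not_differentiableAt hf]
    exact zero_mem _

variable {O : Type*} [Finite O]

/-- The chosen norm need not be submultiplicative, so the product is treated as a bilinear map,
continuous by finite dimension. -/
theorem Sm.mul {f g : E → Gr O} {y : E} (hf : Sm f y) (hg : Sm g y) :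
    Sm (fun z => f z * g z) y := by
  filter_upwards [hf, hg] with z h h'
  have hB : ContDiffAt ℝ ∞ (fun z => LinearMap.toContinuousBilinearMap (LinearMap.mul ℝ (Gr O))
    (f z) (g z)) z := ContDiffAt.clm_apply
      ((LinearMap.toContinuousBilinearMap (LinearMap.mul ℝ (Gr O))).contDiff.contDiffAt.comp z h) h'
  exact hB

theorem fderiv_mul_gr {f g : E → Gr O} {y : E} (hf : DifferentiableAt ℝ f y)
    (hg : DifferentiableAt ℝ g y) (e : E) :
    fderiv ℝ (fun z => f z * g z) y e = fderiv ℝ f y e * g y + f y * fderiv ℝ g y e := by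
  have h := (LinearMap.toContinuousBilinearMap (LinearMap.mul ℝ (Gr O))).hasFDerivAt_of_bilinear
    hf.hasFDerivAt hg.hasFDerivAt
  have h2 := DFunLike.congr_fun h.fderiv e
  refine Eq.trans ?_ (h2.trans ?_)
  · rfl
  · simp [add_comm]

end Smooth

/-! ### Partial derivatives of superfunctions and the graded Leibniz rule -/

section PartialDerivatives

variable {A : Type v} [DecidableEq A] {par : A → ZMod 2}

theorem coord_even {a : A} (h : par a = 0) (x : Ev par) :
    coord par a x = algebraMap ℝ _ (x ⟨a, h⟩) := dif_pos h

theorem coord_odd {a : A} (h : par a = 1) (x : Ev par) :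
    coord par a x = ExteriorAlgebra.ι ℝ (Pi.single ⟨a, h⟩ 1) := dif_neg (by rw [h]; decide)

theorem coord_mem (a : A) (x : Ev par) : coord par a x ∈ parityPart (par a) := by
  rcases zmod_two_cases (par a) with h | h
  · rw [coord_even h, h]; exact algebraMap_mem_parityPart _
  · rw [coord_odd h, h]; exact ι_mem_parityPart _

variable [Fintype A]

theorem pd_even {a : A} (h : par a = 0) (f : SFun par) (x : Ev par) :
    pd a f x = fderiv ℝ f x (Pi.single ⟨a, h⟩ 1) := dif_pos h

theorem pd_odd {a : A} (h : par a = 1) (f : SFun par) (x : Ev par) :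
    pd a f x = ctr ⟨a, h⟩ (f x) := dif_neg (by rw [h]; decide)

theorem sm_coord (a : A) (x : Ev par) : Sm (coord par a) x := by
  rcases zmod_two_cases (par a) with h | h
  · rw [funext (coord_even h)]
    exact Sm.linearMap (f := fun z : Ev par => z ⟨a, h⟩) (Algebra.linearMap ℝ (Gr (OdIx par)))
      (sm_of_contDiff (contDiff_apply ℝ ℝ _) x)
  · rw [funext (coord_odd h)]
    exact sm_const _ _

theorem pd_eventuallyEq (a : A) {f g : SFun par} {x : Ev par} (h : f =ᶠ[𝓝 x] g) :
    pd a f =ᶠ[𝓝 x] pd a g := by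
  filter_upwards [h.eventuallyEq_nhds] with z hz
  rcases zmod_two_cases (par a) with ha | ha
  · rw [pd_even ha, pd_even ha, hz.fderiv_eq]
  · rw [pd_odd ha, pd_odd ha, hz.self_of_nhds]

theorem pd_congr (a : A) {f g : SFun par} {x : Ev par} (h : f =ᶠ[𝓝 x] g) :
    pd a f x = pd a g x := (pd_eventuallyEq a h).self_of_nhds

theorem Sm.pd (a : A) {f : SFun par} {x : Ev par} (h : Sm f x) : Sm (pd a f) x := by
  rcases zmod_two_cases (par a) with ha | ha
  · rw [funext (pd_even ha f)]; exact h.fderiv_apply _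
  · rw [funext (pd_odd ha f)]; exact h.linearMap _

theorem pd_mem (a : A) {f : SFun par} {x : Ev par} {e : ZMod 2}
    (h : ∀ᶠ z in 𝓝 x, f z ∈ parityPart e) : pd a f x ∈ parityPart (e + par a) := by
  rcases zmod_two_cases (par a) with ha | ha
  · rw [pd_even ha, ha, add_zero]; exact fderiv_mem_submodule _ h _
  · rw [pd_odd ha, ha]; exact ctr_mem h.self_of_nhds

theorem pd_add (a : A) {f g : SFun par} {x : Ev par} (hf : Sm f x) (hg : Sm g x) :
    pd a (fun z => f z + g z) x = pd a f x + pd a g x := by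
  rcases zmod_two_cases (par a) with ha | ha
  · rw [pd_even ha, pd_even ha, pd_even ha,
      fderiv_fun_add hf.differentiableAt hg.differentiableAt]
    rfl
  · rw [pd_odd ha, pd_odd ha, pd_odd ha, map_add]

theorem pd_const_smul (a : A) {f : SFun par} {x : Ev par} (c : ℝ) (hf : Sm f x) :
    pd a (fun z => c • f z) x = c • pd a f x := by
  rcases zmod_two_cases (par a) with ha | ha
  · rw [pd_even ha, pd_even ha, fderiv_fun_const_smul hf.differentiableAt]
    rfl
  · rw [pd_odd ha, pd_odd ha, map_smul]

theorem pd_const (a : A) (r : ℝ) (x : Ev par) :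
    pd a (fun _ => algebraMap ℝ _ r : SFun par) x = 0 := by
  rcases zmod_two_cases (par a) with ha | ha
  · rw [pd_even ha]; simp
  · rw [pd_odd ha, ctr_algebraMap]

theorem pd_sum {κ : Type*} (a : A) (s : Finset κ) {f : κ → SFun par} {x : Ev par}
    (hf : ∀ k, Sm (f k) x) :
    pd a (fun z => ∑ k ∈ s, f k z) x = ∑ k ∈ s, pd a (f k) x := by
  classical
  induction s using Finset.induction_on with
  | empty => simpa using pd_const a 0 x
  | insert k s hk ih =>
    simp only [Finset.sum_insert hk]
    rw [pd_add a (hf k) (sm_sum fun i _ => hf i), ih]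

/-- The graded Leibniz rule. -/
theorem pd_mul (a : A) {f g : SFun par} {x : Ev par} (hf : Sm f x) (hg : Sm g x) :
    pd a (fun z => f z * g z) x = pd a f x * g x + sg (par a) (f x) * pd a g x := by
  rcases zmod_two_cases (par a) with ha | ha
  · rw [pd_even ha, pd_even ha, pd_even ha, ha,
      fderiv_mul_gr hf.differentiableAt hg.differentiableAt]
    simp
  · rw [pd_odd ha, pd_odd ha, pd_odd ha, ctr_mul, ha]

theorem pd_coord (a b : A) (x : Ev par) :
    pd a (coord par b) x = if a = b then 1 else 0 := by
  rcases zmod_two_cases (par a) with ha | ha <;> rcases zmod_two_cases (par b) with hb | hb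
  · rw [pd_even ha, funext (coord_even hb)]
    have := fderiv_linearMap (f := fun z : Ev par => z ⟨b, hb⟩) (y := x)
      (Algebra.linearMap ℝ (Gr (OdIx par))) (differentiableAt_apply _ _) (Pi.single ⟨a, ha⟩ 1)
    refine Eq.trans this ?_
    rw [fderiv_apply differentiableAt_id]
    by_cases hab : a = b
    · subst hab; simp
    · rw [if_neg hab]
      simp [Ne.symm hab]
  · rw [pd_even ha, funext (coord_odd hb), if_neg (by rintro rfl; rw [ha] at hb; exact absurd hb (by decide))]
    simp
  · rw [pd_odd ha, coord_even hb, if_neg (by rintro rfl; rw [ha] at hb; exact absurd hb (by decide)), ctr_algebraMap]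
  · rw [pd_odd ha, coord_odd hb, ctr_ι]
    by_cases hab : a = b
    · subst hab; simp
    · rw [if_neg hab, Pi.single_eq_of_ne (by simpa using hab), map_zero]

theorem body_pd_even {a : A} (h : par a = 0) {f : SFun par} {x : Ev par} (hf : Sm f x) :
    body (pd a f x) = fderiv ℝ (fun z => body (f z)) x (Pi.single ⟨a, h⟩ 1) := by
  rw [pd_even h]
  exact (fderiv_linearMap body.toLinearMap hf.differentiableAt _).symm

end PartialDerivatives

end Super

end

noncomputable section

namespace Super

open Filter Topology
open scoped ContDiff

/-! ### Taylor expansion with nilpotent increments -/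

section Taylor

variable {B : Type w} [Fintype B] [DecidableEq B] {par' : B → ZMod 2} {O : Type*} [Finite O]
  {n : EvIx par' → Gr O} {y : Ev par'}

theorem taylorStep_eventuallyEq {G H : Ev par' → Gr O} (h : G =ᶠ[𝓝 y] H) :
    taylorStep n G =ᶠ[𝓝 y] taylorStep n H := by
  filter_upwards [h.eventuallyEq_nhds] with z hz
  simp only [taylorStep, hz.fderiv_eq]

theorem taylorStep_iterate_eventuallyEq {G H : Ev par' → Gr O} (h : G =ᶠ[𝓝 y] H) (k : ℕ) :
    (taylorStep n)^[k] G =ᶠ[𝓝 y] (taylorStep n)^[k] H := by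
  induction k generalizing G H with
  | zero => exact h
  | succ k ih => exact ih (taylorStep_eventuallyEq h)

theorem Sm.taylorStep {G : Ev par' → Gr O} (h : Sm G y) : Sm (taylorStep n G) y :=
  sm_sum fun _ _ => (sm_const _ _).mul (h.fderiv_apply _)

theorem taylorStep_add {G H : Ev par' → Gr O} (hG : Sm G y) (hH : Sm H y) :
    taylorStep n (fun z => G z + H z) y = taylorStep n G y + taylorStep n H y := by
  simp only [taylorStep, ← Finset.sum_add_distrib, ← mul_add]
  rw [fderiv_fun_add hG.differentiableAt hH.differentiableAt]
  rfl

theorem taylorStep_iterate_add {G H : Ev par' → Gr O} (hG : Sm G y) (hH : Sm H y) (k : ℕ) :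
    (taylorStep n)^[k] (fun z => G z + H z) =ᶠ[𝓝 y]
      fun z => (taylorStep n)^[k] G z + (taylorStep n)^[k] H z := by
  induction k generalizing G H with
  | zero => exact EventuallyEq.rfl
  | succ k ih =>
    refine EventuallyEq.trans (taylorStep_iterate_eventuallyEq ?_ k)
      (ih hG.taylorStep hH.taylorStep)
    filter_upwards [hG.eventually, hH.eventually] with z h h' using taylorStep_add h h'

theorem taylorStep_zero : taylorStep n (fun _ : Ev par' => (0 : Gr O)) = fun _ => 0 := by
  funext z
  simp [taylorStep]

theorem taylorStep_const (c : Gr O) : taylorStep n (fun _ : Ev par' => c) = fun _ => 0 := by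
  funext z
  simp [taylorStep]

theorem taylorStep_iterate_zero (k : ℕ) :
    (taylorStep n)^[k] (fun _ : Ev par' => (0 : Gr O)) = fun _ => 0 := by
  induction k with
  | zero => rfl
  | succ k ih => rw [Function.iterate_succ_apply, taylorStep_zero, ih]

theorem taylorStep_iterate_sum {κ : Type*} (s : Finset κ) {G : κ → Ev par' → Gr O}
    (hG : ∀ i, Sm (G i) y) (k : ℕ) :
    (taylorStep n)^[k] (fun z => ∑ i ∈ s, G i z) =ᶠ[𝓝 y]
      fun z => ∑ i ∈ s, (taylorStep n)^[k] (G i) z := by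
  classical
  induction s using Finset.induction_on with
  | empty =>
    simp only [Finset.sum_empty]
    rw [taylorStep_iterate_zero]
  | insert i s hi ih =>
    simp only [Finset.sum_insert hi]
    refine (taylorStep_iterate_add (hG i) (sm_sum fun j _ => hG j) k).trans ?_
    filter_upwards [ih] with z hz
    rw [hz]

variable (hn : ∀ b, n b ∈ parityPart (O := O) 0)
include hn

/-- The increments `n b` are even, hence central, so the step is an ungraded derivation. -/
theorem taylorStep_mul {G H : Ev par' → Gr O} (hG : Sm G y) (hH : Sm H y) :
    taylorStep n (fun z => G z * H z) y = taylorStep n G y * H y + G y * taylorStep n H y := by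
  simp only [taylorStep, Finset.sum_mul, Finset.mul_sum, ← Finset.sum_add_distrib]
  refine Finset.sum_congr rfl fun b _ => ?_
  rw [fderiv_mul_gr hG.differentiableAt hH.differentiableAt, mul_add, mul_assoc, ← mul_assoc (G y),
    ← mul_comm_of_even (hn b) (G y), mul_assoc]

theorem taylorStep_iterate_mul {G H : Ev par' → Gr O} (hG : Sm G y) (hH : Sm H y) (k : ℕ) :
    (taylorStep n)^[k] (fun z => G z * H z) =ᶠ[𝓝 y] fun z =>
      ∑ p ∈ Finset.HasAntidiagonal.antidiagonal k,
        k.choose p.1 • ((taylorStep n)^[p.1] G z * (taylorStep n)^[p.2] H z) := by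
  induction k generalizing G H with
  | zero => simp
  | succ k ih =>
    have h1 : taylorStep n (fun z => G z * H z) =ᶠ[𝓝 y]
        fun z => taylorStep n G z * H z + G z * taylorStep n H z := by
      filter_upwards [hG.eventually, hH.eventually] with z h h' using taylorStep_mul hn h h'
    have h2 := (taylorStep_iterate_eventuallyEq (n := n) h1 k).trans
      (taylorStep_iterate_add (hG.taylorStep.mul hH) (hG.mul hH.taylorStep) k)
    refine h2.trans ?_
    filter_upwards [ih hG.taylorStep hH, ih hG hH.taylorStep] with z h3 h4
    rw [h3, h4, Finset.sum_antidiagonal_choose_succ_nsmul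
      (fun i j => (taylorStep n)^[i] G z * (taylorStep n)^[j] H z), add_comm]
    congr 1
    refine Finset.sum_congr rfl fun p hp => ?_
    rw [Finset.HasAntidiagonal.mem_antidiagonal] at hp
    rw [Nat.choose_symm_of_eq_add hp.symm]
    rfl

theorem sg_taylorStep_iterate (e : ZMod 2) {G : Ev par' → Gr O} (hG : Sm G y) (k : ℕ) :
    (fun z => sg e ((taylorStep n)^[k] G z)) =ᶠ[𝓝 y]
      (taylorStep n)^[k] fun z => sg e (G z) := by
  induction k generalizing G with
  | zero => exact EventuallyEq.rfl
  | succ k ih =>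
    refine (ih hG.taylorStep).trans (taylorStep_iterate_eventuallyEq ?_ k)
    filter_upwards [hG.eventually] with z hz
    simp only [taylorStep, map_sum, map_mul]
    refine Finset.sum_congr rfl fun b _ => ?_
    rw [sg_of_mem (hn b), mul_zero, ZMod.val_zero, pow_zero, one_smul]
    congr 1
    exact (fderiv_linearMap (sg e).toLinearMap hz.differentiableAt _).symm

omit hn

/-- With `K = Fil O` this says that each step raises the filtration degree; with `K` constant it
gives preservation of parity. -/
theorem taylorStep_iterate_mem (K : ℕ → Submodule ℝ (Gr O))
    (hK : ∀ k b, ∀ u ∈ K k, n b * u ∈ K (k + 1)) {G : Ev par' → Gr O} {m : ℕ}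
    (hG : ∀ᶠ z in 𝓝 y, G z ∈ K m) (k : ℕ) :
    ∀ᶠ z in 𝓝 y, (taylorStep n)^[k] G z ∈ K (m + k) := by
  induction k generalizing G m with
  | zero => exact hG
  | succ k ih =>
    rw [← add_assoc, add_right_comm]
    refine ih ?_
    filter_upwards [hG.eventually_nhds] with z hz
    exact Submodule.sum_mem _ fun b _ => hK _ _ _ (fderiv_mem_submodule _ hz _)

/-- The truncated Taylor expansion of `G (y + n)`. -/
def taylorSum (N : ℕ) (n : EvIx par' → Gr O) (G : Ev par' → Gr O) (y : Ev par') : Gr O :=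
  ∑ k ∈ Finset.range N, ((k.factorial : ℝ))⁻¹ • (taylorStep n)^[k] G y

/-- The exponential of a derivation is multiplicative. Truncation does no harm, since terms of total
order at least `N` lie in `Fil O N = ⊥`. -/
theorem taylorSum_mul {N : ℕ} (hN : Fil O N = ⊥) (hn : ∀ b, n b ∈ parityPart (O := O) 0)
    (hn1 : ∀ b, n b ∈ Fil O 1) {G H : Ev par' → Gr O} (hG : Sm G y) (hH : Sm H y) :
    taylorSum N n (fun z => G z * H z) y = taylorSum N n G y * taylorSum N n H y := by
  set f : ℕ × ℕ → Gr O := fun p =>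
    ((p.1.factorial : ℝ)⁻¹ • (taylorStep n)^[p.1] G y) *
      ((p.2.factorial : ℝ)⁻¹ • (taylorStep n)^[p.2] H y) with hf
  have hK : ∀ k b, ∀ u ∈ Fil O k, n b * u ∈ Fil O (k + 1) := fun k b u hu => by
    rw [add_comm]; exact mul_mem_Fil (hn1 b) hu
  have hmem : ∀ (G : Ev par' → Gr O) k, (taylorStep n)^[k] G y ∈ Fil O k := fun G k => by
    simpa using (taylorStep_iterate_mem (y := y) (G := G) (Fil O) hK (m := 0) (by simp) k).self_of_nhds
  have hzero : ∀ p : ℕ × ℕ, N ≤ p.1 + p.2 → f p = 0 := fun p hp => by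
    have : f p ∈ Fil O (p.1 + p.2) :=
      mul_mem_Fil (Submodule.smul_mem _ _ (hmem G _)) (Submodule.smul_mem _ _ (hmem H _))
    have h2 := Fil_antitone hp this
    rwa [hN, Submodule.mem_bot] at h2
  have hl : taylorSum N n (fun z => G z * H z) y =
      ∑ k ∈ Finset.range N, ∑ p ∈ Finset.HasAntidiagonal.antidiagonal k, f p := by
    refine Finset.sum_congr rfl fun k _ => ?_
    rw [(taylorStep_iterate_mul hn hG hH k).self_of_nhds, Finset.smul_sum]
    refine Finset.sum_congr rfl fun p hp => ?_
    rw [Finset.HasAntidiagonal.mem_antidiagonal] at hp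
    simp only [hf]
    rw [smul_mul_smul_comm, ← Nat.cast_smul_eq_nsmul ℝ, smul_smul]
    congr 1
    rw [← hp, Nat.choose_symm_add, ← Nat.add_choose_mul_factorial_mul_factorial]
    have := Nat.factorial_pos p.1
    have := Nat.factorial_pos p.2
    have : 0 < (p.1 + p.2).choose p.2 := Nat.choose_pos (Nat.le_add_left _ _)
    push_cast
    field_simp
  have hr : taylorSum N n G y * taylorSum N n H y =
      ∑ p ∈ Finset.range N ×ˢ Finset.range N, f p := by
    rw [taylorSum, taylorSum, Finset.sum_mul_sum, Finset.sum_product]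
  -- In the square of index pairs only those below the `N`-th antidiagonal contribute; they are
  -- regrouped by total order.
  rw [hl, hr, ← Finset.sum_filter_of_ne (p := fun p : ℕ × ℕ => p.1 + p.2 < N)
    (fun p _ hp => by by_contra h; exact hp (hzero p (not_lt.mp h))),
    ← Finset.sum_fiberwise_of_maps_to (t := Finset.range N) (g := fun p : ℕ × ℕ => p.1 + p.2)
      (by intro p hp; simpa using (Finset.mem_filter.mp hp).2)]
  refine Finset.sum_congr rfl fun k hk => Finset.sum_congr ?_ fun _ _ => rfl
  ext p
  simp only [Finset.HasAntidiagonal.mem_antidiagonal, Finset.mem_filter, Finset.mem_product, Finset.mem_range]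
    at hk ⊢
  omega

end Taylor

/-! ### The pullback as an algebra homomorphism, and its smoothness -/

section Pull

variable {A : Type v} {B : Type w} {par : A → ZMod 2} {par' : B → ZMod 2}

/-- `F` has smooth components of the right parity in a neighbourhood of `x`. -/
structure IsGerm [Fintype A] (F : SMap par par') (x : Ev par) : Prop where
  smooth : ∀ b, Sm (F b) x
  parity : ∀ᶠ z in 𝓝 x, ∀ b, F b z ∈ parityPart (par' b)

theorem IsGerm.mem [Fintype A] {F : SMap par par'} {x : Ev par} (h : IsGerm F x) (b : B) :
    F b x ∈ parityPart (par' b) := h.parity.self_of_nhds b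

theorem IsGerm.eventually [Fintype A] [Finite B] {F : SMap par par'} {x : Ev par}
    (h : IsGerm F x) : ∀ᶠ z in 𝓝 x, IsGerm F z := by
  filter_upwards [Filter.eventually_all.mpr fun b => (h.smooth b).eventually,
    h.parity.eventually_nhds] with z h1 h2 using ⟨h1, h2⟩

theorem SmoothOn.isGerm [Fintype A] {F : SMap par par'} {U : Set (Ev par)} (h : SmoothOn F U)
    (hU : IsOpen U) {x : Ev par} (hx : x ∈ U) : IsGerm F x where
  smooth b := sm_of_contDiffOn (h.smooth b) hU hx
  parity := by
    filter_upwards [hU.mem_nhds hx] with z hz b using h.parity b z hz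

theorem smoothOn_of_isGerm [Fintype A] {F : SMap par par'} {U : Set (Ev par)}
    (h : ∀ x ∈ U, IsGerm F x) : SmoothOn F U where
  smooth b := contDiffOn_of_sm fun x hx => (h x hx).smooth b
  parity b x hx := (h x hx).mem b

theorem isGerm_coord [Fintype A] [DecidableEq A] (x : Ev par) : IsGerm (par' := par) (coord par) x :=
  ⟨fun b => sm_coord b x, Eventually.of_forall fun z b => coord_mem b z⟩

theorem soul_mem {F : SMap par par'} {x : Ev par} (h : ∀ b, F b x ∈ parityPart (par' b))
    (b : EvIx par') : soul F x b ∈ parityPart 0 :=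
  sub_mem (by simpa only [b.2] using h b) (algebraMap_mem_parityPart _)

theorem soul_mem_Fil (F : SMap par par') (x : Ev par) (b : EvIx par') :
    soul F x b ∈ Fil (OdIx par) 1 := sub_body_mem_Fil _

theorem sm_body {O : Type*} [Finite O] {E : Type*} [NormedAddCommGroup E] [NormedSpace ℝ E]
    {f : E → Gr O} {x : E} (h : Sm f x) : Sm (fun z => body (f z)) x :=
  h.linearMap body.toLinearMap

theorem bodyMap_congr {F' : SMap par par'} (h : ∀ b, F b x = F' b x) :
    bodyMap F x = bodyMap F' x := by
  funext b
  rw [bodyMap, bodyMap, h]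

theorem soul_coord [DecidableEq A] (x : Ev par) : soul (par' := par) (coord par) x = 0 := by
  funext a
  have h : coord par a x = algebraMap ℝ _ (x a) := coord_even a.2 x
  simp [soul, bodyMap, h]

theorem bodyMap_coord [DecidableEq A] (x : Ev par) : bodyMap (par' := par) (coord par) x = x := by
  funext a
  have h : coord par a x = algebraMap ℝ _ (x a) := coord_even a.2 x
  rw [bodyMap, h, body_algebraMap]

section OddSubst

variable [Fintype B] {F : SMap par par'} {x : Ev par}

theorem oddVec_mem (h : ∀ b, F b x ∈ parityPart (par' b)) (m : OdIx par' → ℝ) :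
    oddVec F x m ∈ parityPart 1 := by
  rw [oddVec, Fintype.linearCombination_apply]
  exact Submodule.sum_mem _ fun b _ => Submodule.smul_mem _ _ (by simpa only [b.2] using h b)

/-- The substitution of the odd coordinates as a homomorphism of algebras. -/
def oddHom (F : SMap par par') (x : Ev par) (h : ∀ b, F b x ∈ parityPart (par' b)) :
    Gr (OdIx par') →ₐ[ℝ] Gr (OdIx par) :=
  ExteriorAlgebra.lift ℝ ⟨oddVec F x, fun m => mul_self_of_odd (oddVec_mem h m)⟩

/-- Odd elements square to zero, so with the right parities the default branch of `oddSubst` does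
not occur. -/
theorem oddSubst_eq (h : ∀ b, F b x ∈ parityPart (par' b)) (u : Gr (OdIx par')) :
    oddSubst F x u = oddHom F x h u := by
  rw [oddSubst, dif_pos fun m => mul_self_of_odd (oddVec_mem h m)]
  rfl

theorem oddHom_ι (h : ∀ b, F b x ∈ parityPart (par' b)) (m : OdIx par' → ℝ) :
    oddHom F x h (ExteriorAlgebra.ι ℝ m) = oddVec F x m := by
  rw [oddHom, ExteriorAlgebra.lift_ι_apply]

theorem oddVec_single [DecidableEq B] (b : OdIx par') : oddVec F x (Pi.single b 1) = F b x := by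
  rw [oddVec, Fintype.linearCombination_apply_single, one_smul]

theorem oddHom_sg (h : ∀ b, F b x ∈ parityPart (par' b)) (e : ZMod 2) (u : Gr (OdIx par')) :
    oddHom F x h (sg e u) = sg e (oddHom F x h u) := by
  have : (oddHom F x h).comp (sg e) = (sg e).comp (oddHom F x h) := by
    refine ExteriorAlgebra.hom_ext (LinearMap.ext fun m => ?_)
    simp only [LinearMap.comp_apply, AlgHom.toLinearMap_apply, AlgHom.comp_apply]
    rw [sg_ι, map_smul, oddHom_ι, sg_of_mem (oddVec_mem h m), mul_one]
  exact DFunLike.congr_fun this u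

theorem oddHom_mem (h : ∀ b, F b x ∈ parityPart (par' b)) {e : ZMod 2} {u : Gr (OdIx par')}
    (hu : u ∈ parityPart e) : oddHom F x h u ∈ parityPart e := by
  rw [mem_parityPart_iff] at hu ⊢
  rw [← oddHom_sg, hu, map_smul]

theorem body_oddHom (h : ∀ b, F b x ∈ parityPart (par' b)) (u : Gr (OdIx par')) :
    body (oddHom F x h u) = body u := by
  have : body.comp (oddHom F x h) = body := by
    refine ExteriorAlgebra.hom_ext (LinearMap.ext fun m => ?_)
    simp only [LinearMap.comp_apply, AlgHom.toLinearMap_apply, AlgHom.comp_apply]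
    rw [oddHom_ι, body_of_odd (oddVec_mem h m), body_ι]
  exact DFunLike.congr_fun this u

theorem oddHom_mem_Fil (h : ∀ b, F b x ∈ parityPart (par' b)) {m : ℕ} {u : Gr (OdIx par')}
    (hu : u ∈ Fil (OdIx par') m) : oddHom F x h u ∈ Fil (OdIx par) m := by
  induction m generalizing u with
  | zero => simp
  | succ m ih =>
    refine Fil_induction (C := fun u => oddHom F x h u ∈ Fil (OdIx par) (m + 1)) ?_ ?_ hu
    · intro u u' hu hu'; rw [map_add]; exact add_mem hu hu'
    · intro v u hu
      rw [map_mul, oddHom_ι, add_comm]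
      exact mul_mem_Fil (mem_Fil_one.mpr (body_of_odd (oddVec_mem h v))) (ih hu)

theorem sm_oddSubst [Fintype A] (h : IsGerm F x) (u : Gr (OdIx par')) :
    Sm (fun z => oddSubst F z u) x := by
  induction u using ExteriorAlgebra.induction with
  | algebraMap r =>
    refine (sm_const (algebraMap ℝ _ r) x).congr ?_
    filter_upwards [h.parity] with z hz
    rw [oddSubst_eq hz, AlgHom.commutes]
  | ι m =>
    refine (sm_sum (s := Finset.univ) (f := fun (b : OdIx par') z => m b • F b z) (y := x)
      fun b _ => (h.smooth b).const_smul _).congr ?_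
    filter_upwards [h.parity] with z hz
    rw [oddSubst_eq hz, oddHom_ι, oddVec, Fintype.linearCombination_apply]
  | mul a b ha hb =>
    refine (ha.mul hb).congr ?_
    filter_upwards [h.parity] with z hz
    simp only [oddSubst_eq hz, map_mul]
  | add a b ha hb =>
    refine (ha.add hb).congr ?_
    filter_upwards [h.parity] with z hz
    simp only [oddSubst_eq hz, map_add]

end OddSubst

variable [Fintype A] [Fintype B] {F : SMap par par'} {x : Ev par}

theorem sm_bodyMap (h : IsGerm F x) : Sm (bodyMap F) x :=
  sm_pi fun b => sm_body (h.smooth b)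

theorem IsGerm.eventually_bodyMap (h : IsGerm F x) {p : Ev par' → Prop}
    (hp : ∀ᶠ y in 𝓝 (bodyMap F x), p y) : ∀ᶠ z in 𝓝 x, p (bodyMap F z) :=
  (sm_bodyMap h).continuousAt.eventually hp

variable [DecidableEq B]

theorem pull_eq_taylorSum (F : SMap par par') (G : SFun par') (x : Ev par) :
    pull F G x = taylorSum (Fintype.card A + 1) (soul F x) (fun z => oddSubst F x (G z))
      (bodyMap F x) := rfl

/-- The truncation order in `pull` is large enough because there are at most `card A` odd
coordinates. -/
theorem Fil_card_eq_bot : Fil (OdIx par) (Fintype.card A + 1) = ⊥ :=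
  Fil_eq_bot (Nat.lt_succ_of_le (Fintype.card_subtype_le _))

theorem pull_congr {G H : SFun par'} (h : G =ᶠ[𝓝 (bodyMap F x)] H) : pull F G x = pull F H x := by
  refine Finset.sum_congr rfl fun k _ => ?_
  congr 1
  refine (taylorStep_iterate_eventuallyEq ?_ k).self_of_nhds
  filter_upwards [h] with z hz
  rw [hz]

/-- Body, soul and odd substitution at `x` involve `F` only through its values at `x`. Agreement at
one point therefore suffices, in contrast to the dependence on `G`, which is through its germ. -/
theorem pull_congr_left {F' : SMap par par'} (h : ∀ b, F b x = F' b x) (G : SFun par') :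
    pull F G x = pull F' G x := by
  have h1 := bodyMap_congr h
  have h2 : soul F x = soul F' x := by funext b; rw [soul, soul, h, h1]
  have h3 : oddVec F x = oddVec F' x := by
    rw [oddVec, oddVec]; congr 1; funext b; exact h b
  have h4 : oddSubst F x = oddSubst F' x := by
    unfold oddSubst
    generalize oddVec F x = v at h3 ⊢
    subst h3
    rfl
  rw [pull, pull, h1, h2, h4]

theorem pull_add {G H : SFun par'} (hG : Sm G (bodyMap F x)) (hH : Sm H (bodyMap F x)) :
    pull F (fun z => G z + H z) x = pull F G x + pull F H x := by
  simp only [pull, ← Finset.sum_add_distrib, ← smul_add, map_add]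
  refine Finset.sum_congr rfl fun k _ => ?_
  congr 1
  exact (taylorStep_iterate_add (hG.linearMap _) (hH.linearMap _) k).self_of_nhds

theorem pull_sum {κ : Type*} (s : Finset κ) {G : κ → SFun par'}
    (hG : ∀ i, Sm (G i) (bodyMap F x)) :
    pull F (fun z => ∑ i ∈ s, G i z) x = ∑ i ∈ s, pull F (G i) x := by
  simp only [pull, map_sum]
  rw [Finset.sum_comm]
  refine Finset.sum_congr rfl fun k _ => ?_
  rw [← Finset.smul_sum]
  congr 1
  exact (taylorStep_iterate_sum s (fun i => (hG i).linearMap _) k).self_of_nhds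

theorem pull_mul (hF : ∀ b, F b x ∈ parityPart (par' b)) {G H : SFun par'}
    (hG : Sm G (bodyMap F x)) (hH : Sm H (bodyMap F x)) :
    pull F (fun z => G z * H z) x = pull F G x * pull F H x := by
  simp only [pull_eq_taylorSum]
  rw [← taylorSum_mul Fil_card_eq_bot (soul_mem hF) (soul_mem_Fil F x) (hG.linearMap _) (hH.linearMap _)]
  simp only [oddSubst_eq hF, map_mul]

theorem pull_const_eq (F : SMap par par') (x : Ev par) (c : Gr (OdIx par')) :
    pull F (fun _ => c) x = oddSubst F x c := by
  rw [pull, Finset.sum_range_succ']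
  simp [Function.iterate_succ_apply, taylorStep_const, taylorStep_iterate_zero]

theorem pull_algebraMap (hF : ∀ b, F b x ∈ parityPart (par' b)) (r : ℝ) :
    pull F (fun _ => algebraMap ℝ _ r) x = algebraMap ℝ _ r := by
  rw [pull_const_eq, oddSubst_eq hF, AlgHom.commutes]

theorem pull_const_smul (hF : ∀ b, F b x ∈ parityPart (par' b)) (c : ℝ) {G : SFun par'}
    (hG : Sm G (bodyMap F x)) : pull F (fun z => c • G z) x = c • pull F G x := by
  simp only [Algebra.smul_def]
  rw [pull_mul hF (sm_const _ _) hG, pull_algebraMap hF]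

theorem pull_coord (hF : ∀ b, F b x ∈ parityPart (par' b)) (b : B) :
    pull F (coord par' b) x = F b x := by
  rcases zmod_two_cases (par' b) with hb | hb
  · have h0 : (fun z => oddSubst F x (coord par' b z)) =
        fun z => algebraMap ℝ _ (z ⟨b, hb⟩) := by
      funext z
      rw [coord_even hb, oddSubst_eq hF, AlgHom.commutes]
    have h1 : taylorStep (soul F x) (fun z : Ev par' => algebraMap ℝ (Gr (OdIx par))
        (z ⟨b, hb⟩)) = fun _ => soul F x ⟨b, hb⟩ := by
      funext z
      rw [taylorStep, Finset.sum_eq_single ⟨b, hb⟩]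
      · have := fderiv_linearMap (f := fun z : Ev par' => z ⟨b, hb⟩) (y := z)
          (Algebra.linearMap ℝ (Gr (OdIx par))) (differentiableAt_apply _ _)
          (Pi.single ⟨b, hb⟩ 1)
        rw [fderiv_apply differentiableAt_id] at this
        refine (congrArg _ this).trans ?_
        simp
      · intro c _ hc
        have := fderiv_linearMap (f := fun z : Ev par' => z ⟨b, hb⟩) (y := z)
          (Algebra.linearMap ℝ (Gr (OdIx par))) (differentiableAt_apply _ _)
          (Pi.single c 1)
        rw [fderiv_apply differentiableAt_id] at this
        refine (congrArg _ this).trans ?_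
        simp [hc.symm]
      · simp
    rw [pull, h0, Finset.sum_range_succ']
    simp only [Function.iterate_succ_apply, h1, Function.iterate_zero_apply]
    have h2 : F b x = soul F x ⟨b, hb⟩ + algebraMap ℝ _ (bodyMap F x ⟨b, hb⟩) := by
      rw [soul, sub_add_cancel]
    rw [h2]
    congr 1
    -- If `card A = 0`, the sum has no first-order term, but then `Fil _ 1 = ⊥` and the soul is
    -- zero. Otherwise the first-order term is the soul and all later ones vanish.
    · rcases Nat.eq_zero_or_pos (Fintype.card A) with hA | hA
      · have h3 := soul_mem_Fil F x ⟨b, hb⟩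
        have h4 := Fil_card_eq_bot (par := par)
        rw [hA, zero_add] at h4
        rw [h4, Submodule.mem_bot] at h3
        rw [h3, hA]
        simp
      · obtain ⟨N, hN⟩ := Nat.exists_eq_add_of_le' hA
        rw [hN, Finset.sum_range_succ']
        simp [Function.iterate_succ_apply, taylorStep_const, taylorStep_iterate_zero]
    · simp
  · rw [funext (coord_odd hb), pull_const_eq, oddSubst_eq hF, oddHom_ι, oddVec_single]

/-- Every Taylor term of positive order contains a soul factor and so has no body. -/
theorem body_pull (hF : ∀ b, F b x ∈ parityPart (par' b)) (G : SFun par') :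
    body (pull F G x) = body (G (bodyMap F x)) := by
  rw [pull, Finset.sum_range_succ', map_add, map_sum, Finset.sum_eq_zero]
  · simp [oddSubst_eq hF, body_oddHom]
  · intro k _
    have h := (taylorStep_iterate_mem (n := soul F x) (y := bodyMap F x)
      (G := fun z => oddSubst F x (G z)) (Fil (OdIx par)) (fun k b u hu => by
        rw [add_comm]; exact mul_mem_Fil (soul_mem_Fil F x b) hu) (m := 0) (by simp)
        (k + 1)).self_of_nhds
    rw [map_smul, mem_Fil_one.mp (Fil_antitone (by omega) h), smul_zero]

theorem pull_mem (hF : ∀ b, F b x ∈ parityPart (par' b)) {G : SFun par'} {e : ZMod 2}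
    (hG : ∀ᶠ z in 𝓝 (bodyMap F x), G z ∈ parityPart e) : pull F G x ∈ parityPart e := by
  refine Submodule.sum_mem _ fun k _ => Submodule.smul_mem _ _ ?_
  refine (taylorStep_iterate_mem (n := soul F x) (fun _ => parityPart e)
    (fun _ b u hu => mul_mem_parityPart' (soul_mem hF b) hu (zero_add e)) (m := 0) ?_
    k).self_of_nhds
  filter_upwards [hG] with z hz
  rw [oddSubst_eq hF]
  exact oddHom_mem hF hz

theorem sg_pull (hF : ∀ b, F b x ∈ parityPart (par' b)) (e : ZMod 2) {G : SFun par'}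
    (hG : Sm G (bodyMap F x)) : sg e (pull F G x) = pull F (fun z => sg e (G z)) x := by
  simp only [pull, map_sum, map_smul]
  refine Finset.sum_congr rfl fun k _ => ?_
  congr 1
  refine (sg_taylorStep_iterate (soul_mem hF) e (hG.linearMap _) k).self_of_nhds.trans ?_
  simp only [oddSubst_eq hF, oddHom_sg]

theorem oddSubst_coord [DecidableEq A] (x : Ev par) (u : Gr (OdIx par)) :
    oddSubst (coord par) x u = u := by
  have hF : ∀ b, coord par b x ∈ parityPart (par b) := fun b => coord_mem b x
  rw [oddSubst_eq hF]
  have : oddHom (coord par) x hF = AlgHom.id ℝ _ := by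
    refine ExteriorAlgebra.hom_ext (LinearMap.ext fun m => ?_)
    simp only [LinearMap.comp_apply, AlgHom.toLinearMap_apply, AlgHom.id_apply]
    rw [oddHom_ι, oddVec, Fintype.linearCombination_apply]
    conv_rhs => rw [← Finset.univ_sum_single m, map_sum]
    refine Finset.sum_congr rfl fun b _ => ?_
    rw [coord_odd b.2, ← map_smul, ← Pi.single_smul, smul_eq_mul, mul_one]
  rw [this]
  rfl

theorem taylorStep_soul_zero {O : Type*} [Finite O] (G : Ev par' → Gr O) :
    taylorStep 0 G = fun _ => 0 := by
  funext z
  simp [taylorStep]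

theorem pull_id [DecidableEq A] (G : SFun par) (x : Ev par) : pull (coord par) G x = G x := by
  rw [pull, Finset.sum_range_succ', Finset.sum_eq_zero]
  · simp [bodyMap_coord, oddSubst_coord]
  · intro k _
    rw [Function.iterate_succ_apply, soul_coord, taylorStep_soul_zero, taylorStep_iterate_zero,
      smul_zero]

section Smoothness

variable {E : Type*} [NormedAddCommGroup E] [NormedSpace ℝ E]

/-- In a pullback the increment and the function being expanded both vary with the source point.
Smoothness is therefore proved jointly in source and target points, and then restricted to the graph
of the body map. -/
theorem sm_taylorStep_joint {O : Type*} [Finite O] {n : E → EvIx par' → Gr O}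
    {H : E → Ev par' → Gr O} {x : E} {y : Ev par'} (hn : ∀ b, Sm (fun z => n z b) x)
    (hH : Sm (fun p : E × Ev par' => H p.1 p.2) (x, y)) :
    Sm (fun p : E × Ev par' => taylorStep (n p.1) (H p.1) p.2) (x, y) := by
  refine sm_sum fun b _ => Sm.mul ?_ ?_
  · exact Sm.comp (g := fun z => n z b) (f := fun p : E × Ev par' => p.1) (hn b)
      (sm_of_contDiff contDiff_fst _)
  · filter_upwards [hH] with p hp
    refine ContDiffAt.clm_apply ?_ contDiffAt_const
    refine ContDiffAt.fderiv (f := fun (p : E × Ev par') => H p.1) (g := fun p => p.2) (n := ∞)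
      ?_ contDiffAt_snd (by simp)
    exact ContDiffAt.comp (g := fun p : E × Ev par' => H p.1 p.2)
      (f := fun q : (E × Ev par') × Ev par' => (q.1.1, q.2)) (p, p.2) hp
      ((contDiffAt_fst.comp _ contDiffAt_fst).prodMk contDiffAt_snd)

theorem sm_taylorStep_iterate_joint {O : Type*} [Finite O] {n : E → EvIx par' → Gr O}
    {H : E → Ev par' → Gr O} {x : E} {y : Ev par'} (hn : ∀ b, Sm (fun z => n z b) x)
    (hH : Sm (fun p : E × Ev par' => H p.1 p.2) (x, y)) (k : ℕ) :
    Sm (fun p : E × Ev par' => (taylorStep (n p.1))^[k] (H p.1) p.2) (x, y) := by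
  induction k generalizing H with
  | zero => exact hH
  | succ k ih => exact ih (H := fun z => taylorStep (n z) (H z)) (sm_taylorStep_joint hn hH)

end Smoothness

theorem Sm.pull (hF : IsGerm F x) {G : SFun par'} (hG : Sm G (bodyMap F x)) :
    Sm (pull F G) x := by
  refine sm_sum fun k _ => Sm.const_smul _ ?_
  have hn : ∀ b, Sm (fun z => soul F z b) x := fun b =>
    (hF.smooth b).sub (Sm.linearMap (Algebra.linearMap ℝ (Gr (OdIx par)))
      (sm_body (hF.smooth b)))
  have hH : Sm (fun p : Ev par × Ev par' => Super.oddSubst F p.1 (G p.2)) (x, bodyMap F x) := by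
    -- Expanding `G` in a basis separates the variables: coefficients depend on the target point,
    -- substituted basis vectors on the source point.
    let β := Module.finBasis ℝ (Gr (OdIx par'))
    have h1 : (fun p : Ev par × Ev par' => Super.oddSubst F p.1 (G p.2)) =
        fun p => ∑ i, β.coord i (G p.2) • Super.oddSubst F p.1 (β i) := by
      funext p
      conv_lhs => rw [← β.sum_repr (G p.2), map_sum]
      simp only [map_smul, Module.Basis.coord_apply]
    rw [h1]
    refine sm_sum fun i _ => Sm.smul ?_ ?_
    · exact Sm.linearMap (β.coord i) (Sm.comp (g := G) (f := fun p : Ev par × Ev par' => p.2) hG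
        (sm_of_contDiff contDiff_snd _))
    · exact Sm.comp (g := fun z => Super.oddSubst F z (β i)) (f := fun p : Ev par × Ev par' => p.1)
        (sm_oddSubst hF _) (sm_of_contDiff contDiff_fst _)
  exact Sm.comp (g := fun p : Ev par × Ev par' => (Super.taylorStep (soul F p.1))^[k]
    (fun y => Super.oddSubst F p.1 (G y)) p.2) (f := fun z => (z, bodyMap F z))
    (sm_taylorStep_iterate_joint (H := fun x y => Super.oddSubst F x (G y)) hn hH k)
    (by filter_upwards [sm_bodyMap hF] with z hz using contDiffAt_id.prodMk hz)

/-- The composition of maps of superdomains. -/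
theorem IsGerm.comp {C : Type*} {par'' : C → ZMod 2} {G : SMap par' par''} (hF : IsGerm F x)
    (hG : IsGerm G (bodyMap F x)) : IsGerm (par' := par'') (fun c => Super.pull F (G c)) x where
  smooth c := (hG.smooth c).pull hF
  parity := by
    filter_upwards [hF.parity, (sm_bodyMap hF).continuousAt.eventually hG.parity.eventually_nhds]
      with z h1 h2 c
    exact pull_mem h1 (h2.mono fun y hy => hy c)

theorem bodyMap_pull {C : Type*} {par'' : C → ZMod 2} (G : SMap par' par'')
    (hF : ∀ b, F b x ∈ parityPart (par' b)) :
    bodyMap (par' := par'') (fun c => pull F (G c)) x = bodyMap G (bodyMap F x) := by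
  funext c
  exact body_pull hF (G c)

end Pull

end Super

end

noncomputable section

namespace Super

open Filter Topology MeasureTheory
open scoped ContDiff

/-! ### Hadamard's lemma with smooth coefficients -/

section Hadamard

variable {E F : Type*} [NormedAddCommGroup E] [NormedSpace ℝ E]

theorem add_smul_sub_mem_closedBall {y z : E} {r t : ℝ} (hz : z ∈ Metric.closedBall y r)
    (ht : t ∈ Set.Icc (0 : ℝ) 1) : y + t • (z - y) ∈ Metric.closedBall y r := by
  rw [mem_closedBall_iff_norm] at hz ⊢
  rw [add_sub_cancel_left, norm_smul, Real.norm_of_nonneg ht.1]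
  exact (mul_le_of_le_one_left (norm_nonneg _) ht.2).trans hz

variable [FiniteDimensional ℝ E] [NormedAddCommGroup F] [NormedSpace ℝ F]

/-- Differentiating under the integral yields a factor `t`; the weight `t ^ k` makes this family of
integrals closed under differentiation. -/
theorem hasFDerivAt_segment_integral {h : E → F} {y z : E} {R : ℝ} (k : ℕ)
    (hh : ContDiffOn ℝ 1 h (Metric.ball y R)) (hz : z ∈ Metric.ball y R) :
    HasFDerivAt (fun z => ∫ t in (0 : ℝ)..1, t ^ k • h (y + t • (z - y)))
      (∫ t in (0 : ℝ)..1, t ^ (k + 1) • fderiv ℝ h (y + t • (z - y))) z := by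
  obtain ⟨r, hr, hrR⟩ := exists_between (Metric.mem_ball.mp hz)
  have hsub : Metric.closedBall y r ⊆ Metric.ball y R := Metric.closedBall_subset_ball hrR
  have hc : ContinuousOn h (Metric.ball y R) := hh.continuousOn
  have hd : ContinuousOn (fderiv ℝ h) (Metric.ball y R) :=
    hh.continuousOn_fderiv_of_isOpen Metric.isOpen_ball le_rfl
  obtain ⟨C, hC⟩ := (isCompact_closedBall y r).exists_bound_of_continuousOn (hd.mono hsub)
  have hpath : ∀ x ∈ Metric.ball y r, ∀ t ∈ Set.Icc (0 : ℝ) 1,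
      y + t • (x - y) ∈ Metric.closedBall y r := fun x hx t ht =>
    add_smul_sub_mem_closedBall (Metric.ball_subset_closedBall hx) ht
  have hcont : ∀ x ∈ Metric.ball y r,
      ContinuousOn (fun t : ℝ => t ^ k • h (y + t • (x - y))) (Set.Icc 0 1) := fun x hx =>
    (continuous_pow k).continuousOn.smul (hc.comp (by fun_prop) fun t ht => hsub (hpath x hx t ht))
  have hcont' : ContinuousOn (fun t : ℝ => t ^ (k + 1) • fderiv ℝ h (y + t • (z - y)))
      (Set.Icc 0 1) :=
    (continuous_pow _).continuousOn.smul
      (hd.comp (by fun_prop) fun t ht => hsub (hpath z hr t ht))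
  have hIoc : Set.uIoc (0 : ℝ) 1 ⊆ Set.Icc 0 1 := by
    rw [Set.uIoc_of_le zero_le_one]; exact Set.Ioc_subset_Icc_self
  have hmeas : MeasurableSet (Set.uIoc (0 : ℝ) 1) := measurableSet_uIoc
  refine intervalIntegral.hasFDerivAt_integral_of_dominated_of_fderiv_le
    (F := fun z t => t ^ k • h (y + t • (z - y)))
    (F' := fun z t => t ^ (k + 1) • fderiv ℝ h (y + t • (z - y)))
    (bound := fun _ => C) (Metric.isOpen_ball.mem_nhds hr) ?_ ?_ ?_ ?_ ?_ ?_
  · filter_upwards [Metric.isOpen_ball.mem_nhds hr] with x hx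
    exact ((hcont x hx).mono hIoc).aestronglyMeasurable hmeas
  · exact ContinuousOn.intervalIntegrable (by
      rw [Set.uIcc_of_le zero_le_one]; exact hcont z hr)
  · exact (hcont'.mono hIoc).aestronglyMeasurable hmeas
  · refine Eventually.of_forall fun t ht x hx => ?_
    have ht' := hIoc ht
    rw [norm_smul, norm_pow, Real.norm_of_nonneg ht'.1]
    exact (mul_le_of_le_one_left (norm_nonneg _) (pow_le_one₀ ht'.1 ht'.2)).trans
      (hC _ (hpath x hx t ht'))
  · exact intervalIntegrable_const
  · refine Eventually.of_forall fun t ht x hx => ?_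
    have hx' := hsub (hpath x hx t (hIoc ht))
    have h1 : HasFDerivAt h (fderiv ℝ h (y + t • (x - y))) (y + t • (x - y)) :=
      ((hh.contDiffAt (Metric.isOpen_ball.mem_nhds hx')).differentiableAt one_ne_zero).hasFDerivAt
    have h2 : HasFDerivAt (fun x : E => y + t • (x - y)) (t • ContinuousLinearMap.id ℝ E) x :=
      (((hasFDerivAt_id x).sub_const y).const_smul t).const_add y
    have h3 := (h1.comp x h2).const_smul (t ^ k)
    refine h3.congr_fderiv ?_
    ext e
    simp [pow_succ, smul_smul]

/-- Induction on the order `n`, for all weights and integrands at once, since the derivative has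
weight `k + 1` and integrand a directional derivative of `h`. -/
theorem contDiffOn_segment_integral {y : E} {R : ℝ} (n : ℕ) : ∀ (k : ℕ) {h : E → F},
    ContDiffOn ℝ ∞ h (Metric.ball y R) →
    ContDiffOn ℝ n (fun z => ∫ t in (0 : ℝ)..1, t ^ k • h (y + t • (z - y)))
      (Metric.ball y R) := by
  have hder : ∀ (k : ℕ) {h : E → F}, ContDiffOn ℝ ∞ h (Metric.ball y R) →
      ∀ z ∈ Metric.ball y R, HasFDerivAt
        (fun z => ∫ t in (0 : ℝ)..1, t ^ k • h (y + t • (z - y)))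
        (∫ t in (0 : ℝ)..1, t ^ (k + 1) • fderiv ℝ h (y + t • (z - y))) z :=
    fun k h hh z hz => hasFDerivAt_segment_integral k (hh.of_le (by simp)) hz
  induction n with
  | zero =>
    intro k h hh
    rw [Nat.cast_zero, contDiffOn_zero]
    exact fun z hz => (hder k hh z hz).continuousAt.continuousWithinAt
  | succ n ih =>
    intro k h hh
    have hd : ContDiffOn ℝ ∞ (fderiv ℝ h) (Metric.ball y R) :=
      hh.fderiv_of_isOpen Metric.isOpen_ball (by simp)
    rw [Nat.cast_succ, contDiffOn_succ_iff_fderiv_of_isOpen Metric.isOpen_ball]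
    refine ⟨fun z hz => (hder k hh z hz).differentiableAt.differentiableWithinAt, by simp, ?_⟩
    rw [contDiffOn_clm_apply]
    intro e
    refine (ih (k + 1) (h := fun z => fderiv ℝ h z e) (hd.clm_apply contDiffOn_const)).congr ?_
    intro z hz
    rw [(hder k hh z hz).fderiv]
    have hint : IntervalIntegrable (fun t : ℝ => t ^ (k + 1) • fderiv ℝ h (y + t • (z - y)))
        volume 0 1 := by
      refine ContinuousOn.intervalIntegrable ?_
      rw [Set.uIcc_of_le zero_le_one]
      refine (continuous_pow _).continuousOn.smul (hd.continuousOn.comp (by fun_prop) ?_)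
      intro t ht
      obtain ⟨r, hr, hrR⟩ := exists_between (Metric.mem_ball.mp hz)
      exact Metric.closedBall_subset_ball hrR (add_smul_sub_mem_closedBall
        (Metric.mem_closedBall.mpr hr.le) ht)
    rw [ContinuousLinearMap.intervalIntegral_apply hint]
    rfl

/-- Hadamard's lemma. -/
theorem exists_hadamard [CompleteSpace F] {κ : Type*} [Fintype κ] [DecidableEq κ] {f : (κ → ℝ) → F} {y : κ → ℝ}
    (hf : Sm f y) : ∃ g : κ → (κ → ℝ) → F, (∀ b, Sm (g b) y) ∧
      f =ᶠ[𝓝 y] fun z => f y + ∑ b, (z b - y b) • g b z := by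
  obtain ⟨R, hR, hball⟩ := Metric.eventually_nhds_iff_ball.mp hf
  have hf' : ContDiffOn ℝ ∞ f (Metric.ball y R) := fun z hz =>
    (hball z hz).contDiffWithinAt
  have hd : ContDiffOn ℝ ∞ (fderiv ℝ f) (Metric.ball y R) :=
    hf'.fderiv_of_isOpen Metric.isOpen_ball (by simp)
  -- The coefficients are the averages of the partial derivatives along the segment from `y` to `z`;
  -- the trivial weight `t ^ 0` fits the preceding lemma.
  refine ⟨fun b z => ∫ t in (0 : ℝ)..1, t ^ 0 • fderiv ℝ f (y + t • (z - y)) (Pi.single b 1),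
    fun b => sm_of_contDiffOn (contDiffOn_infty.mpr fun n =>
      contDiffOn_segment_integral n 0 (hd.clm_apply contDiffOn_const)) Metric.isOpen_ball
      (Metric.mem_ball_self hR), ?_⟩
  filter_upwards [Metric.ball_mem_nhds y hR] with z hz
  have hpath : ∀ t ∈ Set.uIcc (0 : ℝ) 1, y + t • (z - y) ∈ Metric.ball y R := by
    intro t ht
    rw [Set.uIcc_of_le zero_le_one] at ht
    obtain ⟨r, hr, hrR⟩ := exists_between (Metric.mem_ball.mp hz)
    exact Metric.closedBall_subset_ball hrR (add_smul_sub_mem_closedBall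
      (Metric.mem_closedBall.mpr hr.le) ht)
  have hcont : ∀ e, IntervalIntegrable (fun t : ℝ => fderiv ℝ f (y + t • (z - y)) e)
      volume 0 1 := fun e => ContinuousOn.intervalIntegrable
    ((hd.clm_apply contDiffOn_const).continuousOn.comp (by fun_prop) hpath)
  have hint := intervalIntegral.integral_eq_sub_of_hasDerivAt
    (f := fun t : ℝ => f (y + t • (z - y)))
    (f' := fun t : ℝ => fderiv ℝ f (y + t • (z - y)) (z - y)) (a := 0) (b := 1) (fun t ht => by
      have h1 := ((hball _ (hpath t ht)).differentiableAt (by simp)).hasFDerivAt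
      have h2 : HasDerivAt (fun t : ℝ => y + t • (z - y)) (z - y) t := by
        simpa using ((hasDerivAt_id t).smul_const (z - y)).const_add y
      exact h1.comp_hasDerivAt t h2) (hcont _)
  simp only [one_smul, zero_smul, add_zero, add_sub_cancel] at hint
  rw [← sub_eq_iff_eq_add', ← hint]
  have hsum : ∀ t : ℝ, fderiv ℝ f (y + t • (z - y)) (z - y) =
      ∑ b, (z b - y b) • fderiv ℝ f (y + t • (z - y)) (Pi.single b 1) := by
    intro t
    refine (congrArg _ (Finset.univ_sum_single (z - y)).symm).trans ?_
    rw [map_sum]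
    refine Finset.sum_congr rfl fun b _ => ?_
    rw [← map_smul, ← Pi.single_smul, smul_eq_mul, mul_one, Pi.sub_apply]
  simp only [hsum, pow_zero, one_smul]
  refine (intervalIntegral.integral_finsetSum fun b _ => (hcont _).smul (z b - y b)).trans ?_
  exact Finset.sum_congr rfl fun b _ => intervalIntegral.integral_smul _ _

end Hadamard

end Super

end

noncomputable section

namespace Super

open Filter Topology
open scoped ContDiff

/-! ### Operations on germs are determined by the coordinates -/

section Uniqueness

variable {B : Type w} [Fintype B] [DecidableEq B] {par' : B → ZMod 2} {O : Type*} [Finite O]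

/-- A generalized derivation on germs of superfunctions that kills the coordinates vanishes. -/
theorem eq_zero_of_leibniz {y : Ev par'} (Δ φ φ' : SFun par' → Gr O)
    (hcongr : ∀ G H, G =ᶠ[𝓝 y] H → Δ G = Δ H)
    (hadd : ∀ G H, Sm G y → Sm H y → Δ (fun z => G z + H z) = Δ G + Δ H)
    (hmul : ∀ G H, Sm G y → Sm H y → Δ (fun z => G z * H z) = Δ G * φ H + φ' G * Δ H)
    (hconst : ∀ r, Δ (fun _ => algebraMap ℝ _ r) = 0)
    (hcoord : ∀ b, Δ (coord par' b) = 0)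
    (hnil : ∀ b : EvIx par', φ' (fun z => coord par' b z + algebraMap ℝ _ (-y b)) ∈ Fil O 1)
    {G : SFun par'} (hG : Sm G y) : Δ G = 0 := by
  have h0 : Δ (fun _ => 0) = 0 := by simpa using hconst 0
  have hsum : ∀ {κ : Type w} (s : Finset κ) (H : κ → SFun par'), (∀ i, Sm (H i) y) →
      Δ (fun z => ∑ i ∈ s, H i z) = ∑ i ∈ s, Δ (H i) := by
    classical
    intro κ s H hH
    induction s using Finset.induction_on with
    | empty => simpa using h0
    | insert i s hi ih =>
      simp only [Finset.sum_insert hi]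
      rw [hadd _ _ (hH i) (sm_sum fun j _ => hH j), ih]
  -- A constant Grassmann element is a polynomial in the odd coordinates, so it is killed as well.
  have hc : ∀ w : Gr (OdIx par'), Δ (fun _ => w) = 0 := by
    intro w
    induction w using ExteriorAlgebra.induction with
    | algebraMap r => exact hconst r
    | ι m =>
      have h1 : (fun _ : Ev par' => ExteriorAlgebra.ι ℝ m) = fun z =>
          ∑ b : OdIx par', algebraMap ℝ _ (m b) * coord par' b.1 z := by
        funext z
        conv_lhs => rw [← Finset.univ_sum_single m, map_sum]
        refine Finset.sum_congr rfl fun b _ => ?_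
        rw [coord_odd b.2, ← Algebra.smul_def, ← map_smul, ← Pi.single_smul, smul_eq_mul, mul_one]
      rw [h1, hsum Finset.univ (fun (b : OdIx par') z => algebraMap ℝ _ (m b) * coord par' b.1 z)
        fun b => (sm_const _ _).mul (sm_coord b.1 y)]
      refine Finset.sum_eq_zero fun b _ => ?_
      rw [hmul _ _ (sm_const _ _) (sm_coord _ _), hconst, hcoord, zero_mul, mul_zero, add_zero]
    | mul a b ha hb => rw [hmul _ _ (sm_const a _) (sm_const b _), ha, hb, zero_mul, mul_zero, add_zero]
    | add a b ha hb => rw [hadd _ _ (sm_const a _) (sm_const b _), ha, hb, add_zero]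
  -- By Hadamard, `G` is a constant plus a sum of products of coordinate differences with smooth
  -- germs `g b`. In such a product the Leibniz rule leaves only `φ'` of the difference times `Δ (g
  -- b)`, and the first factor lies in `Fil O 1`. Each application thus gains a filtration degree.
  have key : ∀ (m : ℕ) (G : SFun par'), Sm G y → Δ G ∈ Fil O m := by
    intro m
    induction m with
    | zero => simp
    | succ m ih =>
      intro G hG
      obtain ⟨g, hg, hGg⟩ := exists_hadamard hG
      have hn : ∀ b : EvIx par', Sm (fun z => coord par' b z + algebraMap ℝ _ (-y b)) y :=
        fun b => (sm_coord _ _).add (sm_const _ _)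
      have h1 : G =ᶠ[𝓝 y] fun z => G y +
          ∑ b : EvIx par', (coord par' b z + algebraMap ℝ _ (-y b)) * g b z := by
        filter_upwards [hGg] with z hz
        rw [hz]
        congr 1
        refine Finset.sum_congr rfl fun b _ => ?_
        rw [coord_even b.2, ← map_add, ← sub_eq_add_neg, Algebra.smul_def]
      rw [hcongr _ _ h1, hadd _ _ (sm_const _ _) (sm_sum fun b _ => (hn b).mul (hg b)), hc, zero_add,
        hsum _ _ fun b => (hn b).mul (hg b)]
      refine Submodule.sum_mem _ fun b _ => ?_
      rw [hmul _ _ (hn b) (hg b), hadd _ _ (sm_coord _ _) (sm_const _ _), hcoord, hconst, add_zero,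
        zero_mul, zero_add, add_comm m]
      exact mul_mem_Fil (hnil b) (ih _ (hg b))
  cases nonempty_fintype O
  have := key (Fintype.card O + 1) G hG
  rwa [Fil_eq_bot (Nat.lt_succ_self (Fintype.card O)), Submodule.mem_bot] at this

end Uniqueness

/-! ### Functoriality of the pullback and the chain rule -/

section Functoriality

variable {A : Type v} {B : Type w} {par : A → ZMod 2} {par' : B → ZMod 2}
  [Fintype A] [Fintype B] [DecidableEq B] {F : SMap par par'} {x : Ev par}

theorem pull_coord_sub_mem (hF : ∀ b, F b x ∈ parityPart (par' b)) (b : EvIx par') :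
    pull F (fun z => coord par' b z + algebraMap ℝ _ (-bodyMap F x b)) x ∈ Fil (OdIx par) 1 := by
  rw [pull_add (sm_coord _ _) (sm_const _ _), pull_coord hF, pull_algebraMap hF, mem_Fil_one,
    map_add, body_algebraMap, bodyMap, add_neg_cancel]

theorem pull_eventuallyEq (hF : IsGerm F x) {G H : SFun par'} (h : G =ᶠ[𝓝 (bodyMap F x)] H) :
    pull F G =ᶠ[𝓝 x] pull F H := by
  filter_upwards [hF.eventually_bodyMap h.eventuallyEq_nhds] with z hz using pull_congr hz

/-- Functoriality of the pullback. -/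
theorem pull_pull {C : Type*} [Fintype C] [DecidableEq C] {par'' : C → ZMod 2}
    {G : SMap par' par''} (hF : IsGerm F x) (hG : IsGerm G (bodyMap F x)) {H : SFun par''}
    (hH : Sm H (bodyMap G (bodyMap F x))) :
    pull F (pull G H) x = pull (par' := par'') (fun c => pull F (G c)) H x := by
  have hb : bodyMap (par' := par'') (fun c => pull F (G c)) x = bodyMap G (bodyMap F x) :=
    bodyMap_pull G hF.mem
  have hGF := hF.comp hG
  have hm := hGF.mem
  rw [← sub_eq_zero]
  -- Both sides are homomorphisms in `H`, and a difference Φ' - Φ of homomorphisms satisfies a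
  -- Leibniz rule with Φ' on the left and Φ on the right.
  refine eq_zero_of_leibniz (y := bodyMap G (bodyMap F x))
    (fun H => pull F (pull G H) x - pull (par' := par'') (fun c => pull F (G c)) H x)
    (fun H => pull (par' := par'') (fun c => pull F (G c)) H x)
    (fun H => pull F (pull G H) x) ?_ ?_ ?_ ?_ ?_ ?_ hH
  · intro H K h
    have h2 : pull (par' := par'') (fun c => pull F (G c)) H x =
        pull (par' := par'') (fun c => pull F (G c)) K x := pull_congr (by rwa [hb])
    rw [pull_congr (pull_eventuallyEq hG h), h2]
  · intro H K hH hK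
    have h1 : pull G (fun z => H z + K z) =ᶠ[𝓝 (bodyMap F x)] fun z => pull G H z + pull G K z := by
      filter_upwards [hG.eventually_bodyMap hH.eventually, hG.eventually_bodyMap hK.eventually]
        with z h h' using pull_add h h'
    rw [pull_congr h1, pull_add (hH.pull hG) (hK.pull hG), pull_add (by rwa [hb]) (by rwa [hb])]
    abel
  · intro H K hH hK
    have h1 : pull G (fun z => H z * K z) =ᶠ[𝓝 (bodyMap F x)] fun z => pull G H z * pull G K z := by
      filter_upwards [hG.eventually_bodyMap hH.eventually, hG.eventually_bodyMap hK.eventually,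
        hG.parity] with z h h' h'' using pull_mul h'' h h'
    rw [pull_congr h1, pull_mul hF.mem (hH.pull hG) (hK.pull hG),
      pull_mul hm (by rwa [hb]) (by rwa [hb]), sub_mul, mul_sub]
    abel
  · intro r
    have h1 : pull G (fun _ => algebraMap ℝ _ r) =ᶠ[𝓝 (bodyMap F x)] fun _ => algebraMap ℝ _ r := by
      filter_upwards [hG.parity] with z h using pull_algebraMap h r
    rw [pull_congr h1, pull_algebraMap hF.mem, pull_algebraMap hm, sub_self]
  · intro c
    have h1 : pull G (coord par'' c) =ᶠ[𝓝 (bodyMap F x)] G c := by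
      filter_upwards [hG.parity] with z h using pull_coord h c
    rw [pull_congr h1, pull_coord hm, sub_self]
  · intro c
    rw [mem_Fil_one, body_pull hF.mem]
    exact mem_Fil_one.mp (pull_coord_sub_mem hG.mem c)

/-- The chain rule. -/
theorem pd_pull [DecidableEq A] (hF : IsGerm F x) (a : A) {G : SFun par'}
    (hG : Sm G (bodyMap F x)) :
    pd a (pull F G) x = ∑ b, pd a (F b) x * pull F (pd b G) x := by
  have hFm := hF.mem
  have hpar : ∀ b, pd a (F b) x ∈ parityPart (par a + par' b) := fun b => by
    rw [add_comm]
    exact pd_mem a (hF.parity.mono fun z hz => hz b)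
  rw [← sub_eq_zero]
  -- In `G` both sides are graded derivations along `F`, so the left multiplier is the pullback
  -- twisted by the parity of `a`.
  refine eq_zero_of_leibniz (y := bodyMap F x)
    (fun G => pd a (pull F G) x - ∑ b, pd a (F b) x * pull F (pd b G) x)
    (fun G => pull F G x) (fun G => sg (par a) (pull F G x)) ?_ ?_ ?_ ?_ ?_ ?_ hG
  · intro G H h
    rw [pd_congr a (pull_eventuallyEq hF h)]
    congr 1
    exact Finset.sum_congr rfl fun b _ => by rw [pull_congr (pd_eventuallyEq b h)]
  · intro G H hG hH
    have h1 : pull F (fun z => G z + H z) =ᶠ[𝓝 x] fun z => pull F G z + pull F H z := by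
      filter_upwards [hF.eventually_bodyMap hG.eventually, hF.eventually_bodyMap hH.eventually]
        with z h h' using pull_add h h'
    have h2 : ∀ b, pull F (pd b fun z => G z + H z) x = pull F (pd b G) x + pull F (pd b H) x := by
      intro b
      rw [← pull_add (hG.pd b) (hH.pd b)]
      refine pull_congr ?_
      filter_upwards [hG.eventually, hH.eventually] with z h h' using pd_add b h h'
    rw [pd_congr a h1, pd_add a (hG.pull hF) (hH.pull hF)]
    simp only [h2, mul_add, Finset.sum_add_distrib]
    abel
  · intro G H hG hH
    have h1 : pull F (fun z => G z * H z) =ᶠ[𝓝 x] fun z => pull F G z * pull F H z := by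
      filter_upwards [hF.eventually_bodyMap hG.eventually, hF.eventually_bodyMap hH.eventually,
        hF.parity] with z h h' h'' using pull_mul h'' h h'
    have h2 : ∀ b, pd a (F b) x * pull F (pd b fun z => G z * H z) x =
        pd a (F b) x * pull F (pd b G) x * pull F H x +
          sg (par a) (pull F G x) * (pd a (F b) x * pull F (pd b H) x) := by
      intro b
      have hsg : Sm (fun z => sg (par' b) (G z)) (bodyMap F x) :=
        hG.linearMap (sg (par' b)).toLinearMap
      have h3 : pull F (pd b fun z => G z * H z) x =
          pull F (pd b G) x * pull F H x + sg (par' b) (pull F G x) * pull F (pd b H) x := by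
        rw [sg_pull hFm _ hG, ← pull_mul hFm (hG.pd b) hH, ← pull_mul hFm hsg (hH.pd b),
          ← pull_add ((hG.pd b).mul hH) (hsg.mul (hH.pd b))]
        refine pull_congr ?_
        filter_upwards [hG.eventually, hH.eventually] with z h h' using pd_mul b h h'
      -- Moving the Jacobian entry, of parity ã + b̃, past the twist by b̃ leaves the twist by ã,
      -- the same for every `b`.
      rw [h3, mul_add, ← mul_assoc, ← mul_assoc, mul_eq_sg_mul (hpar b) (sg (par' b) _), sg_sg,
        mul_assoc (sg _ _), show par a + par' b + par' b = par a by
          rw [add_assoc, CharTwo.add_self_eq_zero, add_zero]]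
    rw [pd_congr a h1, pd_mul a (hG.pull hF) (hH.pull hF)]
    simp only [h2, Finset.sum_add_distrib, ← Finset.sum_mul, ← Finset.mul_sum]
    rw [sub_mul, mul_sub]
    abel
  · intro r
    have h1 : pull F (fun _ => algebraMap ℝ _ r) =ᶠ[𝓝 x] fun _ => algebraMap ℝ _ r := by
      filter_upwards [hF.parity] with z h using pull_algebraMap h r
    have h2 : ∀ b, pull F (pd b fun _ => algebraMap ℝ _ r) x = 0 := fun b => by
      rw [funext (pd_const b r)]
      simpa using pull_algebraMap hFm 0
    rw [pd_congr a h1, pd_const, zero_sub, neg_eq_zero]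
    exact Finset.sum_eq_zero fun b _ => by rw [h2, mul_zero]
  · intro c
    have h1 : pull F (coord par' c) =ᶠ[𝓝 x] F c := by
      filter_upwards [hF.parity] with z h using pull_coord h c
    have h2 : ∀ b, pull F (pd b (coord par' c)) x = if b = c then 1 else 0 := fun b => by
      rw [funext (pd_coord b c)]
      split_ifs
      · simpa using pull_algebraMap hFm 1
      · simpa using pull_algebraMap hFm 0
    rw [pd_congr a h1]
    simp [h2]
  · intro b
    exact sg_mem_Fil (pull_coord_sub_mem hFm b) _

end Functoriality

end Super

end

noncomputable section

namespace Super

open Filter Topology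
open scoped ContDiff

/-! ### The body of the Jacobi matrix -/

section Jacobian

variable {A : Type v} {B : Type w} {par : A → ZMod 2} {par' : B → ZMod 2}
  [Fintype A] [DecidableEq A] {F : SMap par par'} {x : Ev par}

/-- The body of the Jacobi matrix. -/
def bJ (F : SMap par par') (x : Ev par) : Matrix A B ℝ := fun a b => body (pd a (F b) x)

theorem IsGerm.pd_mem (hF : IsGerm F x) (a : A) (b : B) :
    pd a (F b) x ∈ parityPart (par' b + par a) :=
  Super.pd_mem a (hF.parity.mono fun _ hz => hz b)

/-- Entries between coordinates of different parity are odd and have no body: `bJ` is block diagonal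
with respect to parity. -/
theorem bJ_eq_zero (hF : IsGerm F x) {a : A} {b : B} (h : par a ≠ par' b) : bJ F x a b = 0 := by
  refine body_of_odd ?_
  have := hF.pd_mem a b
  rwa [show par' b + par a = 1 by
    revert h; generalize par a = p; generalize par' b = q; revert p q; decide] at this

/-- With left derivatives indexing the rows, the chain rule gives the product with the inner map
first. -/
theorem bJ_pull {C : Type*} [Fintype B] [DecidableEq B] {par'' : C → ZMod 2}
    {G : SMap par' par''} (hF : IsGerm F x) (hG : IsGerm G (bodyMap F x)) :
    bJ (par' := par'') (fun c => pull F (G c)) x = bJ F x * bJ G (bodyMap F x) := by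
  ext a c
  rw [bJ, pd_pull hF a (hG.smooth c), map_sum, Matrix.mul_apply]
  refine Finset.sum_congr rfl fun b _ => ?_
  rw [map_mul, body_pull hF.mem]
  rfl

theorem fderiv_bodyMap [Fintype B] (hF : IsGerm F x) (a : EvIx par) (b : EvIx par') :
    fderiv ℝ (bodyMap F) x (Pi.single a 1) b = bJ F x a b := by
  have h : fderiv ℝ (bodyMap F) x =
      ContinuousLinearMap.pi fun b : EvIx par' => fderiv ℝ (fun z => body (F b z)) x :=
    fderiv_pi fun b => (sm_body (hF.smooth b.1)).differentiableAt
  rw [bJ, body_pd_even a.2 (hF.smooth b), h]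
  rfl

theorem sub_linear_mem (hF : IsGerm F x) {b : B} (hb : par' b = 1) :
    F b x - ∑ a : OdIx par, bJ F x a b • coord par a x ∈ Fil (OdIx par) 2 := by
  have h1 : F b x ∈ Fil (OdIx par) 1 := mem_Fil_one.mpr (body_of_odd (hb ▸ hF.mem b))
  convert sub_linear_mem_Fil h1 using 3 with a
  rw [coord_odd a.2, bJ, pd_odd a.2]

end Jacobian

/-! ### Inverting maps that are close to the identity -/

section NearIdentity

variable {A : Type v} {par : A → ZMod 2} [Fintype A] [DecidableEq A] {K : SMap par par} {x : Ev par}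

/-- `K` agrees with the identity up to terms with more odd coordinates. -/
structure NearId (K : SMap par par) (x : Ev par) : Prop where
  germ : IsGerm K x
  body : bodyMap K x = x
  odd : ∀ b, par b = 1 → K b x - coord par b x ∈ Fil (OdIx par) 2

/-- Telescoping over the generators of a product: replacing one generator by its image costs an
error in `Fil _ 2` instead of `Fil _ 1`. -/
theorem NearId.oddHom_sub_mem (hK : NearId K x) {m : ℕ} {u : Gr (OdIx par)}
    (hu : u ∈ Fil (OdIx par) m) : oddHom K x hK.germ.mem u - u ∈ Fil (OdIx par) (m + 1) := by
  have hι : ∀ v, oddVec K x v - ExteriorAlgebra.ι ℝ v ∈ Fil (OdIx par) 2 := by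
    intro v
    have h1 : oddVec K x v - ExteriorAlgebra.ι ℝ v =
        ∑ b : OdIx par, v b • (K b x - coord par b x) := by
      simp only [smul_sub, Finset.sum_sub_distrib]
      rw [oddVec, Fintype.linearCombination_apply]
      congr 1
      conv_lhs => rw [← Finset.univ_sum_single v, map_sum]
      refine Finset.sum_congr rfl fun b _ => ?_
      rw [coord_odd b.2, ← map_smul, ← Pi.single_smul, smul_eq_mul, mul_one]
    rw [h1]
    exact Submodule.sum_mem _ fun b _ => Submodule.smul_mem _ _ (hK.odd b b.2)
  induction m generalizing u with
  | zero =>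
    rw [zero_add, mem_Fil_one, map_sub, body_oddHom, sub_self]
  | succ m ih =>
    refine Fil_induction (C := fun u => oddHom K x hK.germ.mem u - u ∈ Fil (OdIx par) (m + 1 + 1))
      ?_ ?_ hu
    · intro u u' h h'
      rw [map_add, add_sub_add_comm]
      exact add_mem h h'
    · intro v u hu
      have h1 : oddHom K x hK.germ.mem (ExteriorAlgebra.ι ℝ v * u) - ExteriorAlgebra.ι ℝ v * u =
          (oddVec K x v - ExteriorAlgebra.ι ℝ v) * oddHom K x hK.germ.mem u +
            ExteriorAlgebra.ι ℝ v * (oddHom K x hK.germ.mem u - u) := by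
        rw [map_mul, oddHom_ι, sub_mul, mul_sub]
        abel
      rw [h1]
      refine add_mem ?_ (ι_mul_mem_Fil v (ih hu))
      have := mul_mem_Fil (hι v) (oddHom_mem_Fil hK.germ.mem hu)
      rwa [show 2 + m = m + 1 + 1 by omega] at this

/-- Taylor terms of positive order gain a soul factor, and the term of order zero is covered by the
preceding lemma. Hence the pullback minus the identity is nilpotent. -/
theorem NearId.pull_sub_mem (hK : NearId K x) {H : SFun par} {m : ℕ}
    (hH : ∀ᶠ z in 𝓝 x, H z ∈ Fil (OdIx par) m) : pull K H x - H x ∈ Fil (OdIx par) (m + 1) := by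
  rw [pull, Finset.sum_range_succ', add_sub_assoc]
  refine add_mem (Submodule.sum_mem _ fun k _ => Submodule.smul_mem _ _ ?_) ?_
  · have h := (taylorStep_iterate_mem (n := soul K x) (y := bodyMap K x)
      (G := fun z => oddSubst K x (H z)) (Fil (OdIx par)) (fun k b u hu => by
        rw [add_comm]; exact mul_mem_Fil (soul_mem_Fil K x b) hu) (m := m) (by
          rw [hK.body]
          filter_upwards [hH] with z hz
          rw [oddSubst_eq hK.germ.mem]
          exact oddHom_mem_Fil hK.germ.mem hz) (k + 1)).self_of_nhds
    exact Fil_antitone (by omega) h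
  · simp only [Nat.factorial_zero, Nat.cast_one, inv_one, Function.iterate_zero_apply, one_smul,
      hK.body, oddSubst_eq hK.germ.mem]
    exact hK.oddHom_sub_mem hH.self_of_nhds

/-- The defect of the pullback by `K` from the identity. -/
def defect (K : SMap par par) (H : SFun par) : SFun par := fun z => H z - pull K H z

variable {U : Set (Ev par)}

theorem defect_iterate_sm (hK : ∀ x ∈ U, NearId K x) (k : ℕ) {H : SFun par}
    (hH : ∀ x ∈ U, Sm H x) : ∀ x ∈ U, Sm ((defect K)^[k] H) x := by
  induction k generalizing H with
  | zero => exact hH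
  | succ k ih =>
    refine ih fun x hx => (hH x hx).sub (Sm.pull (hK x hx).germ ?_)
    rw [(hK x hx).body]
    exact hH x hx

theorem defect_iterate_parity (hU : IsOpen U) (hK : ∀ x ∈ U, NearId K x) (k : ℕ) {H : SFun par}
    {e : ZMod 2} (hH : ∀ x ∈ U, H x ∈ parityPart e) :
    ∀ x ∈ U, (defect K)^[k] H x ∈ parityPart e := by
  induction k generalizing H with
  | zero => exact hH
  | succ k ih =>
    refine ih fun x hx => sub_mem (hH x hx) (pull_mem (hK x hx).germ.mem ?_)
    rw [(hK x hx).body]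
    filter_upwards [hU.mem_nhds hx] with z hz using hH z hz

theorem defect_iterate_mem_Fil (hU : IsOpen U) (hK : ∀ x ∈ U, NearId K x) (k : ℕ) {H : SFun par}
    {m : ℕ} (hH : ∀ x ∈ U, H x ∈ Fil (OdIx par) m) :
    ∀ x ∈ U, (defect K)^[k] H x ∈ Fil (OdIx par) (m + k) := by
  induction k generalizing H m with
  | zero => exact hH
  | succ k ih =>
    rw [← add_assoc, add_right_comm]
    refine ih fun x hx => ?_
    rw [defect, ← neg_sub]
    refine neg_mem ((hK x hx).pull_sub_mem ?_)
    filter_upwards [hU.mem_nhds hx] with z hz using hH z hz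

/-- Geometric series: with D the nilpotent defect of the pullback, `K'` is the sum of the powers of
D applied to the coordinates. -/
theorem exists_nearId_left_inverse (hU : IsOpen U) (hK : ∀ x ∈ U, NearId K x) :
    ∃ K' : SMap par par, (∀ x ∈ U, NearId K' x) ∧
      ∀ x ∈ U, ∀ b, pull K (K' b) x = coord par b x := by
  set n := Fintype.card A with hn
  have hsm : ∀ k b, ∀ x ∈ U, Sm ((defect K)^[k] (coord par b)) x := fun k b =>
    defect_iterate_sm hK k fun x _ => sm_coord b x
  have hpar : ∀ k b, ∀ x ∈ U, (defect K)^[k] (coord par b) x ∈ parityPart (par b) := fun k b =>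
    defect_iterate_parity hU hK k fun x _ => coord_mem b x
  have hfil : ∀ k b, ∀ x ∈ U, (defect K)^[k] (coord par b) x ∈ Fil (OdIx par) k := fun k b x hx => by
    simpa using defect_iterate_mem_Fil hU hK k (H := coord par b) (m := 0) (by simp) x hx
  let K' : SMap par par := fun b z => ∑ k ∈ Finset.range (n + 1), (defect K)^[k] (coord par b) z
  have hsub : ∀ b z, K' b z - coord par b z =
      ∑ k ∈ Finset.range n, (defect K)^[k + 1] (coord par b) z := fun b z => by
    simp only [K']
    rw [Finset.sum_range_succ', Function.iterate_zero_apply, add_sub_cancel_right]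
  refine ⟨K', fun x hx => ⟨⟨fun b => sm_sum fun k _ => hsm k b x hx, ?_⟩, ?_, ?_⟩, ?_⟩
  · filter_upwards [hU.mem_nhds hx] with z hz b
    exact Submodule.sum_mem _ fun k _ => hpar k b z hz
  · funext b
    have h1 : body (K' b x - coord par b x) = 0 := by
      rw [hsub, map_sum]
      exact Finset.sum_eq_zero fun k _ =>
        mem_Fil_one.mp (Fil_antitone (Nat.le_add_left 1 k) (hfil (k + 1) b x hx))
    rw [map_sub, sub_eq_zero] at h1
    rw [bodyMap, h1, coord_even b.2, body_algebraMap]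
  · intro b hb
    rw [hsub]
    refine Submodule.sum_mem _ fun k _ => ?_
    -- An odd coordinate starts in `Fil _ 1`, so one application of the defect already reaches `Fil
    -- _ 2`.
    refine Fil_antitone (show 2 ≤ 1 + (k + 1) by omega)
      (defect_iterate_mem_Fil hU hK (k + 1) (H := coord par b) (m := 1) (fun z _ => ?_) x hx)
    exact mem_Fil_one.mpr (body_of_odd (hb ▸ coord_mem b z))
  · intro x hx b
    have hb := (hK x hx).body
    rw [pull_sum _ fun k => by rw [hb]; exact hsm k b x hx]
    have h1 : ∀ k, pull K ((defect K)^[k] (coord par b)) x =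
        (defect K)^[k] (coord par b) x - (defect K)^[k + 1] (coord par b) x := fun k => by
      rw [Function.iterate_succ_apply', defect, sub_sub_cancel]
    -- The sum telescopes; the leftover power of order `n + 1` lies in a vanishing filtration step.
    rw [Finset.sum_congr rfl fun k _ => h1 k, Finset.sum_range_sub']
    have h2 := hfil (n + 1) b x hx
    rw [Fil_card_eq_bot, Submodule.mem_bot] at h2
    rw [h2, sub_zero, Function.iterate_zero_apply]

/-- The left inverse `K'` is again near the identity and has a left inverse `K''`. As in any monoid,
`K'' = K''K'K = K`. -/
theorem exists_nearId_inverse (hU : IsOpen U) (hK : ∀ x ∈ U, NearId K x) :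
    ∃ K' : SMap par par, (∀ x ∈ U, NearId K' x) ∧
      (∀ x ∈ U, ∀ b, pull K (K' b) x = coord par b x) ∧
      ∀ x ∈ U, ∀ b, pull K' (K b) x = coord par b x := by
  obtain ⟨K', hK', h1⟩ := exists_nearId_left_inverse hU hK
  obtain ⟨K'', hK'', h2⟩ := exists_nearId_left_inverse hU hK'
  have h3 : ∀ x ∈ U, ∀ b, K'' b x = K b x := by
    intro x hx b
    have hb := (hK x hx).body
    have e1 : pull K (pull K' (K'' b)) x = K b x := by
      rw [← pull_coord (hK x hx).germ.mem b]
      refine pull_congr ?_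
      rw [hb]
      filter_upwards [hU.mem_nhds hx] with z hz using h2 z hz b
    rw [← e1, pull_pull (hK x hx).germ (by rw [hb]; exact (hK' x hx).germ)
      (by rw [hb, (hK' x hx).body]; exact (hK'' x hx).germ.smooth b),
      pull_congr_left (h1 x hx), pull_id]
  refine ⟨K', hK', h1, fun x hx b => ?_⟩
  rw [← h2 x hx b]
  refine pull_congr ?_
  rw [(hK' x hx).body]
  filter_upwards [hU.mem_nhds hx] with z hz using (h3 z hz b).symm

end NearIdentity

end Super

end

noncomputable section

namespace Super

open Filter Topology
open scoped ContDiff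

/-! ### The inverse function theorem -/

section InverseFunction

variable {A : Type v} {par : A → ZMod 2} [Fintype A] [DecidableEq A] {F : SMap par par}

omit [DecidableEq A] in
theorem sum_subtype_of_eq_zero {M : Type*} [AddCommMonoid M] (p : A → Prop) [DecidablePred p]
    (f : A → M) (h : ∀ a, ¬p a → f a = 0) : ∑ a : {a // p a}, f a = ∑ a, f a := by
  rw [← Fintype.sum_subtype_add_sum_subtype p f, Finset.sum_eq_zero (s := Finset.univ)
    (f := fun a : {a // ¬p a} => f a) fun a _ => h a a.2, add_zero]

theorem sm_matrix_det {E : Type*} [NormedAddCommGroup E] [NormedSpace ℝ E] {x : E}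
    {N : E → Matrix A A ℝ} (hN : ∀ a b, Sm (fun z => N z a b) x) : Sm (fun z => (N z).det) x := by
  have h : ∀ᶠ z in 𝓝 x, ∀ a b, ContDiffAt ℝ ∞ (fun z => N z a b) z :=
    eventually_all.mpr fun a => eventually_all.mpr fun b => hN a b
  filter_upwards [h] with z hz
  simp only [Matrix.det_apply]
  exact ContDiffAt.sum fun σ _ => (contDiffAt_prod fun a _ => hz _ _).const_smul _

theorem sm_matrix_inv {E : Type*} [NormedAddCommGroup E] [NormedSpace ℝ E] {x : E}
    {N : E → Matrix A A ℝ} (hN : ∀ a b, Sm (fun z => N z a b) x) (hx : IsUnit (N x)) (a b : A) :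
    Sm (fun z => (N z)⁻¹ a b) x := by
  have h1 : Sm (fun z => ((N z).det)⁻¹) x := by
    have hd := sm_matrix_det hN
    have h0 : (N x).det ≠ 0 := ((Matrix.isUnit_iff_isUnit_det _).mp hx).ne_zero
    filter_upwards [hd, hd.continuousAt.eventually_ne h0] with z hz hz0 using hz.inv hz0
  have h2 : Sm (fun z => (N z).adjugate a b) x := by
    simp only [Matrix.adjugate_apply]
    refine sm_matrix_det fun c d => ?_
    simp only [Matrix.updateRow_apply]
    split_ifs
    · exact sm_const _ _
    · exact hN c d
  refine (h1.smul h2).congr (Eventually.of_forall fun z => ?_)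
  simp [Matrix.inv_def]

theorem sm_bJ {x : Ev par} (hF : IsGerm F x) (a b : A) : Sm (fun z => bJ F z a b) x :=
  sm_body ((hF.smooth b).pd a)

/-- A vector in the kernel, extended by zero to the odd indices, is a row vector annihilated by the
whole matrix, because the mixed-parity blocks vanish. -/
theorem fderiv_bodyMap_injective {x : Ev par} (hF : IsGerm F x) (hJ : IsUnit (bJ F x)) :
    Function.Injective (fderiv ℝ (bodyMap F) x) := by
  refine (injective_iff_map_eq_zero _).mpr fun v hv => ?_
  have h1 : ∀ b : EvIx par, ∑ a : EvIx par, v a * bJ F x a b = 0 := by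
    intro b
    have h2 : fderiv ℝ (bodyMap F) x v = ∑ a, v a • fderiv ℝ (bodyMap F) x (Pi.single a 1) := by
      refine (congrArg _ (Finset.univ_sum_single v).symm).trans ?_
      rw [map_sum]
      refine Finset.sum_congr rfl fun a _ => ?_
      rw [← map_smul, ← Pi.single_smul, smul_eq_mul, mul_one]
    have h3 := congrFun (h2.symm.trans hv) b
    simpa [Finset.sum_apply, fderiv_bodyMap hF] using h3
  let w : A → ℝ := fun a => if h : par a = 0 then v ⟨a, h⟩ else 0
  have hw : Matrix.vecMul w (bJ F x) = 0 := by
    funext b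
    rw [Matrix.vecMul, dotProduct, Pi.zero_apply]
    by_cases hb : par b = 0
    · rw [← h1 ⟨b, hb⟩, ← sum_subtype_of_eq_zero (fun a => par a = 0) _ fun a ha => by simp [w, ha]]
      exact Finset.sum_congr rfl fun a _ => by simp [w, a.2]
    · refine Finset.sum_eq_zero fun a _ => ?_
      by_cases ha : par a = 0
      · rw [bJ_eq_zero hF (by rw [ha]; exact Ne.symm hb), mul_zero]
      · simp [w, ha]
  have hw0 : w = 0 := by
    have hinj := Matrix.vecMul_injective_of_isUnit hJ
    exact hinj (by simpa using hw)
  funext a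
  have := congrFun hw0 a.1
  simpa [w, a.2] using this

/-- The derivative of the underlying map, as an equivalence. -/
theorem exists_equiv_fderiv {x : Ev par} (hF : IsGerm F x) (hJ : IsUnit (bJ F x)) :
    ∃ L : Ev par ≃L[ℝ] Ev par, HasFDerivAt (bodyMap F) (L : Ev par →L[ℝ] Ev par) x := by
  let L := (LinearEquiv.ofInjectiveEndo (fderiv ℝ (bodyMap F) x : Ev par →ₗ[ℝ] Ev par)
    (fderiv_bodyMap_injective hF hJ)).toContinuousLinearEquiv
  refine ⟨L, (sm_bodyMap hF).differentiableAt.hasFDerivAt.congr_fderiv ?_⟩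
  ext v : 1
  rfl

theorem exists_injOn_nhds {x : Ev par} (hF : IsGerm F x) (hJ : IsUnit (bJ F x)) :
    ∃ V ∈ 𝓝 x, Set.InjOn (bodyMap F) V := by
  obtain ⟨L, hL⟩ := exists_equiv_fderiv hF hJ
  have hs : HasStrictFDerivAt (bodyMap F) (L : Ev par →L[ℝ] Ev par) x :=
    (sm_bodyMap hF).contDiffAt.hasStrictFDerivAt' hL (by simp)
  exact ⟨_, (hs.toOpenPartialHomeomorph _).open_source.mem_nhds
    hs.mem_toOpenPartialHomeomorph_source, (hs.toOpenPartialHomeomorph _).injOn⟩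

theorem eventually_isUnit_bJ {x : Ev par} (hF : IsGerm F x) (hJ : IsUnit (bJ F x)) :
    ∀ᶠ z in 𝓝 x, IsUnit (bJ F z) := by
  simp only [Matrix.isUnit_iff_isUnit_det, isUnit_iff_ne_zero] at hJ ⊢
  exact (sm_matrix_det fun a b => sm_bJ hF a b).continuousAt.eventually_ne hJ

variable {U : Set (Ev par)}

/-- By injectivity on `U`, the set-theoretic inverse coincides near `bodyMap F x` with the local
inverse of the classical theorem. -/
theorem invFunOn_bodyMap_eventually (hU : IsOpen U) (hinj : Set.InjOn (bodyMap F) U) {x : Ev par}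
    (hx : x ∈ U) (hF : IsGerm F x) (hJ : IsUnit (bJ F x)) :
    (∀ᶠ y in 𝓝 (bodyMap F x), y ∈ bodyMap F '' U) ∧
      ContDiffAt ℝ ∞ (Function.invFunOn (bodyMap F) U) (bodyMap F x) := by
  obtain ⟨L, hL⟩ := exists_equiv_fderiv hF hJ
  have hc := (sm_bodyMap hF).contDiffAt
  have hs : HasStrictFDerivAt (bodyMap F) (L : Ev par →L[ℝ] Ev par) x :=
    hc.hasStrictFDerivAt' hL (by simp)
  have h1 : ∀ᶠ y in 𝓝 (bodyMap F x), hs.localInverse _ _ _ y ∈ U ∧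
      bodyMap F (hs.localInverse _ _ _ y) = y :=
    (hs.localInverse_continuousAt.eventually (by
      rw [hs.localInverse_apply_image]; exact hU.mem_nhds hx)).and hs.eventually_right_inverse
  refine ⟨h1.mono fun y hy => ⟨_, hy.1, hy.2⟩, ?_⟩
  refine (hc.to_localInverse hL (by simp)).congr_of_eventuallyEq ?_
  filter_upwards [h1] with y hy
  refine hinj (Function.invFunOn_mem ⟨_, hy.1, hy.2⟩) hy.1 ?_
  rw [Function.invFunOn_eq ⟨_, hy.1, hy.2⟩]
  exact hy.2.symm

theorem isOpen_image_bodyMap (hU : IsOpen U) (hF : ∀ x ∈ U, IsGerm F x)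
    (hinj : Set.InjOn (bodyMap F) U) (hJ : ∀ x ∈ U, IsUnit (bJ F x)) :
    IsOpen (bodyMap F '' U) := by
  rw [isOpen_iff_mem_nhds]
  rintro _ ⟨x, hx, rfl⟩
  exact (invFunOn_bodyMap_eventually hU hinj hx (hF x hx) (hJ x hx)).1

theorem nearId_of_bJ {K : SMap par par} {x : Ev par} (hK : IsGerm K x) (hb : bodyMap K x = x)
    (hJ : ∀ a b, par a = 1 → par b = 1 → bJ K x a b = if a = b then 1 else 0) : NearId K x := by
  refine ⟨hK, hb, fun b h => ?_⟩
  have h1 := sub_linear_mem hK h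
  have h2 : ∑ a : OdIx par, bJ K x a b • coord par a x = coord par b x := by
    rw [Finset.sum_eq_single ⟨b, h⟩]
    · simp [hJ b b h h]
    · intro a _ ha
      rw [hJ a b a.2 h, if_neg fun h' => ha (Subtype.ext h'), zero_smul]
    · simp
  rwa [h2] at h1

/-- The body of `F` inverted by `h`, and the linear part of `F` on odd coordinates inverted. -/
def bodyInverse (F : SMap par par) (h : Ev par → Ev par) : SMap par par := fun b y =>
  if hb : par b = 0 then algebraMap ℝ _ (h y ⟨b, hb⟩)
  else ∑ c : OdIx par, (bJ F (h y))⁻¹ c b • coord par c y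

theorem isGerm_bodyInverse {h : Ev par → Ev par} {y : Ev par} (hh : Sm h y)
    (hF : IsGerm F (h y)) (hJ : IsUnit (bJ F (h y))) : IsGerm (par' := par) (bodyInverse F h) y where
  smooth b := by
    unfold bodyInverse
    split_ifs with hb
    · exact Sm.linearMap (Algebra.linearMap ℝ (Gr (OdIx par)))
        (Sm.linearMap (LinearMap.proj (R := ℝ) (φ := fun _ : EvIx par => ℝ) ⟨b, hb⟩) hh)
    · refine sm_sum fun c _ => Sm.smul ?_ (sm_coord _ _)
      exact Sm.comp (g := fun z => (bJ F z)⁻¹ c b) (sm_matrix_inv (fun a b => sm_bJ hF a b) hJ _ _) hh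
  parity := Eventually.of_forall fun z b => by
    unfold bodyInverse
    split_ifs with hb
    · rw [hb]; exact algebraMap_mem_parityPart _
    · rw [par_eq_one hb]
      exact Submodule.sum_mem _ fun c _ => Submodule.smul_mem _ _ (by
        simpa only [c.2] using coord_mem c.1 z)

theorem bodyMap_bodyInverse (h : Ev par → Ev par) (y : Ev par) :
    bodyMap (par' := par) (bodyInverse F h) y = h y := by
  funext b
  rw [bodyMap, bodyInverse, dif_pos b.2, body_algebraMap]

theorem bJ_bodyInverse (h : Ev par → Ev par) (y : Ev par) {a b : A} (ha : par a = 1)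
    (hb : par b = 1) : bJ (par' := par) (bodyInverse F h) y a b = (bJ F (h y))⁻¹ a b := by
  rw [bJ, pd_odd ha, bodyInverse, dif_neg (by rw [hb]; decide), map_sum,
    Finset.sum_eq_single ⟨a, ha⟩]
  · rw [map_smul, coord_odd ha, ctr_ι]
    simp
  · intro c _ hc
    rw [map_smul, coord_odd c.2, ctr_ι, Pi.single_eq_of_ne hc.symm]
    simp
  · simp

/-- The inverse function theorem for superdomains. -/
theorem exists_inverse (hU : IsOpen U) (hF : ∀ x ∈ U, IsGerm F x)
    (hinj : Set.InjOn (bodyMap F) U) (hJ : ∀ x ∈ U, IsUnit (bJ F x)) :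
    ∃ G : SMap par par, (∀ y ∈ bodyMap F '' U, IsGerm G y) ∧
      Set.MapsTo (bodyMap G) (bodyMap F '' U) U ∧
      (∀ x ∈ U, ∀ b, pull F (G b) x = coord par b x) ∧
      ∀ y ∈ bodyMap F '' U, ∀ b, pull G (F b) y = coord par b y := by
  set V := bodyMap F '' U with hVdef
  have hV : IsOpen V := isOpen_image_bodyMap hU hF hinj hJ
  set h := Function.invFunOn (bodyMap F) U with hh
  have hmaps : Set.MapsTo h V U := fun y hy => Function.invFunOn_mem hy
  have hright : ∀ y ∈ V, bodyMap F (h y) = y := fun y hy => Function.invFunOn_eq hy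
  have hleft : ∀ x ∈ U, h (bodyMap F x) = x := fun x hx =>
    hinj (hmaps ⟨x, hx, rfl⟩) hx (hright _ ⟨x, hx, rfl⟩)
  have hFV : ∀ x ∈ U, bodyMap F x ∈ V := fun x hx => ⟨x, hx, rfl⟩
  have hsm : ∀ y ∈ V, Sm h y := fun y hy => by
    filter_upwards [hV.mem_nhds hy] with z hz
    obtain ⟨x, hx, rfl⟩ := hz
    exact (invFunOn_bodyMap_eventually hU hinj hx (hF x hx) (hJ x hx)).2
  set G₀ : SMap par par := bodyInverse F h with hG₀def
  have hG₀ : ∀ y ∈ V, IsGerm G₀ y := fun y hy =>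
    isGerm_bodyInverse (hsm y hy) (hF _ (hmaps hy)) (hJ _ (hmaps hy))
  have hbG₀ : ∀ y, bodyMap G₀ y = h y := bodyMap_bodyInverse h
  -- Summands with an even middle index vanish, and for odd ones the Jacobian of `G₀` is the inverse
  -- matrix by construction.
  have hoddL : ∀ x ∈ U, ∀ a b, par a = 1 → par b = 1 →
      (bJ F x * bJ G₀ (bodyMap F x)) a b = if a = b then 1 else 0 := by
    intro x hx a b ha hb
    have h1 := Matrix.mul_nonsing_inv (bJ F x) ((Matrix.isUnit_iff_isUnit_det _).mp (hJ x hx))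
    rw [← Matrix.one_apply, ← h1, Matrix.mul_apply, Matrix.mul_apply]
    refine Finset.sum_congr rfl fun c _ => ?_
    rcases zmod_two_cases (par c) with hc | hc
    · rw [bJ_eq_zero (hF x hx) (by rw [ha, hc]; decide), zero_mul, zero_mul]
    · rw [hG₀def, bJ_bodyInverse _ _ hc hb, hleft x hx]
  have hoddR : ∀ y ∈ V, ∀ a b, par a = 1 → par b = 1 →
      (bJ G₀ y * bJ F (h y)) a b = if a = b then 1 else 0 := by
    intro y hy a b ha hb
    have h1 := Matrix.nonsing_inv_mul (bJ F (h y))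
      ((Matrix.isUnit_iff_isUnit_det _).mp (hJ _ (hmaps hy)))
    rw [← Matrix.one_apply, ← h1, Matrix.mul_apply, Matrix.mul_apply]
    refine Finset.sum_congr rfl fun c _ => ?_
    rcases zmod_two_cases (par c) with hc | hc
    · rw [bJ_eq_zero (hF _ (hmaps hy)) (by rw [hc, hb]; decide), mul_zero, mul_zero]
    · rw [hG₀def, bJ_bodyInverse _ _ ha hc]
  -- The approximate inverse `G₀` makes both composites, `G₀ ∘ F` and `F ∘ G₀`, near the identity.
  have hK₁ : ∀ x ∈ U, NearId (fun b => pull F (G₀ b)) x := fun x hx =>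
    nearId_of_bJ ((hF x hx).comp (hG₀ _ (hFV x hx)))
      (by rw [bodyMap_pull G₀ (hF x hx).mem, hbG₀, hleft x hx])
      (by rw [bJ_pull (hF x hx) (hG₀ _ (hFV x hx))]; exact hoddL x hx)
  have hFG₀ : ∀ y ∈ V, IsGerm F (bodyMap G₀ y) := fun y hy => by
    rw [hbG₀]; exact hF _ (hmaps hy)
  have hK₂ : ∀ y ∈ V, NearId (fun b => pull G₀ (F b)) y := fun y hy =>
    nearId_of_bJ ((hG₀ y hy).comp (hFG₀ y hy))
      (by rw [bodyMap_pull F (hG₀ y hy).mem, hbG₀, hright y hy])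
      (by rw [bJ_pull (hG₀ y hy) (hFG₀ y hy), hbG₀]; exact hoddR y hy)
  obtain ⟨K₁, hK₁g, hK₁l, -⟩ := exists_nearId_inverse hU hK₁
  obtain ⟨K₂, hK₂g, -, hK₂r⟩ := exists_nearId_inverse hV hK₂
  -- `G = K₁ ∘ G₀` is a left inverse of `F` and `G₂ = G₀ ∘ K₂` a right inverse.
  let G : SMap par par := fun b => pull G₀ (K₁ b)
  let G₂ : SMap par par := fun b => pull K₂ (G₀ b)
  have hK₁G₀ : ∀ y ∈ V, IsGerm K₁ (bodyMap G₀ y) := fun y hy => by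
    rw [hbG₀]; exact (hK₁g _ (hmaps hy)).germ
  have hG : ∀ y ∈ V, IsGerm G y := fun y hy => (hG₀ y hy).comp (hK₁G₀ y hy)
  have hbG : ∀ y ∈ V, bodyMap G y = h y := fun y hy => by
    rw [bodyMap_pull K₁ (hG₀ y hy).mem, hbG₀, (hK₁g _ (hmaps hy)).body]
  have hG₀K₂ : ∀ y ∈ V, IsGerm G₀ (bodyMap K₂ y) := fun y hy => by
    rw [(hK₂g y hy).body]; exact hG₀ y hy
  have hG₂ : ∀ y ∈ V, IsGerm G₂ y := fun y hy => (hK₂g y hy).germ.comp (hG₀K₂ y hy)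
  have hbG₂ : ∀ y ∈ V, bodyMap G₂ y = h y := fun y hy => by
    rw [bodyMap_pull G₀ (hK₂g y hy).germ.mem, (hK₂g y hy).body, hbG₀]
  have hl : ∀ x ∈ U, ∀ b, pull F (G b) x = coord par b x := fun x hx b => by
    rw [pull_pull (hF x hx) (hG₀ _ (hFV x hx)) ((hK₁G₀ _ (hFV x hx)).smooth b)]
    exact hK₁l x hx b
  have hr : ∀ y ∈ V, ∀ b, pull G₂ (F b) y = coord par b y := fun y hy b => by
    rw [← hK₂r y hy b, pull_pull (hK₂g y hy).germ (hG₀K₂ y hy)]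
    rw [(hK₂g y hy).body]
    exact (hFG₀ y hy).smooth b
  -- Left and right inverses agree: both equal `G ∘ F ∘ G₂`.
  have heq : ∀ y ∈ V, ∀ b, G₂ b y = G b y := fun y hy b => by
    have h1 : pull G₂ (pull F (G b)) y = G₂ b y := by
      rw [← pull_coord (hG₂ y hy).mem b]
      refine pull_congr ?_
      rw [hbG₂ y hy]
      filter_upwards [hU.mem_nhds (hmaps hy)] with z hz using hl z hz b
    rw [← h1, pull_pull (hG₂ y hy) (by rw [hbG₂ y hy]; exact hF _ (hmaps hy))
      (by rw [hbG₂ y hy, hright y hy]; exact (hG y hy).smooth b),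
      pull_congr_left (hr y hy), pull_id]
  refine ⟨G, hG, fun y hy => by rw [hbG y hy]; exact hmaps hy, hl, fun y hy b => ?_⟩
  rw [← hr y hy b, pull_congr_left (heq y hy)]

end InverseFunction

end Super

end

noncomputable section

namespace Super

open Filter Topology
open scoped ContDiff

/-! ### Coordinate changes of the base and their inverse Jacobians -/

section Base

variable {A : Type v} {par : A → ZMod 2} [Fintype A] [DecidableEq A] {M : SuperAtlas.{u} par}
  {i j k : M.ι} {x : Ev par}

namespace SuperAtlas.IsSupermanifold

theorem germ (hM : M.IsSupermanifold) (hx : x ∈ M.overlap i j) : IsGerm (M.trans i j) x :=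
  (hM.smooth i j).isGerm (hM.isOpen_overlap i j) hx

theorem eventually_overlap (hM : M.IsSupermanifold) (hx : x ∈ M.overlap i j) :
    ∀ᶠ z in 𝓝 x, z ∈ M.overlap i j := (hM.isOpen_overlap i j).mem_nhds hx

theorem cocycle_mem (hM : M.IsSupermanifold) (hx : x ∈ M.overlap i j)
    (hy : bodyMap (M.trans i j) x ∈ M.overlap j k) : x ∈ M.overlap i k :=
  (hM.cocycle i j k x hx hy).1

theorem cocycle_body (hM : M.IsSupermanifold) (hx : x ∈ M.overlap i j)
    (hy : bodyMap (M.trans i j) x ∈ M.overlap j k) :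
    bodyMap (M.trans j k) (bodyMap (M.trans i j) x) = bodyMap (M.trans i k) x := by
  rw [← bodyMap_pull (M.trans j k) (hM.germ hx).mem]
  exact bodyMap_congr (hM.cocycle i j k x hx hy).2

theorem eventually_cocycle (hM : M.IsSupermanifold) (hx : x ∈ M.overlap i j)
    (hy : bodyMap (M.trans i j) x ∈ M.overlap j k) (a : A) :
    pull (M.trans i j) (M.trans j k a) =ᶠ[𝓝 x] M.trans i k a := by
  filter_upwards [hM.eventually_overlap hx,
    (hM.germ hx).eventually_bodyMap (hM.eventually_overlap hy)] with z hz hz'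
  exact (hM.cocycle i j k z hz hz').2 a

theorem eventually_trans_self (hM : M.IsSupermanifold) (hx : x ∈ M.dom i) (a : A) :
    M.trans i i a =ᶠ[𝓝 x] coord par a := by
  filter_upwards [(hM.isOpen_dom i).mem_nhds hx] with z hz using hM.trans_self i a z hz

theorem bodyMap_self (hM : M.IsSupermanifold) (hx : x ∈ M.dom i) :
    bodyMap (M.trans i i) x = x := by
  rw [bodyMap_congr fun b => hM.trans_self i b x hx, bodyMap_coord]

theorem bodyMap_inv (hM : M.IsSupermanifold) (hx : x ∈ M.overlap i j) :
    bodyMap (M.trans j i) (bodyMap (M.trans i j) x) = x := by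
  rw [hM.cocycle_body hx (hM.mapsTo i j hx), hM.bodyMap_self (hM.overlap_subset i j hx)]

/-- Functoriality of the pullback of arbitrary functions along coordinate changes. -/
theorem pull_pull_trans (hM : M.IsSupermanifold) (hx : x ∈ M.overlap i j)
    (hy : bodyMap (M.trans i j) x ∈ M.overlap j k) {G : SFun par}
    (hG : Sm G (bodyMap (M.trans i k) x)) :
    pull (M.trans i j) (pull (M.trans j k) G) x = pull (M.trans i k) G x := by
  rw [← hM.cocycle_body hx hy] at hG
  rw [pull_pull (hM.germ hx) (hM.germ hy) hG]
  exact pull_congr_left (hM.cocycle i j k x hx hy).2 G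

end SuperAtlas.IsSupermanifold

/-- The matrix `∂x^a/∂x^{a'}` of the inverse coordinate change, in the coordinates `x`. -/
def invJac (M : SuperAtlas.{u} par) (i j : M.ι) (a' a : A) : SFun par :=
  pull (M.trans i j) (pd a' (M.trans j i a))

theorem sm_invJac (hM : M.IsSupermanifold) (hx : x ∈ M.overlap i j) (a' a : A) :
    Sm (invJac M i j a' a) x :=
  Sm.pull (hM.germ hx) (((hM.germ (hM.mapsTo i j hx)).smooth a).pd a')

theorem invJac_mem (hM : M.IsSupermanifold) (hx : x ∈ M.overlap i j) (a' a : A) :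
    invJac M i j a' a x ∈ parityPart (par a + par a') := by
  refine pull_mem (hM.germ hx).mem ?_
  filter_upwards [(hM.germ (hM.mapsTo i j hx)).eventually] with z hz using hz.pd_mem a' a

/-- The chain rule for the identity `j → i → j`, carried out in chart `j` and then pulled back to
chart `i`. -/
theorem sum_invJac_mul (hM : M.IsSupermanifold) (hx : x ∈ M.overlap i j) (a' a'' : A) :
    ∑ a, invJac M i j a' a x * pd a (M.trans i j a'') x = if a' = a'' then 1 else 0 := by
  have hy := hM.mapsTo i j hx
  have hg := hM.germ hx
  have hg' := hM.germ hy
  have hinv := hM.bodyMap_inv hx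
  have hgg : IsGerm (M.trans i j) (bodyMap (M.trans j i) (bodyMap (M.trans i j) x)) := by
    rwa [hinv]
  have h1 : (fun y => ∑ a, pd a' (M.trans j i a) y * pull (M.trans j i) (pd a (M.trans i j a'')) y)
      =ᶠ[𝓝 (bodyMap (M.trans i j) x)] fun _ => algebraMap ℝ _ (if a' = a'' then 1 else 0) := by
    have hz' : ∀ᶠ y in 𝓝 (bodyMap (M.trans i j) x),
        pull (M.trans j i) (M.trans i j a'') =ᶠ[𝓝 y] M.trans j j a'' :=
      (hM.eventually_cocycle hy (by rwa [hinv]) a'').eventuallyEq_nhds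
    filter_upwards [hg'.eventually, hg'.eventually_bodyMap (hgg.smooth a'').eventually, hz',
      hM.eventually_overlap hy] with y h2 h3 h4 h5
    rw [← pd_pull h2 a' h3, pd_congr a' h4,
      pd_congr a' (hM.eventually_trans_self (hM.overlap_subset _ _ h5) a''), pd_coord]
    split_ifs <;> simp
  have h2 := pull_congr (F := M.trans i j) h1
  rw [pull_algebraMap hg.mem, pull_sum] at h2
  · rw [show (if a' = a'' then (1 : Gr (OdIx par)) else 0) =
      algebraMap ℝ _ (if a' = a'' then 1 else 0) by split_ifs <;> simp, ← h2]
    refine Finset.sum_congr rfl fun a _ => ?_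
    rw [pull_mul hg.mem ((hg'.smooth a).pd a') (((hgg.smooth a'').pd a).pull hg')]
    congr 1
    have hxi := hM.overlap_subset _ _ hx
    have hb := hM.bodyMap_self hxi
    rw [hM.pull_pull_trans hx hy (by rw [hb]; exact (hg.smooth a'').pd a),
      pull_congr_left (fun b => hM.trans_self i b x hxi), pull_id]
  · exact fun a => ((hg'.smooth a).pd a').mul (((hgg.smooth a'').pd a).pull hg')

/-- The chain rule for `k → j → i`, pulled back from chart `k` to chart `i`. This is the cocycle
identity of the cotangent fibres. -/
theorem sum_pull_invJac_mul (hM : M.IsSupermanifold) (hx : x ∈ M.overlap i j)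
    (hy : bodyMap (M.trans i j) x ∈ M.overlap j k) (a'' a : A) :
    ∑ a', pull (M.trans i j) (invJac M j k a'' a') x * invJac M i j a' a x =
      invJac M i k a'' a x := by
  have hik := hM.cocycle_mem hx hy
  have hbik := hM.cocycle_body hx hy
  have hkj : bodyMap (M.trans i k) x ∈ M.overlap k j := hbik ▸ hM.mapsTo j k hy
  have hki : bodyMap (M.trans i k) x ∈ M.overlap k i := hM.mapsTo i k hik
  have hbkj : bodyMap (M.trans k j) (bodyMap (M.trans i k) x) = bodyMap (M.trans i j) x :=
    hM.cocycle_body hik hkj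
  have hji : bodyMap (M.trans k j) (bodyMap (M.trans i k) x) ∈ M.overlap j i :=
    hbkj ▸ hM.mapsTo i j hx
  have hgkj := hM.germ hkj
  have hgji := hM.germ hji
  have h1 : pd a'' (M.trans k i a) =ᶠ[𝓝 (bodyMap (M.trans i k) x)] fun y =>
      ∑ a', pd a'' (M.trans k j a') y * pull (M.trans k j) (pd a' (M.trans j i a)) y := by
    filter_upwards [(hM.eventually_cocycle hkj hji a).eventuallyEq_nhds, hgkj.eventually,
      hgkj.eventually_bodyMap (hgji.smooth a).eventually] with y h2 h3 h4
    rw [← pd_congr a'' h2, pd_pull h3 a'' h4]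
  have hg := hM.germ hik
  rw [invJac, pull_congr h1, pull_sum _ fun a' =>
    ((hgkj.smooth a').pd a'').mul (((hgji.smooth a).pd a').pull hgkj)]
  refine Finset.sum_congr rfl fun a' _ => ?_
  rw [pull_mul hg.mem ((hgkj.smooth a').pd a'') (((hgji.smooth a).pd a').pull hgkj)]
  congr 1
  · exact hM.pull_pull_trans hx hy ((hgkj.smooth a').pd a'')
  · exact (hM.pull_pull_trans hik hkj (by rw [← hbkj]; exact (hgji.smooth a).pd a')).symm

end Base

/-! ### Pullback of base functions to the bundles -/

section Projection

variable {A : Type v} {par : A → ZMod 2} [Fintype A] [DecidableEq A] {z : Ev (dbl par)}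

theorem isGerm_proj (z : Ev (dbl par)) : IsGerm (par' := par) (proj par) z :=
  ⟨fun _ => sm_coord _ z, Eventually.of_forall fun z b => coord_mem (par := dbl par) (Sum.inl b) z⟩

omit [Fintype A] in
theorem bodyMap_proj (z : Ev (dbl par)) : bodyMap (par' := par) (proj par) z = basePt par z := by
  funext b
  have h : dbl par (Sum.inl b.1) = 0 := b.2
  rw [bodyMap, proj, coord_even h, body_algebraMap]
  rfl

omit [Fintype A] [DecidableEq A] in
theorem continuous_basePt : Continuous (basePt par) := by
  unfold basePt
  fun_prop

omit [Fintype A] [DecidableEq A] in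
theorem eventually_basePt {p : Ev par → Prop} (h : ∀ᶠ x in 𝓝 (basePt par z), p x) :
    ∀ᶠ z' in 𝓝 z, p (basePt par z') := continuous_basePt.continuousAt.eventually h

theorem pull_proj_congr {G H : SFun par} (h : G =ᶠ[𝓝 (basePt par z)] H) :
    pull (proj par) G z = pull (proj par) H z := pull_congr (by rwa [bodyMap_proj])

theorem sm_pull_proj {G : SFun par} (h : Sm G (basePt par z)) : Sm (pull (proj par) G) z :=
  Sm.pull (isGerm_proj z) (by rwa [bodyMap_proj])

theorem pull_proj_mul {G H : SFun par} (hG : Sm G (basePt par z)) (hH : Sm H (basePt par z)) :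
    pull (proj par) (fun x => G x * H x) z = pull (proj par) G z * pull (proj par) H z :=
  pull_mul (isGerm_proj z).mem (by rwa [bodyMap_proj]) (by rwa [bodyMap_proj])

theorem pull_proj_sum {κ : Type*} (s : Finset κ) {G : κ → SFun par}
    (hG : ∀ k, Sm (G k) (basePt par z)) :
    pull (proj par) (fun x => ∑ k ∈ s, G k x) z = ∑ k ∈ s, pull (proj par) (G k) z :=
  pull_sum s (by rwa [bodyMap_proj])

theorem pull_proj_mem {G : SFun par} {e : ZMod 2}
    (h : ∀ᶠ x in 𝓝 (basePt par z), G x ∈ parityPart e) : pull (proj par) G z ∈ parityPart e :=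
  pull_mem (isGerm_proj z).mem (by rwa [bodyMap_proj])

theorem pull_proj_coord (a : A) (z : Ev (dbl par)) :
    pull (proj par) (coord par a) z = coord (dbl par) (Sum.inl a) z :=
  pull_coord (isGerm_proj z).mem a

theorem pull_proj_algebraMap (r : ℝ) (z : Ev (dbl par)) :
    pull (proj par) (fun _ => algebraMap ℝ _ r) z = algebraMap ℝ _ r :=
  pull_algebraMap (isGerm_proj z).mem r

theorem pd_inr_pull_proj (a : A) {G : SFun par} (hG : Sm G (basePt par z)) :
    pd (Sum.inr a) (pull (proj par) G) z = 0 := by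
  rw [pd_pull (isGerm_proj z) _ (by rwa [bodyMap_proj])]
  refine Finset.sum_eq_zero fun b _ => ?_
  rw [proj, pd_coord, if_neg Sum.inr_ne_inl, zero_mul]

theorem basePt_bodyMap {F : SMap (dbl par) (dbl par)} {T : SMap par par}
    (h : ∀ a, F (Sum.inl a) z = pull (proj par) (T a) z) :
    basePt par (bodyMap F z) = bodyMap T (basePt par z) := by
  funext a
  change body (F (Sum.inl a.1) z) = body (T a (basePt par z))
  rw [h, body_pull (isGerm_proj z).mem, bodyMap_proj]

/-- The pullback of functions on the base by a bundle map. -/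
theorem pull_pull_proj {F : SMap (dbl par) (dbl par)} {T : SMap par par} (hF : IsGerm F z)
    (hT : IsGerm T (basePt par z)) (h : ∀ a, F (Sum.inl a) z = pull (proj par) (T a) z)
    {G : SFun par} (hG : Sm G (bodyMap T (basePt par z))) :
    pull F (pull (proj par) G) z = pull (proj par) (pull T G) z := by
  rw [pull_pull hF (isGerm_proj _) (by rwa [bodyMap_proj, basePt_bodyMap h]),
    pull_pull (isGerm_proj z) (by rwa [bodyMap_proj]) (by rwa [bodyMap_proj])]
  refine pull_congr_left (fun a => ?_) G
  rw [← h, proj, pull_coord hF.mem]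

omit [Fintype A] in
theorem body_coord_inr (hz : ∀ b : EvIx (dbl par), b.1.isRight → z b = 0) (a : A) :
    body (coord (dbl par) (Sum.inr a) z) = 0 := by
  rcases zmod_two_cases (dbl par (Sum.inr a)) with h | h
  · rw [coord_even h, body_algebraMap]
    exact hz _ rfl
  · rw [coord_odd h, body_ι]

end Projection

end Super

end

noncomputable section

namespace Super

open Filter Topology
open scoped ContDiff

/-! ### The two bundles, and compatibility of the maps with coordinate changes -/

section Bundle

variable {A : Type v} {par : A → ZMod 2} [Fintype A] [DecidableEq A] {M : SuperAtlas.{u} par}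

/-- Transition maps of a bundle over `M` whose coordinates have the parities `dbl par`. -/
structure IsBundle (M : SuperAtlas.{u} par) (τ : M.ι → M.ι → SMap (dbl par) (dbl par)) :
    Prop where
  germ : ∀ i j z, basePt par z ∈ M.overlap i j → IsGerm (τ i j) z
  inl : ∀ i j a z, τ i j (Sum.inl a) z = pull (proj par) (M.trans i j a) z
  self : ∀ i b z, basePt par z ∈ M.dom i → τ i i b z = coord (dbl par) b z
  cocycle : ∀ i j k z, basePt par z ∈ M.overlap i j →
    bodyMap (M.trans i j) (basePt par z) ∈ M.overlap j k →
    ∀ b, pull (τ i j) (τ j k b) z = τ i k b z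
  zero : ∀ i j z, basePt par z ∈ M.overlap i j →
    (∀ b : EvIx (dbl par), b.1.isRight → z b = 0) →
    ∀ b : EvIx (dbl par), b.1.isRight → bodyMap (τ i j) z b = 0

theorem piT_inl (i j : M.ι) (a : A) :
    (piT M).trans i j (Sum.inl a) = pull (proj par) (M.trans i j a) := rfl

theorem piT_inr (i j : M.ι) (a' : A) : (piT M).trans i j (Sum.inr a') = fun z =>
    ∑ a, coord (dbl par) (Sum.inr a) z * pull (proj par) (pd a (M.trans i j a')) z := by
  funext z
  simp [piT]

theorem piTstar_inl (i j : M.ι) (a : A) :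
    (piTstar M).trans i j (Sum.inl a) = pull (proj par) (M.trans i j a) := rfl

theorem piTstar_inr (i j : M.ι) (a' : A) : (piTstar M).trans i j (Sum.inr a') = fun z =>
    ∑ a, pull (proj par) (invJac M i j a' a) z * coord (dbl par) (Sum.inr a) z := by
  funext z
  simp [piTstar, invJac]

theorem piT_germ (hM : M.IsSupermanifold) (i j : M.ι) (z : Ev (dbl par))
    (hz : basePt par z ∈ M.overlap i j) : IsGerm ((piT M).trans i j) z where
  smooth b := by
    have hg := hM.germ hz
    rcases b with a | a'
    · rw [piT_inl]; exact sm_pull_proj (hg.smooth a)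
    · rw [piT_inr]
      exact sm_sum fun a _ => (sm_coord _ _).mul (sm_pull_proj ((hg.smooth a').pd a))
  parity := by
    filter_upwards [eventually_basePt (hM.germ hz).eventually] with z' hg b
    rcases b with a | a'
    · rw [piT_inl]; exact pull_proj_mem (hg.parity.mono fun x hx => hx a)
    · rw [piT_inr]
      refine Submodule.sum_mem _ fun a _ => mul_mem_parityPart' (coord_mem _ _)
        (pull_proj_mem (hg.eventually.mono fun x hx => hx.pd_mem a a')) ?_
      change par a + 1 + (par a' + par a) = par a' + 1
      generalize par a = p
      generalize par a' = q
      revert p q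
      decide

theorem piTstar_germ (hM : M.IsSupermanifold) (i j : M.ι) (z : Ev (dbl par))
    (hz : basePt par z ∈ M.overlap i j) : IsGerm ((piTstar M).trans i j) z where
  smooth b := by
    rcases b with a | a'
    · rw [piTstar_inl]; exact sm_pull_proj ((hM.germ hz).smooth a)
    · rw [piTstar_inr]
      exact sm_sum fun a _ => (sm_pull_proj (sm_invJac hM hz a' a)).mul (sm_coord _ _)
  parity := by
    filter_upwards [eventually_basePt (hM.germ hz).eventually,
      eventually_basePt (hM.eventually_overlap hz)] with z' hg hz' b
    rcases b with a | a'
    · rw [piTstar_inl]; exact pull_proj_mem (hg.parity.mono fun x hx => hx a)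
    · rw [piTstar_inr]
      refine Submodule.sum_mem _ fun a _ => mul_mem_parityPart' (pull_proj_mem
        ((hM.eventually_overlap hz').mono fun x hx => invJac_mem hM hx a' a)) (coord_mem _ _) ?_
      change par a + par a' + (par a + 1) = par a' + 1
      generalize par a = p
      generalize par a' = q
      revert p q
      decide

theorem piT_isBundle (hM : M.IsSupermanifold) : IsBundle M (piT M).trans where
  germ := piT_germ hM
  inl _ _ _ _ := rfl
  self i b z hz := by
    rcases b with a | a'
    · rw [piT_inl, pull_proj_congr (hM.eventually_trans_self hz a), pull_proj_coord]
    · rw [piT_inr]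
      have h1 : ∀ a, pull (proj par) (pd a (M.trans i i a')) z = if a = a' then 1 else 0 := by
        intro a
        rw [pull_proj_congr (pd_eventuallyEq a (hM.eventually_trans_self hz a')),
          funext (pd_coord a a')]
        split_ifs
        · simpa using pull_proj_algebraMap 1 z
        · simpa using pull_proj_algebraMap 0 z
      simp [h1]
  cocycle i j k z hz hy b := by
    have hg := hM.germ hz
    have hg' := hM.germ hy
    have ht := piT_germ hM i j z hz
    rcases b with a | a''
    · rw [piT_inl, piT_inl, pull_pull_proj ht hg (fun _ => rfl) (hg'.smooth a)]
      exact pull_proj_congr (hM.eventually_cocycle hz hy a)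
    · have hb : basePt par (bodyMap ((piT M).trans i j) z) =
          bodyMap (M.trans i j) (basePt par z) := basePt_bodyMap fun _ => rfl
      have hs : ∀ a', Sm (pd a' (M.trans j k a'')) (bodyMap (M.trans i j) (basePt par z)) :=
        fun a' => (hg'.smooth a'').pd a'
      have h1 : ∀ a, pull (proj par) (pd a (M.trans i k a'')) z =
          ∑ a', pull (proj par) (pd a (M.trans i j a')) z *
            pull (proj par) (pull (M.trans i j) (pd a' (M.trans j k a''))) z := by
        intro a
        have h2 : pd a (M.trans i k a'') =ᶠ[𝓝 (basePt par z)] fun x =>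
            ∑ a', pd a (M.trans i j a') x * pull (M.trans i j) (pd a' (M.trans j k a'')) x := by
          filter_upwards [(hM.eventually_cocycle hz hy a'').eventuallyEq_nhds, hg.eventually,
            hg.eventually_bodyMap (hg'.smooth a'').eventually] with x h3 h4 h5
          rw [← pd_congr a h3, pd_pull h4 a h5]
        rw [pull_proj_congr h2, pull_proj_sum _ fun a' =>
          ((hg.smooth a').pd a).mul (Sm.pull hg (hs a'))]
        exact Finset.sum_congr rfl fun a' _ =>
          pull_proj_mul ((hg.smooth a').pd a) (Sm.pull hg (hs a'))
      rw [piT_inr, piT_inr, pull_sum _ fun a' => (sm_coord _ _).mul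
        (sm_pull_proj (by rw [hb]; exact hs a'))]
      simp only [h1, Finset.mul_sum]
      rw [Finset.sum_comm]
      refine Finset.sum_congr rfl fun a' _ => ?_
      rw [pull_mul ht.mem (sm_coord _ _) (sm_pull_proj (by rw [hb]; exact hs a')),
        pull_coord ht.mem, pull_pull_proj ht hg (fun _ => rfl) (hs a'), piT_inr, Finset.sum_mul]
      exact Finset.sum_congr rfl fun a _ => mul_assoc _ _ _
  zero i j z hz h0 b hb := by
    obtain ⟨b | b, h⟩ := b
    · simp at hb
    · change body ((piT M).trans i j (Sum.inr b) z) = 0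
      rw [piT_inr, map_sum]
      exact Finset.sum_eq_zero fun a _ => by rw [map_mul, body_coord_inr h0, zero_mul]

theorem piTstar_isBundle (hM : M.IsSupermanifold) : IsBundle M (piTstar M).trans where
  germ := piTstar_germ hM
  inl _ _ _ _ := rfl
  self i b z hz := by
    rcases b with a | a'
    · rw [piTstar_inl, pull_proj_congr (hM.eventually_trans_self hz a), pull_proj_coord]
    · rw [piTstar_inr]
      have h1 : ∀ a, pull (proj par) (invJac M i i a' a) z = if a' = a then 1 else 0 := by
        intro a
        have h2 : invJac M i i a' a =ᶠ[𝓝 (basePt par z)]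
            fun _ => algebraMap ℝ _ (if a' = a then 1 else 0) := by
          filter_upwards [(hM.isOpen_dom i).mem_nhds hz] with x hx
          rw [invJac, pull_congr_left fun b => hM.trans_self i b x hx, pull_id,
            pd_congr a' (hM.eventually_trans_self hx a), pd_coord]
          split_ifs <;> simp
        rw [pull_proj_congr h2, pull_proj_algebraMap]
        split_ifs <;> simp
      simp [h1]
  cocycle i j k z hz hy b := by
    have hg := hM.germ hz
    have hg' := hM.germ hy
    have ht := piTstar_germ hM i j z hz
    rcases b with a | a''
    · rw [piTstar_inl, piTstar_inl, pull_pull_proj ht hg (fun _ => rfl) (hg'.smooth a)]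
      exact pull_proj_congr (hM.eventually_cocycle hz hy a)
    · have hb : basePt par (bodyMap ((piTstar M).trans i j) z) =
          bodyMap (M.trans i j) (basePt par z) := basePt_bodyMap fun _ => rfl
      have hs : ∀ a', Sm (invJac M j k a'' a') (bodyMap (M.trans i j) (basePt par z)) :=
        fun a' => sm_invJac hM hy a'' a'
      have h1 : ∀ a, pull (proj par) (invJac M i k a'' a) z =
          ∑ a', pull (proj par) (pull (M.trans i j) (invJac M j k a'' a')) z *
            pull (proj par) (invJac M i j a' a) z := by
        intro a
        have h2 : invJac M i k a'' a =ᶠ[𝓝 (basePt par z)] fun x =>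
            ∑ a', pull (M.trans i j) (invJac M j k a'' a') x * invJac M i j a' a x := by
          filter_upwards [hM.eventually_overlap hz,
            hg.eventually_bodyMap (hM.eventually_overlap hy)] with x h3 h4
          exact (sum_pull_invJac_mul hM h3 h4 a'' a).symm
        rw [pull_proj_congr h2, pull_proj_sum _ fun a' =>
          (Sm.pull hg (hs a')).mul (sm_invJac hM hz a' a)]
        exact Finset.sum_congr rfl fun a' _ =>
          pull_proj_mul (Sm.pull hg (hs a')) (sm_invJac hM hz a' a)
      rw [piTstar_inr, piTstar_inr, pull_sum _ fun a' =>
        (sm_pull_proj (by rw [hb]; exact hs a')).mul (sm_coord _ _)]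
      simp only [h1, Finset.sum_mul]
      rw [Finset.sum_comm]
      refine Finset.sum_congr rfl fun a' _ => ?_
      rw [pull_mul ht.mem (sm_pull_proj (by rw [hb]; exact hs a')) (sm_coord _ _),
        pull_coord ht.mem, pull_pull_proj ht hg (fun _ => rfl) (hs a'), piTstar_inr, Finset.mul_sum]
      exact Finset.sum_congr rfl fun a _ => (mul_assoc _ _ _).symm
  zero i j z hz h0 b hb := by
    obtain ⟨b | b, h⟩ := b
    · simp at hb
    · change body ((piTstar M).trans i j (Sum.inr b) z) = 0
      rw [piTstar_inr, map_sum]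
      exact Finset.sum_eq_zero fun a _ => by rw [map_mul, body_coord_inr h0, mul_zero]

/-- Coordinate expressions of a map over `M` of the bundles with transition maps `τ` and `τ'`. -/
structure IsFibreMap (M : SuperAtlas.{u} par) (τ τ' : M.ι → M.ι → SMap (dbl par) (dbl par))
    (F : M.ι → SMap (dbl par) (dbl par)) : Prop where
  germ : ∀ i z, basePt par z ∈ M.dom i → IsGerm (F i) z
  inl : ∀ i a z, F i (Sum.inl a) z = coord (dbl par) (Sum.inl a) z
  intertwine : ∀ i j z, basePt par z ∈ M.overlap i j → ∀ b,
    pull (F i) (τ' i j b) z = pull (τ i j) (F j b) z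

theorem basePt_fibre {F : SMap (dbl par) (dbl par)} {z : Ev (dbl par)}
    (h : ∀ a, F (Sum.inl a) z = coord (dbl par) (Sum.inl a) z) :
    basePt par (bodyMap F z) = basePt par z := by
  rw [basePt_bodyMap (T := coord par) fun a => by rw [h, pull_proj_coord], bodyMap_coord]

theorem pull_fibre_pull_proj {F : SMap (dbl par) (dbl par)} {z : Ev (dbl par)} (hF : IsGerm F z)
    (h : ∀ a, F (Sum.inl a) z = coord (dbl par) (Sum.inl a) z) {G : SFun par}
    (hG : Sm G (basePt par z)) : pull F (pull (proj par) G) z = pull (proj par) G z := by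
  rw [pull_pull_proj (T := coord par) hF (isGerm_coord _)
    (fun a => by rw [h, pull_proj_coord]) (by rwa [bodyMap_coord])]
  congr 1
  funext x
  exact pull_id G x

omit [Fintype A] [DecidableEq A] in
theorem isOpen_basePt {U : Set (Ev par)} (hU : IsOpen U) : IsOpen {z | basePt par z ∈ U} :=
  hU.preimage continuous_basePt

theorem isGerm_fibre (f : A → SFun (dbl par)) {z : Ev (dbl par)} (hf : ∀ a, Sm (f a) z)
    (hp : ∀ᶠ z' in 𝓝 z, ∀ a, f a z' ∈ parityPart (par a + 1)) :
    IsGerm (par' := dbl par) (Sum.elim (fun a => coord (dbl par) (Sum.inl a)) f) z where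
  smooth b := by
    rcases b with a | a
    · exact sm_coord _ _
    · exact hf a
  parity := by
    filter_upwards [hp] with z' h b
    rcases b with a | a
    · exact coord_mem _ _
    · exact h a

/-- The coefficients of the chain rule for a bundle in the fibre directions. -/
theorem pd_inr_pull {τ : SMap (dbl par) (dbl par)} {T : SMap par par} {z : Ev (dbl par)}
    (hτ : IsGerm τ z) (hT : IsGerm T (basePt par z))
    (h : ∀ a, τ (Sum.inl a) = pull (proj par) (T a)) (a : A) {f : SFun (dbl par)}
    (hf : Sm f (bodyMap τ z)) :
    pd (Sum.inr a) (pull τ f) z =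
      ∑ a'', pd (Sum.inr a) (τ (Sum.inr a'')) z * pull τ (pd (Sum.inr a'') f) z := by
  rw [pd_pull hτ _ hf, Fintype.sum_sum_type, Finset.sum_eq_zero, zero_add]
  intro b _
  rw [h, pd_inr_pull_proj a (hT.smooth b), zero_mul]

theorem basePt_mem_overlap {τ : M.ι → M.ι → SMap (dbl par) (dbl par)} (hτ : IsBundle M τ)
    (hM : M.IsSupermanifold) {i j : M.ι} {z : Ev (dbl par)} (hz : basePt par z ∈ M.overlap i j) :
    basePt par (bodyMap (τ i j) z) ∈ M.overlap j i := by
  rw [basePt_bodyMap fun a => hτ.inl i j a z]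
  exact hM.mapsTo i j hz

section EvenFunction

variable {N : SuperAtlas.{u} (dbl par)} {f : N.ι → SFun (dbl par)}

theorem SuperAtlas.IsEvenFunction.sm (hf : N.IsEvenFunction f) {i : N.ι} (ho : IsOpen (N.dom i))
    {z : Ev (dbl par)} (hz : z ∈ N.dom i) : Sm (f i) z := sm_of_contDiffOn (hf.smooth i) ho hz

theorem SuperAtlas.IsEvenFunction.pd_inr_mem (hf : N.IsEvenFunction f) {i : N.ι}
    (ho : IsOpen (N.dom i)) {z : Ev (dbl par)} (hz : z ∈ N.dom i) (a : A) :
    pd (Sum.inr a) (f i) z ∈ parityPart (par a + 1) := by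
  have := pd_mem (Sum.inr a) (f := f i) (x := z) (e := 0)
    (by filter_upwards [ho.mem_nhds hz] with z' h using hf.even i z' h)
  rwa [zero_add] at this

end EvenFunction

theorem sum_pull_proj_invJac_mul (hM : M.IsSupermanifold) {i j : M.ι} {z : Ev (dbl par)}
    (hz : basePt par z ∈ M.overlap i j) (a' a'' : A) :
    ∑ a, pull (proj par) (invJac M i j a' a) z * pull (proj par) (pd a (M.trans i j a'')) z =
      if a' = a'' then 1 else 0 := by
  have hg := hM.germ hz
  have h4 : (fun x => ∑ a, invJac M i j a' a x * pd a (M.trans i j a'') x)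
      =ᶠ[𝓝 (basePt par z)] fun _ => algebraMap ℝ _ (if a' = a'' then 1 else 0) := by
    filter_upwards [hM.eventually_overlap hz] with x hx
    rw [sum_invJac_mul hM hx]
    split_ifs <;> simp
  have h5 := pull_proj_congr h4
  rw [pull_proj_algebraMap, pull_proj_sum _ fun a =>
    (sm_invJac hM hz a' a).mul ((hg.smooth a'').pd a)] at h5
  rw [← Finset.sum_congr rfl fun a _ =>
    pull_proj_mul (sm_invJac hM hz a' a) ((hg.smooth a'').pd a), h5]
  split_ifs <;> simp

/-- The fibre derivatives of `ω` transform by the Jacobi matrix, which the cotangent transition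
cancels by its inverse. No signs arise, since `dx^a` stands to the left of its coefficient. -/
theorem psi_isFibreMap (hM : M.IsSupermanifold) {f : M.ι → SFun (dbl par)}
    (hf : (piT M).IsEvenFunction f) :
    IsFibreMap M (piT M).trans (piTstar M).trans (psi M f).map where
  germ i z hz := by
    have ho := isOpen_basePt (hM.isOpen_dom i)
    refine isGerm_fibre _ (fun a => (hf.sm ho hz).pd _) ?_
    filter_upwards [ho.mem_nhds hz] with z' hz' a using hf.pd_inr_mem ho hz' a
  inl _ _ _ := rfl
  intertwine i j z hz b := by
    have ho := isOpen_basePt (hM.isOpen_dom i)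
    have ho' := isOpen_basePt (hM.isOpen_dom j)
    have hzi := hM.overlap_subset i j hz
    have hg := hM.germ hz
    have ht := piT_germ hM i j z hz
    have hF : IsGerm ((psi M f).map i) z := by
      refine isGerm_fibre _ (fun a => (hf.sm ho hzi).pd _) ?_
      filter_upwards [ho.mem_nhds hzi] with z' hz' a using hf.pd_inr_mem ho hz' a
    have hy : basePt par (bodyMap ((piT M).trans i j) z) ∈ M.dom j :=
      hM.overlap_subset _ _ (basePt_mem_overlap (piT_isBundle hM) hM hz)
    have hbF : basePt par (bodyMap ((psi M f).map i) z) = basePt par z := basePt_fibre fun _ => rfl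
    rcases b with a | a'
    · rw [piTstar_inl, pull_fibre_pull_proj hF (fun _ => rfl) (hg.smooth a)]
      exact (pull_coord ht.mem (Sum.inl a)).symm
    · rw [piTstar_inr, pull_sum _ fun a =>
        (sm_pull_proj (by rw [hbF]; exact sm_invJac hM hz a' a)).mul (sm_coord _ _)]
      have h1 : ∀ a, pd (Sum.inr a) (f i) z = ∑ a'', pull (proj par) (pd a (M.trans i j a'')) z *
          pull ((piT M).trans i j) (pd (Sum.inr a'') (f j)) z := by
        intro a
        have h2 : pull ((piT M).trans i j) (f j) =ᶠ[𝓝 z] f i := by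
          filter_upwards [(isOpen_basePt (hM.isOpen_overlap i j)).mem_nhds hz] with z' hz'
          exact hf.compat i j z' hz'
        rw [← pd_congr _ h2, pd_inr_pull ht hg (fun _ => rfl) a (hf.sm ho' hy)]
        refine Finset.sum_congr rfl fun a'' _ => ?_
        congr 1
        have hs : ∀ c, Sm (pull (proj par) (pd c (M.trans i j a''))) z :=
          fun c => sm_pull_proj ((hg.smooth a'').pd c)
        rw [piT_inr, pd_sum _ _ fun c => (sm_coord _ _).mul (hs c), Finset.sum_eq_single a]
        · rw [pd_mul _ (sm_coord _ _) (hs a), pd_coord, if_pos rfl, one_mul,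
            pd_inr_pull_proj a ((hg.smooth a'').pd a), mul_zero, add_zero]
        · intro c _ hc
          rw [pd_mul _ (sm_coord _ _) (hs c), pd_coord, if_neg (by simpa using hc.symm), zero_mul,
            pd_inr_pull_proj a ((hg.smooth a'').pd c), mul_zero, add_zero]
        · simp
      have h6 : ∀ a, pull ((psi M f).map i) (fun z' => pull (proj par) (invJac M i j a' a) z' *
          coord (dbl par) (Sum.inr a) z') z =
          ∑ a'', pull (proj par) (invJac M i j a' a) z * pull (proj par) (pd a (M.trans i j a'')) z *
            pull ((piT M).trans i j) (pd (Sum.inr a'') (f j)) z := by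
        intro a
        rw [pull_mul hF.mem (sm_pull_proj (by rw [hbF]; exact sm_invJac hM hz a' a)) (sm_coord _ _),
          pull_fibre_pull_proj hF (fun _ => rfl) (sm_invJac hM hz a' a), pull_coord hF.mem]
        refine (congrArg _ (h1 a)).trans ?_
        rw [Finset.mul_sum]
        exact Finset.sum_congr rfl fun _ _ => (mul_assoc _ _ _).symm
      rw [Finset.sum_congr rfl fun a _ => h6 a, Finset.sum_comm]
      simp only [← Finset.sum_mul, sum_pull_proj_invJac_mul hM hz]
      rw [Finset.sum_eq_single a' (fun b _ hb => by rw [if_neg hb.symm, zero_mul]) (by simp),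
        if_pos rfl, one_mul]
      rfl

theorem neg_one_pow_val_add (e f : ZMod 2) :
    (-1 : ℝ) ^ (e + f).val = (-1) ^ e.val * (-1) ^ f.val := by
  rw [← pow_add, neg_one_pow_eq_pow_mod_two, neg_one_pow_eq_pow_mod_two (n := e.val + f.val)]
  congr 1
  revert e f
  decide

theorem phi_isGerm (hM : M.IsSupermanifold) {f : M.ι → SFun (dbl par)}
    (hf : (piTstar M).IsEvenFunction f) (i : M.ι) (z : Ev (dbl par))
    (hz : basePt par z ∈ M.dom i) : IsGerm ((phi M f).map i) z := by
  have ho := isOpen_basePt (hM.isOpen_dom i)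
  refine isGerm_fibre _ (fun a => ((hf.sm ho hz).pd _).const_smul _) ?_
  filter_upwards [ho.mem_nhds hz] with z' hz' a
    using Submodule.smul_mem _ _ (hf.pd_inr_mem ho hz' a)

theorem phi_isFibreMap (hM : M.IsSupermanifold) {f : M.ι → SFun (dbl par)}
    (hf : (piTstar M).IsEvenFunction f) :
    IsFibreMap M (piTstar M).trans (piT M).trans (phi M f).map where
  germ := phi_isGerm hM hf
  inl _ _ _ := rfl
  intertwine i j z hz b := by
    have ho' := isOpen_basePt (hM.isOpen_dom j)
    have hzi := hM.overlap_subset i j hz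
    have hg := hM.germ hz
    have ht := piTstar_germ hM i j z hz
    have hF := phi_isGerm hM hf i z hzi
    have hy : basePt par (bodyMap ((piTstar M).trans i j) z) ∈ M.dom j :=
      hM.overlap_subset _ _ (basePt_mem_overlap (piTstar_isBundle hM) hM hz)
    have hbF : basePt par (bodyMap ((phi M f).map i) z) = basePt par z := basePt_fibre fun _ => rfl
    rcases b with a | a'
    · rw [piT_inl, pull_fibre_pull_proj hF (fun _ => rfl) (hg.smooth a)]
      exact (pull_coord ht.mem (Sum.inl a)).symm
    · rw [piT_inr, pull_sum _ fun a => (sm_coord _ _).mul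
        (sm_pull_proj (by rw [hbF]; exact (hg.smooth a').pd a))]
      -- Here the fibre coordinate stands to the right of its coefficient, so a derivative of parity
      -- ã + 1 has to pass a Jacobian entry of parity ã + ã''.
      have h1 : ∀ a, pd (Sum.inr a) (f i) z =
          ∑ a'', (-1 : ℝ) ^ ((par a + 1) * (par a + par a'')).val •
            pull (proj par) (invJac M i j a'' a) z *
              pull ((piTstar M).trans i j) (pd (Sum.inr a'') (f j)) z := by
        intro a
        have h2 : pull ((piTstar M).trans i j) (f j) =ᶠ[𝓝 z] f i := by
          filter_upwards [(isOpen_basePt (hM.isOpen_overlap i j)).mem_nhds hz] with z' hz'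
          exact hf.compat i j z' hz'
        rw [← pd_congr _ h2, pd_inr_pull ht hg (fun _ => rfl) a (hf.sm ho' hy)]
        refine Finset.sum_congr rfl fun a'' _ => ?_
        congr 1
        have hs : ∀ c, Sm (pull (proj par) (invJac M i j a'' c)) z :=
          fun c => sm_pull_proj (sm_invJac hM hz a'' c)
        have hm : pull (proj par) (invJac M i j a'' a) z ∈ parityPart (par a + par a'') :=
          pull_proj_mem ((hM.eventually_overlap hz).mono fun x hx => invJac_mem hM hx a'' a)
        rw [piTstar_inr, pd_sum _ _ fun c => (hs c).mul (sm_coord _ _), Finset.sum_eq_single a]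
        · rw [pd_mul _ (hs a) (sm_coord _ _), pd_coord, if_pos rfl, mul_one,
            pd_inr_pull_proj a (sm_invJac hM hz a'' a), zero_mul, zero_add]
          exact sg_of_mem hm
        · intro c _ hc
          rw [pd_mul _ (hs c) (sm_coord _ _), pd_coord, if_neg (by simpa using hc.symm), mul_zero,
            pd_inr_pull_proj a (sm_invJac hM hz a'' c), zero_mul, zero_add]
        · simp
      have hY : ∀ a'', pull ((piTstar M).trans i j) (pd (Sum.inr a'') (f j)) z ∈
          parityPart (par a'' + 1) := fun a'' => pull_mem ht.mem (by
        filter_upwards [ho'.mem_nhds hy] with y' hy' using hf.pd_inr_mem ho' hy' a'')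
      have hZ : ∀ a, pull (proj par) (pd a (M.trans i j a')) z ∈ parityPart (par a' + par a) :=
        fun a => pull_proj_mem (hg.eventually.mono fun x hx => hx.pd_mem a a')
      -- Three signs combine: the prefactor of `phi`, the one from `h1`, and the one from moving the
      -- fibre derivative past ∂x^{a'}/∂x^a. Their product is independent of `a`, so the sum over
      -- `a` is the product of inverse Jacobian matrices.
      have h6 : ∀ a, pull ((phi M f).map i) (fun z' => coord (dbl par) (Sum.inr a) z' *
          pull (proj par) (pd a (M.trans i j a')) z') z =
          ∑ a'', (-1 : ℝ) ^ (1 + par a'' + par a'' * par a' + par a').val •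
            ((pull (proj par) (invJac M i j a'' a) z *
              pull (proj par) (pd a (M.trans i j a')) z) *
            pull ((piTstar M).trans i j) (pd (Sum.inr a'') (f j)) z) := by
        intro a
        rw [pull_mul hF.mem (sm_coord _ _)
            (sm_pull_proj (by rw [hbF]; exact (hg.smooth a').pd a)),
          pull_fibre_pull_proj hF (fun _ => rfl) ((hg.smooth a').pd a), pull_coord hF.mem]
        change ((-1 : ℝ) ^ (par a + 1).val • pd (Sum.inr a) (f i) z) * _ = _
        rw [h1, Finset.smul_sum, Finset.sum_mul]
        refine Finset.sum_congr rfl fun a'' _ => ?_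
        rw [smul_mul_assoc, smul_mul_assoc, smul_mul_assoc, mul_assoc,
          mul_eq_sg_mul (hY a''), sg_of_mem (hZ a), smul_mul_assoc, mul_smul_comm, smul_smul,
          smul_smul, ← neg_one_pow_val_add, ← neg_one_pow_val_add, mul_assoc]
        congr 3
        generalize par a = p
        generalize par a' = q
        generalize par a'' = r
        revert p q r
        decide
      rw [Finset.sum_congr rfl fun a _ => h6 a, Finset.sum_comm]
      simp only [← Finset.smul_sum, ← Finset.sum_mul, sum_pull_proj_invJac_mul hM hz]
      rw [Finset.sum_eq_single a' (fun b _ hb => by rw [if_neg hb, zero_mul, smul_zero]) (by simp),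
        if_pos rfl, one_mul]
      refine Eq.trans ?_ (pull_const_smul ht.mem _ ((hf.sm ho' hy).pd _)).symm
      -- At ã'' = ã' the total sign reduces to (-1)^(ã'+1), the prefactor in the target chart.
      congr 2
      generalize par a' = q
      revert q
      decide

end Bundle

end Super

end

noncomputable section

namespace Super

open Filter Topology
open scoped ContDiff

/-! ### Invertibility of Grassmann matrices -/

section MatrixUnits

variable {O : Type*} [Finite O] {A : Type*} [Fintype A] [DecidableEq A]

/-- A matrix over a Grassmann algebra is invertible iff its body is. -/
theorem isUnit_matrix_iff (N : Matrix A A (Gr O)) :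
    IsUnit N ↔ IsUnit (N.map (body : Gr O →ₐ[ℝ] ℝ)) := by
  constructor
  · intro h
    exact h.map (RingHom.mapMatrix (body : Gr O →ₐ[ℝ] ℝ).toRingHom)
  · intro h
    cases nonempty_fintype O
    obtain ⟨L, hL, hL'⟩ := isUnit_iff_exists.mp h
    set K : Matrix A A (Gr O) := L.map (algebraMap ℝ (Gr O)) with hK
    have hKb : K.map (body : Gr O →ₐ[ℝ] ℝ) = L := by
      ext a b
      simp [hK]
    -- A matrix with body 1 is the identity plus a nilpotent matrix, as powers of `Q - 1` descend in
    -- the filtration.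
    have key : ∀ Q : Matrix A A (Gr O), Q.map (body : Gr O →ₐ[ℝ] ℝ) = 1 → IsUnit Q := by
      intro Q hQ
      have h1 : ∀ m : ℕ, ∀ a b, ((Q - 1) ^ m) a b ∈ Fil O m := by
        intro m
        induction m with
        | zero => simp
        | succ m ih =>
          intro a b
          rw [pow_succ, Matrix.mul_apply]
          refine Submodule.sum_mem _ fun c _ => mul_mem_Fil (ih a c) ?_
          rw [mem_Fil_one, Matrix.sub_apply, map_sub]
          have := congrFun (congrFun hQ c) b
          rw [Matrix.map_apply] at this
          rw [this]
          by_cases hcb : c = b <;> simp [Matrix.one_apply, hcb]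
      have h2 : IsNilpotent (Q - 1) := by
        refine ⟨Fintype.card O + 1, ?_⟩
        ext a b
        have := h1 (Fintype.card O + 1) a b
        rw [Fil_eq_bot (by omega)] at this
        simpa using this
      simpa using h2.isUnit_one_add
    have h1 : IsUnit (N * K) := key _ (by
      rw [← hKb] at hL
      rw [← hL]
      exact (RingHom.mapMatrix (body : Gr O →ₐ[ℝ] ℝ).toRingHom).map_mul N K)
    have h2 : IsUnit (K * N) := key _ (by
      rw [← hKb] at hL'
      rw [← hL']
      exact (RingHom.mapMatrix (body : Gr O →ₐ[ℝ] ℝ).toRingHom).map_mul K N)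
    obtain ⟨R, hR, -⟩ := isUnit_iff_exists.mp h1
    obtain ⟨S, -, hS⟩ := isUnit_iff_exists.mp h2
    refine isUnit_iff_exists_and_exists.mpr ⟨⟨K * R, by rw [← mul_assoc, hR]⟩,
      ⟨S * K, by rw [mul_assoc, hS]⟩⟩

end MatrixUnits

/-! ### The fibre Hessian as a block of the Jacobi matrix -/

section Hessian

variable {A : Type v} {par : A → ZMod 2} [Fintype A] [DecidableEq A]

omit [Fintype A] in
theorem zeroSec_mem (x : Ev par) (b : A ⊕ A) : zeroSec par b x ∈ parityPart (dbl par b) := by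
  rcases b with a | a
  · exact coord_mem a x
  · exact Submodule.zero_mem _

omit [Fintype A] in
theorem bodyMap_zeroSec {z : Ev (dbl par)} (h0 : ∀ b : EvIx (dbl par), b.1.isRight → z b = 0) :
    bodyMap (par' := dbl par) (zeroSec par) (basePt par z) = z := by
  funext ⟨b, hb⟩
  rcases b with a | a
  · change body (coord par a (basePt par z)) = _
    rw [coord_even (par := par) hb, body_algebraMap]
    rfl
  · rw [h0 _ rfl]
    exact map_zero body

omit [Fintype A] in
theorem bodyMap_zeroSec_right (x : Ev par) (b : EvIx (dbl par)) (hb : b.1.isRight) :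
    bodyMap (par' := dbl par) (zeroSec par) x b = 0 := by
  obtain ⟨b | b, h⟩ := b
  · simp at hb
  · exact map_zero body

omit [Fintype A] in
theorem basePt_zeroSec (x : Ev par) :
    basePt par (bodyMap (par' := dbl par) (zeroSec par) x) = x := by
  funext a
  change body (coord par a.1 x) = _
  rw [coord_even a.2, body_algebraMap]

/-- Base coordinates are preserved and have zero fibre derivatives, so the matrix is block
triangular with an identity block. Its determinant is that of the body of the Hessian times the
product of the `c a`; these constants accommodate the signs in `phi`. -/
theorem isUnit_bJ_iff {F : SMap (dbl par) (dbl par)} {f : SFun (dbl par)} {z : Ev (dbl par)}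
    (c : A → ℝ) (hc : ∀ a, c a ≠ 0) (hl : ∀ a, F (Sum.inl a) = coord (dbl par) (Sum.inl a))
    (hr : ∀ a, F (Sum.inr a) = fun z => c a • pd (Sum.inr a) f z) (hf : Sm f z)
    (h0 : ∀ b : EvIx (dbl par), b.1.isRight → z b = 0) :
    IsUnit (bJ F z) ↔ IsUnit (fiberHessian f (basePt par z)) := by
  have h1 : bJ F z = Matrix.fromBlocks 1 (bJ F z).toBlocks₁₂ 0
      ((fiberHessian f (basePt par z)).map (body : Gr (OdIx par) →ₐ[ℝ] ℝ) *
        Matrix.diagonal c) := by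
    ext a b
    rcases a with a | a <;> rcases b with b | b
    · rw [bJ, hl, pd_coord, Matrix.fromBlocks_apply₁₁, Matrix.one_apply]
      by_cases h : a = b <;> simp [h]
    · rfl
    · rw [bJ, hl, pd_coord]
      simp
    · rw [bJ, hr, pd_const_smul _ _ (hf.pd _), Matrix.fromBlocks_apply₂₂, Matrix.mul_diagonal,
        Matrix.map_apply, fiberHessian, body_pull (zeroSec_mem _), bodyMap_zeroSec h0, map_smul,
        smul_eq_mul, mul_comm]
  have h2 : IsUnit (∏ a, c a) := (Finset.prod_ne_zero_iff.mpr fun a _ => hc a).isUnit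
  rw [isUnit_matrix_iff, h1, Matrix.isUnit_iff_isUnit_det, Matrix.isUnit_iff_isUnit_det,
    Matrix.det_fromBlocks_zero₂₁, Matrix.det_one, one_mul, Matrix.det_mul, Matrix.det_diagonal,
    IsUnit.mul_iff]
  exact and_iff_left h2

end Hessian

section Jacobian

variable {A : Type v} {par : A → ZMod 2} [Fintype A] [DecidableEq A] {x : Ev par}

theorem bJ_congr {F F' : SMap par par} (h : ∀ b, F b =ᶠ[𝓝 x] F' b) : bJ F x = bJ F' x := by
  ext a b
  rw [bJ, bJ, pd_congr a (h b)]

theorem bJ_coord (x : Ev par) : bJ (par' := par) (coord par) x = 1 := by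
  ext a b
  rw [bJ, pd_coord, Matrix.one_apply]
  split_ifs <;> simp

end Jacobian

/-! ### Maps over `M`: necessity of an invertible differential -/

section FibreMap

variable {A : Type v} {par : A → ZMod 2} [Fintype A] [DecidableEq A] {M : SuperAtlas.{u} par}
  {τ τ' : M.ι → M.ι → SMap (dbl par) (dbl par)} {F : M.ι → SMap (dbl par) (dbl par)}
  {i j k : M.ι} {z : Ev (dbl par)}

/-- The total space of the bundle over `M` with transition maps `τ`. -/
def total (M : SuperAtlas.{u} par) (τ : M.ι → M.ι → SMap (dbl par) (dbl par)) :
    SuperAtlas.{u} (dbl par) where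
  ι := M.ι
  dom i := {z | basePt par z ∈ M.dom i}
  overlap i j := {z | basePt par z ∈ M.overlap i j}
  trans := τ

/-- The map of total spaces over `M` with coordinate expressions `F`. -/
def fibreMap (M : SuperAtlas.{u} par) (τ τ' : M.ι → M.ι → SMap (dbl par) (dbl par))
    (F : M.ι → SMap (dbl par) (dbl par)) : SuperMap (total M τ) (total M τ') where
  κ := M.ι
  src := fun i => i
  tgt := fun i => i
  dom := (total M τ).dom
  map := F

namespace IsBundle

theorem basePt_trans (hτ : IsBundle M τ) (i j : M.ι) (z : Ev (dbl par)) :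
    basePt par (bodyMap (τ i j) z) = bodyMap (M.trans i j) (basePt par z) :=
  basePt_bodyMap fun a => hτ.inl i j a z

theorem bodyMap_self (hτ : IsBundle M τ) (hz : basePt par z ∈ M.dom i) :
    bodyMap (τ i i) z = z := by
  rw [bodyMap_congr fun b => hτ.self i b z hz, bodyMap_coord]

theorem cocycle_body (hτ : IsBundle M τ) (hz : basePt par z ∈ M.overlap i j)
    (hy : bodyMap (M.trans i j) (basePt par z) ∈ M.overlap j k) :
    bodyMap (τ j k) (bodyMap (τ i j) z) = bodyMap (τ i k) z := by
  rw [← bodyMap_pull (τ j k) (hτ.germ i j z hz).mem]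
  exact bodyMap_congr (hτ.cocycle i j k z hz hy)

theorem bodyMap_inv (hτ : IsBundle M τ) (hM : M.IsSupermanifold)
    (hz : basePt par z ∈ M.overlap i j) : bodyMap (τ j i) (bodyMap (τ i j) z) = z := by
  rw [hτ.cocycle_body hz (hM.mapsTo i j hz), hτ.bodyMap_self (hM.overlap_subset i j hz)]

theorem isUnit_bJ (hτ : IsBundle M τ) (hM : M.IsSupermanifold)
    (hz : basePt par z ∈ M.overlap i j) : IsUnit (bJ (τ i j) z) := by
  have hy := hM.mapsTo i j hz
  have h1 := bJ_pull (hτ.germ i j z hz)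
    (hτ.germ j i (bodyMap (τ i j) z) (by rwa [hτ.basePt_trans]))
  rw [bJ_congr (F' := coord (dbl par)), bJ_coord] at h1
  · exact IsUnit.of_mul_eq_one _ h1.symm
  · intro b
    filter_upwards [eventually_basePt (hM.eventually_overlap hz)] with z' hz'
    rw [hτ.cocycle i j i z' hz' (hM.mapsTo i j hz'), hτ.self i b z' (hM.overlap_subset i j hz')]

end IsBundle

namespace IsFibreMap

theorem basePt_eq (hF : IsFibreMap M τ τ' F) (i : M.ι) (z : Ev (dbl par)) :
    basePt par (bodyMap (F i) z) = basePt par z := basePt_fibre fun a => hF.inl i a z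

theorem bodyMap_comm (hF : IsFibreMap M τ τ' F) (hτ : IsBundle M τ) (hM : M.IsSupermanifold)
    (hz : basePt par z ∈ M.overlap i j) :
    bodyMap (τ' i j) (bodyMap (F i) z) = bodyMap (F j) (bodyMap (τ i j) z) := by
  rw [← bodyMap_pull (τ' i j) (hF.germ i z (hM.overlap_subset i j hz)).mem,
    ← bodyMap_pull (F j) (hτ.germ i j z hz).mem]
  exact bodyMap_congr (hF.intertwine i j z hz)

/-- The intertwining relation and the chain rule express the differential of `F i` times that of
`τ'` as a product of invertible matrices. -/
theorem isUnit_bJ_of_trans (hF : IsFibreMap M τ τ' F) (hτ : IsBundle M τ) (hτ' : IsBundle M τ')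
    (hM : M.IsSupermanifold) (hz : basePt par z ∈ M.overlap i j)
    (hJ : IsUnit (bJ (F j) (bodyMap (τ i j) z))) : IsUnit (bJ (F i) z) := by
  have hb : basePt par (bodyMap (τ i j) z) ∈ M.dom j := by
    rw [hτ.basePt_trans]
    exact hM.overlap_subset _ _ (hM.mapsTo i j hz)
  have h1 := bJ_pull (hF.germ i z (hM.overlap_subset i j hz))
    (hτ'.germ i j (bodyMap (F i) z) (by rwa [hF.basePt_eq]))
  have h2 := bJ_pull (hτ.germ i j z hz) (hF.germ j _ hb)
  rw [bJ_congr (F' := fun b => pull (τ i j) (F j b)), h2] at h1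
  · have h3 := (hτ.isUnit_bJ hM hz).mul hJ
    rw [h1, Matrix.isUnit_iff_isUnit_det, Matrix.det_mul, IsUnit.mul_iff] at h3
    exact (Matrix.isUnit_iff_isUnit_det _).mpr h3.1
  · intro b
    filter_upwards [eventually_basePt (hM.eventually_overlap hz)] with z' hz'
    exact hF.intertwine i j z' hz' b

theorem isMorphism (hF : IsFibreMap M τ τ' F) (hτ : IsBundle M τ) (hM : M.IsSupermanifold) :
    (fibreMap M τ τ' F).IsMorphism where
  isOpen_dom i := isOpen_basePt (hM.isOpen_dom i)
  dom_subset _ := subset_rfl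
  cover (i : M.ι) (z : Ev (dbl par)) (hz : basePt par z ∈ M.dom i) := ⟨i, by
    change basePt par z ∈ M.overlap i i
    rwa [hM.overlap_self], by
    change basePt par (bodyMap (τ i i) z) ∈ M.dom i
    rwa [hτ.bodyMap_self hz]⟩
  smooth i := smoothOn_of_isGerm fun z hz => hF.germ i z hz
  mapsTo (i : M.ι) z hz := by
    change basePt par (bodyMap (F i) z) ∈ M.dom i
    rwa [hF.basePt_eq]
  agree (i j : M.ι) z _ ho _ := ⟨by
    change basePt par (bodyMap (F i) z) ∈ M.overlap i j
    rwa [hF.basePt_eq], hF.intertwine i j z ho⟩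

/-- A map over `M` that is a diffeomorphism near the zero section has invertible differential along
the zero section. -/
theorem isUnit_bJ_of_isDiffeo (hF : IsFibreMap M τ τ' F) (hτ : IsBundle M τ)
    (hτ' : IsBundle M τ') (hM : M.IsSupermanifold)
    (h : IsDiffeoNearZeroSection (fibreMap M τ τ' F)) (hz : basePt par z ∈ M.dom i)
    (h0 : ∀ b : EvIx (dbl par), b.1.isRight → z b = 0) : IsUnit (bJ (F i) z) := by
  obtain ⟨W, W', hW, hφ, ψ, hψ, hag, -⟩ := h
  have hzW : z ∈ W.carrier i := hW i z hz h0
  have hg := hF.germ i z hz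
  obtain ⟨c, hc1, hc2⟩ := hψ.cover i (bodyMap (F i) z) (hφ.mapsTo i ⟨hz, hzW⟩)
  have hc2 : bodyMap (τ' i (ψ.src c)) (bodyMap (F i) z) ∈ ψ.dom c := hc2
  have hy : basePt par (bodyMap (F i) z) ∈ M.overlap i (ψ.src c) := hc1.1
  have hgτ' := hτ'.germ i (ψ.src c) _ hy
  have hgψ : IsGerm (ψ.map c) (bodyMap (τ' i (ψ.src c)) (bodyMap (F i) z)) :=
    (hψ.smooth c).isGerm (hψ.isOpen_dom c) hc2
  have hgG := hgτ'.comp hgψ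
  have hgC := hg.comp hgG
  -- Returned to chart `i`, the composite with the inverse map is the identity on a whole
  -- neighbourhood, as needed in order to differentiate it.
  have hev : ∀ᶠ z' in 𝓝 z,
      bodyMap (par' := dbl par)
        (fun a => pull (F i) (pull (τ' i (ψ.src c)) (ψ.map c a))) z' ∈
          {w | basePt par w ∈ M.overlap (ψ.tgt c) i} ∧
      ∀ b, pull (par' := dbl par) (fun a => pull (F i) (pull (τ' i (ψ.src c)) (ψ.map c a)))
        (τ (ψ.tgt c) i b) z' = coord (dbl par) b z' := by
    filter_upwards [(isOpen_basePt (hM.isOpen_dom i)).mem_nhds hz, (W.isOpen i).mem_nhds hzW,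
      hg.eventually_bodyMap ((isOpen_basePt (hM.isOpen_overlap i (ψ.src c))).mem_nhds hy),
      hg.eventually_bodyMap ((W'.isOpen i).mem_nhds (hφ.mapsTo i ⟨hz, hzW⟩)),
      hg.eventually_bodyMap (hgτ'.eventually_bodyMap ((hψ.isOpen_dom c).mem_nhds hc2))]
      with z' h1 h2 h3 h4 h5
    have hs : bodyMap (τ i i) z' = z' := hτ.bodyMap_self h1
    have h6 := hag (i, c) i z' ⟨⟨h1, h2⟩, ⟨h3, h4⟩, h5⟩
      ⟨by change basePt par z' ∈ M.overlap i i; rwa [hM.overlap_self], h2⟩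
      (by change bodyMap (τ i i) z' ∈ W.carrier i; rwa [hs])
    refine ⟨h6.1.1, fun b => (h6.2 b).trans ?_⟩
    change pull (τ i i) (coord (dbl par) b) z' = _
    rw [pull_congr_left fun b => hτ.self i b z' h1, pull_id]
  have h1 := bJ_pull hgC (hτ.germ _ _ _ hev.self_of_nhds.1)
  rw [bJ_congr (F' := coord (dbl par)) fun b => hev.mono fun z' h => h.2 b, bJ_coord,
    bJ_pull hg hgG, mul_assoc] at h1
  exact IsUnit.of_mul_eq_one _ h1.symm

end IsFibreMap

end FibreMap

end Super

end

noncomputable section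

namespace Super

open Filter Topology
open scoped ContDiff

theorem SuperMap.IsMorphism.restrict {A : Type v} {B : Type w} {par : A → ZMod 2}
    {par' : B → ZMod 2} [Fintype A] [Fintype B] [DecidableEq A] [DecidableEq B]
    {M : SuperAtlas.{u} par} {N : SuperAtlas.{u} par'} {φ : SuperMap M N} (hφ : φ.IsMorphism)
    (W : M.OpenSub) (W' : N.OpenSub)
    (h : ∀ c, Set.MapsTo (bodyMap (φ.map c)) (φ.dom c ∩ W.carrier (φ.src c))
      (W'.carrier (φ.tgt c))) : (φ.restrict W W').IsMorphism where
  isOpen_dom c := (hφ.isOpen_dom c).inter (W.isOpen _)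
  dom_subset _ _ hx := hx.2
  cover i x hx := by
    obtain ⟨c, h1, h2⟩ := hφ.cover i x (W.subset i hx)
    exact ⟨c, ⟨h1, hx⟩, h2, (W.compat _ _ x h1).mp hx⟩
  smooth c := ⟨fun b => ((hφ.smooth c).smooth b).mono Set.inter_subset_left,
    fun b x hx => (hφ.smooth c).parity b x hx.1⟩
  mapsTo := h
  agree c c' x hx ho hx' := by
    obtain ⟨h1, h2⟩ := hφ.agree c c' x hx.1 ho.1 hx'.1
    exact ⟨⟨h1, h c hx⟩, h2⟩

/-! ### Gluing the inverses in the charts -/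

section FibreMap

variable {A : Type v} {par : A → ZMod 2} [Fintype A] [DecidableEq A] {M : SuperAtlas.{u} par}
  {τ τ' : M.ι → M.ι → SMap (dbl par) (dbl par)} {F : M.ι → SMap (dbl par) (dbl par)}

/-- A map over `M` restricts to a diffeomorphism onto its image from an open set on which it is
injective with invertible differential. -/
theorem IsFibreMap.isDiffeo_restrict (hF : IsFibreMap M τ τ' F) (hτ : IsBundle M τ)
    (hτ' : IsBundle M τ') (hM : M.IsSupermanifold) (W : (total M τ).OpenSub)
    (hinj : ∀ i : M.ι, Set.InjOn (bodyMap (F i)) (W.carrier i))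
    (hJ : ∀ i : M.ι, ∀ z ∈ W.carrier i, IsUnit (bJ (F i) z)) :
    ∃ W' : (total M τ').OpenSub, ((fibreMap M τ τ' F).restrict W W').IsDiffeo := by
  have hdom : ∀ {i : M.ι} {z : Ev (dbl par)}, z ∈ W.carrier i → basePt par z ∈ M.dom i :=
    fun {i z} hz => W.subset i hz
  have hFg : ∀ {i : M.ι} {z : Ev (dbl par)}, z ∈ W.carrier i → IsGerm (F i) z :=
    fun hz => hF.germ _ _ (hdom hz)
  have hcompat : ∀ {i j : M.ι} {z : Ev (dbl par)}, basePt par z ∈ M.overlap i j →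
      (z ∈ W.carrier i ↔ bodyMap (τ i j) z ∈ W.carrier j) := fun {i j z} hz => W.compat i j z hz
  -- The inverse is constructed separately in each chart; compatibility is deduced below from the
  -- intertwining relations.
  choose G hGg hGm hFG hGF using fun i : M.ι => exists_inverse (W.isOpen i)
    (fun z hz => hFg hz) (hinj i) (hJ i)
  have hFGb : ∀ {i : M.ι} {y : Ev (dbl par)}, y ∈ bodyMap (F i) '' W.carrier i →
      bodyMap (F i) (bodyMap (G i) y) = y := by
    intro i y hy
    rw [← bodyMap_pull (F i) (hGg i y hy).mem, bodyMap_congr (hGF i y hy), bodyMap_coord]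
  have hGbase : ∀ {i : M.ι} {y : Ev (dbl par)}, y ∈ bodyMap (F i) '' W.carrier i →
      basePt par (bodyMap (G i) y) = basePt par y := by
    intro i y hy
    rw [← hF.basePt_eq i, hFGb hy]
  let W' : (total M τ').OpenSub :=
    { carrier := fun i => bodyMap (F i) '' W.carrier i
      isOpen := fun i => isOpen_image_bodyMap (W.isOpen i) (fun z hz => hFg hz) (hinj i) (hJ i)
      subset := by
        rintro i _ ⟨z, hz, rfl⟩
        change basePt par (bodyMap (F i) z) ∈ M.dom i
        rw [hF.basePt_eq i z]
        exact hdom hz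
      compat := by
        intro (i : M.ι) (j : M.ι) y (hy : basePt par y ∈ M.overlap i j)
        change y ∈ bodyMap (F i) '' W.carrier i ↔ bodyMap (τ' i j) y ∈ bodyMap (F j) '' W.carrier j
        constructor
        · rintro ⟨z, hz, rfl⟩
          rw [hF.basePt_eq] at hy
          exact ⟨_, (hcompat hy).mp hz, (hF.bodyMap_comm hτ hM hy).symm⟩
        · rintro ⟨w, hw, hwy⟩
          have hb : basePt par w ∈ M.overlap j i := by
            rw [← hF.basePt_eq j, hwy, hτ'.basePt_trans]
            exact hM.mapsTo i j hy
          refine ⟨_, (hcompat hb).mp hw, ?_⟩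
          rw [← hF.bodyMap_comm hτ hM hb, hwy, hτ'.bodyMap_inv hM hy] }
  -- `F_i^* τ'^* G_j^*` is the coordinate change of the source bundle
  have key : ∀ {i j : M.ι} {z : Ev (dbl par)}, z ∈ W.carrier i → basePt par z ∈ M.overlap i j →
      ∀ b, pull (F i) (pull (τ' i j) (G j b)) z = τ i j b z := by
    intro i j z hz ho b
    have hzj := (hcompat ho).mp hz
    have hgτ' : IsGerm (τ' i j) (bodyMap (F i) z) := hτ'.germ i j _ (by rwa [hF.basePt_eq])
    have hgG : Sm (G j b) (bodyMap (F j) (bodyMap (τ i j) z)) :=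
      (hGg j _ ⟨_, hzj, rfl⟩).smooth b
    have hcomm := hF.bodyMap_comm hτ hM ho
    rw [pull_pull (hFg hz) hgτ' (by rwa [hcomm]),
      pull_congr_left (F' := fun c => pull (τ i j) (F j c)) (hF.intertwine i j z ho),
      ← pull_pull (hτ.germ i j z ho) (hFg hzj) hgG]
    have h1 : pull (F j) (G j b) =ᶠ[𝓝 (bodyMap (τ i j) z)] coord (dbl par) b := by
      filter_upwards [(W.isOpen j).mem_nhds hzj] with w hw using hFG j w hw b
    rw [pull_congr h1, pull_coord (hτ.germ i j z ho).mem]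
  have hWt : ∀ {i j : M.ι} {y : Ev (dbl par)}, y ∈ W'.carrier i → basePt par y ∈ M.overlap i j →
      bodyMap (τ' i j) y ∈ W'.carrier j := fun {i j y} hy ho => (W'.compat i j y ho).mp hy
  -- Pulling `key` back by `G i` cancels `F i` and yields compatibility of the local inverses with
  -- the coordinate changes.
  have key' : ∀ {i j : M.ι} {y : Ev (dbl par)}, y ∈ W'.carrier i → basePt par y ∈ M.overlap i j →
      ∀ b, pull (G i) (τ i j b) y = pull (τ' i j) (G j b) y := by
    intro i j y hy ho b
    have hgG := hGg i y hy
    have ho' : basePt par (bodyMap (G i) y) ∈ M.overlap i j := by rwa [hGbase hy]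
    have hgτ' := hτ'.germ i j y ho
    have hs : Sm (pull (τ' i j) (G j b)) y := Sm.pull hgτ' ((hGg j _ (hWt hy ho)).smooth b)
    have h1 : pull (F i) (pull (τ' i j) (G j b)) =ᶠ[𝓝 (bodyMap (G i) y)] τ i j b := by
      filter_upwards [(W.isOpen i).mem_nhds (hGm i hy),
        eventually_basePt (hM.eventually_overlap ho')] with z hz hzo using key hz hzo b
    rw [← pull_congr h1, pull_pull hgG (hFg (hGm i hy)) (by rwa [hFGb hy]),
      pull_congr_left (F' := coord (dbl par)) (hGF i y hy), pull_id]
  have key'' : ∀ {i j : M.ι} {y : Ev (dbl par)}, y ∈ W'.carrier i → basePt par y ∈ M.overlap i j →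
      ∀ b, pull (G i) (pull (τ i j) (F j b)) y = τ' i j b y := by
    intro i j y hy ho b
    have hgG := hGg i y hy
    have ho' : basePt par (bodyMap (G i) y) ∈ M.overlap i j := by rwa [hGbase hy]
    have h1 : pull (τ i j) (F j b) =ᶠ[𝓝 (bodyMap (G i) y)] pull (F i) (τ' i j b) := by
      filter_upwards [eventually_basePt (hM.eventually_overlap ho')] with z hzo
        using (hF.intertwine i j z hzo b).symm
    rw [pull_congr h1, pull_pull hgG (hFg (hGm i hy))
      (by rw [hFGb hy]; exact (hτ'.germ i j y ho).smooth b),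
      pull_congr_left (F' := coord (dbl par)) (hGF i y hy), pull_id]
  let ψ : SuperMap ((total M τ').restrict W') ((total M τ).restrict W) :=
    { κ := M.ι
      src := fun i => i
      tgt := fun i => i
      dom := W'.carrier
      map := G }
  refine ⟨W', (hF.isMorphism hτ hM).restrict W W' fun i z hz => ⟨z, hz.2, rfl⟩, ψ, ?_, ?_, ?_⟩
  · exact
      { isOpen_dom := W'.isOpen
        dom_subset := fun _ => subset_rfl
        cover := by
          intro (i : M.ι) (y : Ev (dbl par)) (hy : y ∈ W'.carrier i)
          have hyd : basePt par y ∈ M.dom i := W'.subset i hy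
          refine ⟨i, ⟨?_, hy⟩, ?_⟩
          · change basePt par y ∈ M.overlap i i
            rwa [hM.overlap_self]
          · change bodyMap (τ' i i) y ∈ W'.carrier i
            rwa [hτ'.bodyMap_self hyd]
        smooth := fun i => smoothOn_of_isGerm fun y hy => hGg i y hy
        mapsTo := hGm
        agree := by
          intro (i : M.ι) (j : M.ι) (y : Ev (dbl par)) (hy : y ∈ W'.carrier i) ho _
          have ho1 : basePt par y ∈ M.overlap i j := ho.1
          refine ⟨⟨?_, hGm i hy⟩, key' hy ho1⟩
          change basePt par (bodyMap (G i) y) ∈ M.overlap i j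
          rwa [hGbase hy] }
  -- The composite applies `F i`, changes to chart `j` and applies `G j`; it is compared with the
  -- identity in chart `k`. By `key` this is the cocycle relation for `i`, `j`, `k`.
  · rintro ⟨i, j⟩ k z ⟨hz, hy, -⟩ ⟨hk, -⟩ -
    change M.ι at i j k
    have hzW : z ∈ W.carrier i := hz.2
    have hij : basePt par z ∈ M.overlap i j := by
      have h : basePt par (bodyMap (F i) z) ∈ M.overlap i j := hy.1
      rwa [hF.basePt_eq] at h
    have hik : basePt par z ∈ M.overlap i k := hk
    have hjk : bodyMap (M.trans i j) (basePt par z) ∈ M.overlap j k :=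
      hM.cocycle_mem (hM.mapsTo i j hij) (by rwa [hM.bodyMap_inv hij])
    have hc : ∀ b, pull (F i) (pull (τ' i j) (G j b)) z = τ i j b z := key hzW hij
    have hb : bodyMap (par' := dbl par) (fun b => pull (F i) (pull (τ' i j) (G j b))) z =
      bodyMap (τ i j) z := bodyMap_congr hc
    refine ⟨⟨?_, ?_⟩, fun b => ?_⟩
    · change basePt par (bodyMap (par' := dbl par)
        (fun b => pull (F i) (pull (τ' i j) (G j b))) z) ∈ M.overlap j k
      rwa [hb, hτ.basePt_trans]
    · change bodyMap (par' := dbl par)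
        (fun b => pull (F i) (pull (τ' i j) (G j b))) z ∈ W.carrier j
      rw [hb]
      exact (hcompat hij).mp hzW
    · change pull (par' := dbl par) (fun b => pull (F i) (pull (τ' i j) (G j b))) (τ j k b) z =
        pull (τ i k) (coord (dbl par) b) z
      rw [pull_congr_left (F' := τ i j) hc, hτ.cocycle i j k z hij hjk,
        pull_coord (hτ.germ i k z hik).mem]
  · rintro ⟨i, j⟩ k y ⟨hy, hz, -⟩ ⟨hk, -⟩ -
    change M.ι at i j k
    have hyW : y ∈ W'.carrier i := hy
    have hij : basePt par y ∈ M.overlap i j := by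
      have h : basePt par (bodyMap (G i) y) ∈ M.overlap i j := hz.1
      rwa [hGbase hy] at h
    have hik : basePt par y ∈ M.overlap i k := hk
    have hjk : bodyMap (M.trans i j) (basePt par y) ∈ M.overlap j k :=
      hM.cocycle_mem (hM.mapsTo i j hij) (by rwa [hM.bodyMap_inv hij])
    have hc : ∀ b, pull (G i) (pull (τ i j) (F j b)) y = τ' i j b y := key'' hyW hij
    have hb : bodyMap (par' := dbl par) (fun b => pull (G i) (pull (τ i j) (F j b))) y =
      bodyMap (τ' i j) y := bodyMap_congr hc
    refine ⟨⟨?_, ?_⟩, fun b => ?_⟩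
    · change basePt par (bodyMap (par' := dbl par)
        (fun b => pull (G i) (pull (τ i j) (F j b))) y) ∈ M.overlap j k
      rwa [hb, hτ'.basePt_trans]
    · change bodyMap (par' := dbl par)
        (fun b => pull (G i) (pull (τ i j) (F j b))) y ∈ W'.carrier j
      rw [hb]
      exact hWt hyW hij
    · change pull (par' := dbl par) (fun b => pull (G i) (pull (τ i j) (F j b))) (τ' j k b) y =
        pull (τ' i k) (coord (dbl par) b) y
      rw [pull_congr_left (F' := τ' i j) hc, hτ'.cocycle i j k y hij hjk,
        pull_coord (hτ'.germ i k y hik).mem]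

end FibreMap

end Super

end

noncomputable section

namespace Super

open Filter Topology
open scoped ContDiff

/-! ### Paracompactness of the underlying space -/

section Topology

variable {A : Type v} {par : A → ZMod 2} [Fintype A] [DecidableEq A] {M : SuperAtlas.{u} par}

/-- The gluing relation of an atlas. -/
def SuperAtlas.Glued (M : SuperAtlas.{u} par) (p q : Σ i, M.dom i) : Prop :=
  p.2.1 ∈ M.overlap p.1 q.1 ∧ bodyMap (M.trans p.1 q.1) p.2.1 = q.2.1

/-- The projection of the chart domains to the underlying space. -/
def SuperAtlas.toBody (M : SuperAtlas.{u} par) (p : Σ i, M.dom i) : M.Body := Quot.mk _ p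

omit [Fintype A] [DecidableEq A] in
theorem SuperAtlas.isQuotientMap_toBody (M : SuperAtlas.{u} par) :
    IsQuotientMap M.toBody := isQuotientMap_quot_mk

namespace SuperAtlas.IsSupermanifold

theorem equivalence_glued (hM : M.IsSupermanifold) : Equivalence M.Glued where
  refl p := ⟨by rw [hM.overlap_self]; exact p.2.2, hM.bodyMap_self p.2.2⟩
  symm {p q} h := by
    obtain ⟨h1, h2⟩ := h
    rw [Glued, ← h2]
    exact ⟨hM.mapsTo _ _ h1, hM.bodyMap_inv h1⟩
  trans {p q r} h h' := by
    obtain ⟨h1, h2⟩ := h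
    obtain ⟨h3, h4⟩ := h'
    rw [← h2] at h3 h4
    exact ⟨hM.cocycle_mem h1 h3, by rw [← hM.cocycle_body h1 h3, h4]⟩

theorem toBody_eq_iff (hM : M.IsSupermanifold) {p q : Σ i, M.dom i} :
    M.toBody p = M.toBody q ↔ M.Glued p q :=
  ⟨fun h => hM.equivalence_glued.eqvGen_iff.mp (Quot.eqvGen_exact h), fun h => Quot.sound h⟩

/-- Near a point of the saturation of an open set, that saturation contains a preimage of the set
under a coordinate change, which is continuous. -/
theorem isOpenQuotientMap_toBody (hM : M.IsSupermanifold) : IsOpenQuotientMap M.toBody := by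
  refine ⟨M.isQuotientMap_toBody.surjective, M.isQuotientMap_toBody.continuous, fun U hU => ?_⟩
  rw [← M.isQuotientMap_toBody.isOpen_preimage, isOpen_iff_mem_nhds]
  rintro q ⟨p, hp, hpq⟩
  obtain ⟨h1, h2⟩ := hM.toBody_eq_iff.mp hpq.symm
  obtain ⟨i, x⟩ := p
  obtain ⟨j, y⟩ := q
  have hU' : IsOpen ((↑) '' (Sigma.mk i ⁻¹' U) : Set (Ev par)) :=
    (hM.isOpen_dom i).isOpenMap_subtype_val _ (isOpen_sigma_iff.mp hU i)
  have h3 : ∀ᶠ y' in 𝓝 (y : Ev par), y' ∈ M.overlap j i ∧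
      bodyMap (M.trans j i) y' ∈ ((↑) '' (Sigma.mk i ⁻¹' U) : Set (Ev par)) :=
    (hM.eventually_overlap h1).and ((hM.germ h1).eventually_bodyMap
      (hU'.mem_nhds ⟨x, hp, h2.symm⟩))
  have h4 : ∀ᶠ y' in 𝓝 y, (⟨j, y'⟩ : Σ i, M.dom i) ∈ M.toBody ⁻¹' (M.toBody '' U) := by
    filter_upwards [continuous_subtype_val.continuousAt.eventually h3] with y' h
    obtain ⟨h5, x', hx', h6⟩ := h
    exact ⟨⟨i, x'⟩, hx', (hM.toBody_eq_iff.mpr ⟨h5, h6.symm⟩).symm⟩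
  rw [Sigma.nhds_mk, Filter.mem_map]
  exact h4

/-- Local compactness passes from the charts through an open quotient map. Together with the
Hausdorff property and second countability it gives paracompactness. -/
theorem weaklyLocallyCompactSpace_body (hM : M.IsSupermanifold) :
    WeaklyLocallyCompactSpace M.Body := by
  have : ∀ i, LocallyCompactSpace (M.dom i) := fun i => (hM.isOpen_dom i).locallyCompactSpace
  have : WeaklyLocallyCompactSpace (Σ i, M.dom i) := ⟨fun ⟨i, x⟩ => by
    obtain ⟨C, hC, hx⟩ := exists_compact_mem_nhds x
    exact ⟨Sigma.mk i '' C, hC.image continuous_sigmaMk, isOpenMap_sigmaMk.image_mem_nhds hx⟩⟩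
  exact hM.isOpenQuotientMap_toBody.weaklyLocallyCompactSpace

/-- A cover by neighbourhoods in the charts has a closed locally finite refinement. -/
theorem exists_locallyFinite_refinement (hM : M.IsSupermanifold)
    (V : (Σ i, M.dom i) → Set (Ev par)) (hV : ∀ p, V p ∈ 𝓝 (p.2 : Ev par)) :
    ∃ K : (Σ i, M.dom i) → M.ι → Set (Ev par),
      (∀ p i, ∀ x ∈ M.dom i, x ∉ K p i → ∀ᶠ y in 𝓝 x, y ∉ K p i) ∧
      (∀ i, ∀ x ∈ M.dom i, ∃ s : Set (Σ i, M.dom i), s.Finite ∧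
        ∀ᶠ y in 𝓝 x, ∀ p, y ∈ K p i → p ∈ s) ∧
      (∀ p i j, ∀ x ∈ M.overlap i j, x ∈ K p i ↔ bodyMap (M.trans i j) x ∈ K p j) ∧
      (∀ p i, ∀ x ∈ K p i, x ∈ M.overlap i p.1 ∧ bodyMap (M.trans i p.1) x ∈ V p) ∧
      ∀ i, ∀ x ∈ M.dom i, ∃ p, x ∈ K p i := by
  have := hM.weaklyLocallyCompactSpace_body
  have := hM.t2
  have := hM.secondCountable
  have hπ := hM.isOpenQuotientMap_toBody
  let O : (Σ i, M.dom i) → Set M.Body := fun p =>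
    M.toBody '' (Sigma.mk p.1 '' ((↑) ⁻¹' interior (V p)))
  have hO : ∀ p, IsOpen (O p) := fun p => hπ.isOpenMap _
    (isOpenMap_sigmaMk _ (isOpen_interior.preimage continuous_subtype_val))
  have hmem : ∀ p, M.toBody p ∈ O p := fun p =>
    ⟨p, ⟨p.2, mem_interior_iff_mem_nhds.mpr (hV p), rfl⟩, rfl⟩
  have hcov : ⋃ p, O p = Set.univ := Set.eq_univ_of_forall fun b => by
    obtain ⟨p, rfl⟩ := hπ.surjective b
    exact Set.mem_iUnion.mpr ⟨p, hmem p⟩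
  -- An open locally finite refinement is shrunk to a closed one by normality. The sets `K p i` are
  -- its traces in the charts.
  obtain ⟨v, hvo, hvc, hvf, hvO⟩ := precise_refinement O hO hcov
  obtain ⟨k, hkc, hkcl, hkv⟩ := exists_iUnion_eq_closed_subset hvo hvf.point_finite hvc
  have hkf : LocallyFinite k := hvf.subset hkv
  have hnear : ∀ {i : M.ι} {x : Ev par} (hx : x ∈ M.dom i) {q : M.Body → Prop},
      (∀ᶠ b in 𝓝 (M.toBody ⟨i, x, hx⟩), q b) →
      ∀ᶠ y in 𝓝 x, ∀ hy : y ∈ M.dom i, q (M.toBody ⟨i, y, hy⟩) := by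
    intro i x hx q hq
    have h1 : ContinuousAt (fun y : M.dom i => M.toBody ⟨i, y⟩) ⟨x, hx⟩ :=
      (hπ.continuous.comp continuous_sigmaMk).continuousAt
    have h2 := h1.eventually hq
    rw [nhds_subtype_eq_comap, Filter.eventually_comap] at h2
    filter_upwards [h2] with y hy hyd using hy ⟨y, hyd⟩ rfl
  refine ⟨fun p i => {x | ∃ h : x ∈ M.dom i, M.toBody ⟨i, x, h⟩ ∈ k p}, ?_, ?_, ?_, ?_, ?_⟩
  · intro p i x hx hxK
    have h1 : M.toBody ⟨i, x, hx⟩ ∉ k p := fun h => hxK ⟨hx, h⟩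
    filter_upwards [hnear hx ((hkcl p).isOpen_compl.mem_nhds h1)] with y hy hyK
    exact hy hyK.1 hyK.2
  · intro i x hx
    obtain ⟨t, ht, hf⟩ := hkf (M.toBody ⟨i, x, hx⟩)
    refine ⟨_, hf, ?_⟩
    filter_upwards [hnear hx ht] with y hy p hyK
    exact ⟨_, hyK.2, hy hyK.1⟩
  · intro p i j x hx
    have hxi := hM.overlap_subset i j hx
    have hxj := hM.overlap_subset j i (hM.mapsTo i j hx)
    have h1 : M.toBody ⟨i, x, hxi⟩ = M.toBody ⟨j, bodyMap (M.trans i j) x, hxj⟩ :=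
      hM.toBody_eq_iff.mpr ⟨hx, rfl⟩
    constructor
    · rintro ⟨h, hk⟩
      exact ⟨hxj, h1 ▸ hk⟩
    · rintro ⟨h, hk⟩
      exact ⟨hxi, h1 ▸ hk⟩
  · rintro p i x ⟨hx, hk⟩
    obtain ⟨_, ⟨y, hy, rfl⟩, h⟩ := hvO p (hkv p hk)
    obtain ⟨h1, h2⟩ := hM.toBody_eq_iff.mp h.symm
    exact ⟨h1, (show bodyMap (M.trans i p.1) x = y from h2) ▸ interior_subset hy⟩
  · intro i x hx
    obtain ⟨p, hp⟩ := Set.mem_iUnion.mp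
      (hkc.symm ▸ Set.mem_univ (M.toBody ⟨i, x, hx⟩) : M.toBody ⟨i, x, hx⟩ ∈ ⋃ p, k p)
    exact ⟨p, hx, hp⟩

end SuperAtlas.IsSupermanifold

end Topology

/-! ### A neighbourhood of the whole zero section -/

section Neighbourhood

variable {A : Type v} {par : A → ZMod 2} [Fintype A] [DecidableEq A] {M : SuperAtlas.{u} par}
  {τ τ' : M.ι → M.ι → SMap (dbl par) (dbl par)} {F : M.ι → SMap (dbl par) (dbl par)}

omit [Fintype A] in
theorem continuous_bodyMap_zeroSec :
    Continuous (bodyMap (par' := dbl par) (zeroSec par)) := by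
  refine continuous_pi fun b => ?_
  obtain ⟨b | b, hb⟩ := b
  · have : (fun x => bodyMap (par' := dbl par) (zeroSec par) x ⟨Sum.inl b, hb⟩) =
        fun x : Ev par => x ⟨b, hb⟩ := by
      funext x
      exact congrFun (basePt_zeroSec x) ⟨b, hb⟩
    rw [this]
    exact continuous_apply _
  · have : (fun x => bodyMap (par' := dbl par) (zeroSec par) x ⟨Sum.inr b, hb⟩) =
        fun _ => 0 := by
      funext x
      exact bodyMap_zeroSec_right x _ rfl
    rw [this]
    exact continuous_const

/-- A map over `M` whose differential is invertible along the zero section is injective with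
invertible differential on a neighbourhood of the zero section. -/
theorem IsFibreMap.exists_neighbourhood (hF : IsFibreMap M τ τ' F) (hτ : IsBundle M τ)
    (hτ' : IsBundle M τ') (hM : M.IsSupermanifold)
    (h : ∀ i z, basePt par z ∈ M.dom i → (∀ b : EvIx (dbl par), b.1.isRight → z b = 0) →
      IsUnit (bJ (F i) z)) :
    ∃ W : (total M τ).OpenSub, ContainsZeroSection W ∧
      (∀ i : M.ι, Set.InjOn (bodyMap (F i)) (W.carrier i)) ∧
      ∀ i : M.ι, ∀ z ∈ W.carrier i, IsUnit (bJ (F i) z) := by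
  let s₀ : Ev par → Ev (dbl par) := bodyMap (par' := dbl par) (zeroSec par)
  -- The classical inverse function theorem at each point of the zero section supplies a
  -- neighbourhood in its own chart.
  have h1 : ∀ p : (Σ i, M.dom i), ∃ B : Set (Ev (dbl par)), IsOpen B ∧ s₀ p.2 ∈ B ∧
      Set.InjOn (bodyMap (F p.1)) B ∧ ∀ z ∈ B, IsUnit (bJ (F p.1) z) := by
    rintro ⟨i, x, hx⟩
    have hb : basePt par (s₀ x) ∈ M.dom i := by rwa [basePt_zeroSec]
    have hg := hF.germ i (s₀ x) hb
    have hJ := h i (s₀ x) hb (bodyMap_zeroSec_right x)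
    obtain ⟨V, hV, hinj⟩ := exists_injOn_nhds hg hJ
    obtain ⟨B, hB, hBo, hxB⟩ := mem_nhds_iff.mp
      (Filter.inter_mem hV (eventually_isUnit_bJ hg hJ))
    exact ⟨B, hBo, hxB, hinj.mono fun z hz => (hB hz).1, fun z hz => (hB hz).2⟩
  choose B hBo hB0 hBinj hBJ using h1
  obtain ⟨K, hKc, hKf, hKt, hKV, hKcov⟩ := hM.exists_locallyFinite_refinement
    (fun p => s₀ ⁻¹' B p)
    fun p => (continuous_bodyMap_zeroSec.continuousAt).preimage_mem_nhds
      ((hBo p).mem_nhds (hB0 p))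
  -- A point belongs to `W` if it lies in `B p` for every `p` whose closed set `K p` contains its
  -- base point. Closedness and local finiteness make this an open condition, and it contains the
  -- zero section because `K p` lies where the zero section is in `B p`.
  let W : (total M τ).OpenSub :=
    { carrier := fun i => {z | basePt par z ∈ M.dom i ∧
        ∀ p, basePt par z ∈ K p i → bodyMap (τ i p.1) z ∈ B p}
      isOpen := by
        intro (i : M.ι)
        rw [isOpen_iff_mem_nhds]
        rintro z ⟨hz, hzB⟩
        obtain ⟨s, hs, hsK⟩ := hKf i _ hz
        have h2 : ∀ p, ∀ᶠ z' in 𝓝 z, basePt par z' ∈ K p i → bodyMap (τ i p.1) z' ∈ B p := by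
          intro p
          by_cases hp : basePt par z ∈ K p i
          · filter_upwards [(hτ.germ i p.1 z (hKV p i _ hp).1).eventually_bodyMap
              ((hBo p).mem_nhds (hzB p hp))] with z' hz' _ using hz'
          · filter_upwards [eventually_basePt (hKc p i _ hz hp)] with z' hz' h using (hz' h).elim
        filter_upwards [(isOpen_basePt (hM.isOpen_dom i)).mem_nhds hz, eventually_basePt hsK,
          (Filter.eventually_all_finite hs).mpr fun p _ => h2 p] with z' h3 h4 h5
        exact ⟨h3, fun p hp => h5 p (h4 p hp) hp⟩
      subset := fun i z hz => hz.1
      compat := by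
        intro (i : M.ι) (j : M.ι) z (hz : basePt par z ∈ M.overlap i j)
        have hy := hM.mapsTo i j hz
        change (basePt par z ∈ M.dom i ∧ _) ↔ (basePt par (bodyMap (τ i j) z) ∈ M.dom j ∧
          ∀ p, basePt par (bodyMap (τ i j) z) ∈ K p j →
            bodyMap (τ j p.1) (bodyMap (τ i j) z) ∈ B p)
        rw [hτ.basePt_trans]
        refine and_congr (iff_of_true (hM.overlap_subset i j hz) (hM.overlap_subset j i hy))
          (forall_congr' fun p => ?_)
        rw [← hKt p i j _ hz]
        refine imp_congr_right fun hp => ?_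
        rw [hτ.cocycle_body hz (hKV p j _ ((hKt p i j _ hz).mp hp)).1] }
  refine ⟨W, ?_, ?_, ?_⟩
  · intro (i : M.ι) z (hz : basePt par z ∈ M.dom i) h0
    refine ⟨hz, fun p hp => ?_⟩
    obtain ⟨h2, h3⟩ := hKV p i _ hp
    rw [Set.mem_preimage, ← hτ.basePt_trans] at h3
    rwa [← bodyMap_zeroSec (hτ.zero i p.1 z h2 h0)]
  · intro i z hz w hw hzw
    -- Equal images force equal base points, so `z` and `w` are both transported into one and the
    -- same `B p`, where the map is injective.
    have hb : basePt par w = basePt par z := by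
      rw [← hF.basePt_eq i z, hzw, hF.basePt_eq]
    obtain ⟨p, hp⟩ := hKcov i _ hz.1
    have ho := (hKV p i _ hp).1
    have ho' : basePt par w ∈ M.overlap i p.1 := by rwa [hb]
    have h2 : bodyMap (τ i p.1) z = bodyMap (τ i p.1) w := by
      refine hBinj p (hz.2 p hp) (hw.2 p (by rwa [hb])) ?_
      rw [← hF.bodyMap_comm hτ hM ho, ← hF.bodyMap_comm hτ hM ho', hzw]
    rw [← hτ.bodyMap_inv hM ho, h2, hτ.bodyMap_inv hM ho']
  · intro i z hz
    obtain ⟨p, hp⟩ := hKcov i _ hz.1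
    exact hF.isUnit_bJ_of_trans hτ hτ' hM (hKV p i _ hp).1 (hBJ p _ (hz.2 p hp))

theorem IsFibreMap.isDiffeoNearZeroSection_iff (hF : IsFibreMap M τ τ' F) (hτ : IsBundle M τ)
    (hτ' : IsBundle M τ') (hM : M.IsSupermanifold) :
    IsDiffeoNearZeroSection (fibreMap M τ τ' F) ↔
      ∀ i z, basePt par z ∈ M.dom i → (∀ b : EvIx (dbl par), b.1.isRight → z b = 0) →
        IsUnit (bJ (F i) z) := by
  refine ⟨fun h i z hz h0 => hF.isUnit_bJ_of_isDiffeo hτ hτ' hM h hz h0, fun h => ?_⟩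
  obtain ⟨W, hW, hinj, hJ⟩ := hF.exists_neighbourhood hτ hτ' hM h
  obtain ⟨W', hW'⟩ := hF.isDiffeo_restrict hτ hτ' hM W hinj hJ
  exact ⟨W, W', hW, hW'⟩

/-- Coordinatewise multiples of the fibre derivatives of an even function form a diffeomorphism
near the zero section iff the fibre Hessian is invertible. -/
theorem IsFibreMap.isDiffeoNearZeroSection_iff_fiberHessian (hF : IsFibreMap M τ τ' F)
    (hτ : IsBundle M τ) (hτ' : IsBundle M τ') (hM : M.IsSupermanifold)
    {f : M.ι → SFun (dbl par)} (hf : ∀ i z, basePt par z ∈ M.dom i → Sm (f i) z)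
    {c : A → ℝ} (hc : ∀ a, c a ≠ 0)
    (hl : ∀ i a, F i (Sum.inl a) = coord (dbl par) (Sum.inl a))
    (hr : ∀ i a, F i (Sum.inr a) = fun z => c a • pd (Sum.inr a) (f i) z) :
    IsDiffeoNearZeroSection (fibreMap M τ τ' F) ↔
      ∀ i, ∀ x ∈ M.dom i, IsUnit (fiberHessian (f i) x) := by
  rw [hF.isDiffeoNearZeroSection_iff hτ hτ' hM]
  constructor
  · intro h i x hx
    have hb : basePt par (bodyMap (par' := dbl par) (zeroSec par) x) ∈ M.dom i := by
      rwa [basePt_zeroSec]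
    have h1 := (isUnit_bJ_iff c hc (hl i) (hr i) (hf i _ hb) (bodyMap_zeroSec_right x)).mp
      (h i _ hb (bodyMap_zeroSec_right x))
    rwa [basePt_zeroSec] at h1
  · intro h i z hz h0
    exact (isUnit_bJ_iff c hc (hl i) (hr i) (hf i z hz) h0).mpr (h i _ hz)

/-- `phi M P` is definitionally a `fibreMap` between instances of `total`, and the constants `c a`
are the signs (-1)^(ã+1). -/
theorem isDiffeoNearZeroSection_phi_iff (hM : M.IsSupermanifold) {P : M.ι → SFun (dbl par)}
    (hP : (piTstar M).IsEvenFunction P) :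
    IsDiffeoNearZeroSection (phi M P) ↔
      ∀ i, ∀ x ∈ M.dom i, IsUnit (fiberHessian (P i) x) :=
  (phi_isFibreMap hM hP).isDiffeoNearZeroSection_iff_fiberHessian (piTstar_isBundle hM)
    (piT_isBundle hM) hM (fun i _ hz => hP.sm (isOpen_basePt (hM.isOpen_dom i)) hz)
    (fun _ => pow_ne_zero _ (by norm_num)) (fun _ _ => rfl) (fun _ _ => rfl)

theorem isDiffeoNearZeroSection_psi_iff (hM : M.IsSupermanifold) {f : M.ι → SFun (dbl par)}
    (hf : (piT M).IsEvenFunction f) :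
    IsDiffeoNearZeroSection (psi M f) ↔
      ∀ i, ∀ x ∈ M.dom i, IsUnit (fiberHessian (f i) x) :=
  (psi_isFibreMap hM hf).isDiffeoNearZeroSection_iff_fiberHessian (piT_isBundle hM)
    (piTstar_isBundle hM) hM (fun i _ hz => hf.sm (isOpen_basePt (hM.isOpen_dom i)) hz)
    (c := fun _ => 1) (fun _ => one_ne_zero) (fun _ _ => rfl)
    (fun _ _ => funext fun _ => (one_smul ℝ _).symm)

end Neighbourhood

end Super

end

theorem proposition1 {A : Type v} [Fintype A] [DecidableEq A] (par : A → ZMod 2)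
    (M : Super.SuperAtlas.{u} par) (hM : M.IsSupermanifold) :
    (∀ P : M.ι → Super.SFun (Super.dbl par), (Super.piTstar M).IsEvenFunction P →
      (Super.phi M P).IsMorphism ∧
      ((∀ i, ∀ x ∈ M.dom i, IsUnit (Super.fiberHessian (P i) x)) →
        Super.IsDiffeoNearZeroSection (Super.phi M P))) ∧
    (∀ ω : M.ι → Super.SFun (Super.dbl par), (Super.piT M).IsEvenFunction ω →
      (Super.psi M ω).IsMorphism ∧
      (Super.IsDiffeoNearZeroSection (Super.psi M ω) ↔
        ∀ i, ∀ x ∈ M.dom i, IsUnit (Super.fiberHessian (ω i) x))) :=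
  ⟨fun _ hP => ⟨(Super.phi_isFibreMap hM hP).isMorphism (Super.piTstar_isBundle hM) hM,
      (Super.isDiffeoNearZeroSection_phi_iff hM hP).mpr⟩,
    fun _ hω => ⟨(Super.psi_isFibreMap hM hω).isMorphism (Super.piT_isBundle hM) hM,
      Super.isDiffeoNearZeroSection_psi_iff hM hω⟩⟩
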